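/- **Theorem.** Let $p>0$ be real. A *clique partition* of a finite simple graph $G=(V,E)$ with $n$ vertices is a map $\varphi:V\to\mathbb N$ such that any two distinct vertices with the same value are adjacent. Put $a_v=|\varphi^{-1}(\varphi(v))|$. The *maximum $p$-mean clique partition problem* is to find a clique partition that maximizes $$M_p(\{a_v:v\in V\})=\Bigl(\tfrac1n\sum_{v\in V}a_v^{\,p}\Bigr)^{1/p}.$$ The *maximum-edge clique partition problem* (Max-ECP) is to find a clique partition that maximizes the number of edges of $G$ whose two endpoints have the same value of $\varphi$. An *interval graph* is the intersection graph of a finite family of closed intervals of the real line. 1. The maximum $p$-mean clique partition problem can be solved in $O(n^3)$ time on interval graphs. Precisely: there are a program for a unit-cost random access machine and constants $C,k$, none of which depends on $p$, such that for every $p>0$ and every interval graph $G$ with vertex set $\{0,\dots,n-1\}$, given only by its adjacency matrix (no interval representation is supplied), the program halts after at most $C(n^3+1)$ steps and outputs an optimal clique partition $\varphi$. The integers handled by the machine are bounded by $(n+2)^k$ (words of $O(\log n)$ bits). Besides the operations on words (addition, subtraction, multiplication, comparison, indirect addressing), the machine adds and compares exact real numbers and evaluates $c\mapsto c^{p+1}$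 for a word $c$, each at unit cost. 2. Consequently, Max-ECP can be solved in $O(n^3)$ time on interval graphs, in the same sense, by a program that uses operations on words only. -/

import Mathlib

open scoped BigOperators

namespace PMean

/-! ### Interval graphs and clique partitions -/

/-- `G` is the intersection graph of a family of closed intervals `[l v, r v]` of the real line. -/
def IsIntervalGraph {V : Type*} (G : SimpleGraph V) : Prop :=
  ∃ l r : V → ℝ, (∀ v, l v ≤ r v) ∧
    ∀ u v, u ≠ v → (G.Adj u v ↔ (Set.Icc (l u) (r u) ∩ Set.Icc (l v) (r v)).Nonempty)

/-- A partition of the vertices into cliques, given by the labels of its parts: two distinct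
vertices with the same label are adjacent. -/
def IsCliquePartition {V : Type*} (G : SimpleGraph V) (φ : V → ℕ) : Prop :=
  ∀ u v, u ≠ v → φ u = φ v → G.Adj u v

/-- `a_v`, the number of vertices in the part that contains `v`. -/
def partSize {V : Type*} [Fintype V] (φ : V → ℕ) (v : V) : ℕ :=
  (Finset.univ.filter fun w => φ w = φ v).card

/-- The generalized mean `M_p` of a finite family of numbers. -/
noncomputable def genMean {V : Type*} [Fintype V] (p : ℝ) (a : V → ℝ) : ℝ :=
  ((1 / (Fintype.card V : ℝ)) * ∑ v, a v ^ p) ^ (1 / p)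

/-- The objective value `M_p ({a_v : v ∈ V})` of a partition. -/
noncomputable def pMeanValue {V : Type*} [Fintype V] (p : ℝ) (φ : V → ℕ) : ℝ :=
  genMean p fun v => (partSize φ v : ℝ)

/-- `φ` is an optimal solution of the maximum `p`-mean clique partition problem on `G`. -/
def IsMaxPMeanCliquePartition {V : Type*} [Fintype V] (p : ℝ) (G : SimpleGraph V)
    (φ : V → ℕ) : Prop :=
  IsCliquePartition G φ ∧ ∀ ψ, IsCliquePartition G ψ → pMeanValue p ψ ≤ pMeanValue p φ

/-- The number of edges of `G` whose endpoints are in the same part. -/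
noncomputable def edgesInside {V : Type*} (G : SimpleGraph V) (φ : V → ℕ) : ℕ :=
  {e ∈ G.edgeSet | ∀ u ∈ e, ∀ v ∈ e, φ u = φ v}.ncard

/-- `φ` is an optimal solution of the maximum-edge clique partition problem on `G`. -/
def IsMaxEdgeCliquePartition {V : Type*} (G : SimpleGraph V) (φ : V → ℕ) : Prop :=
  IsCliquePartition G φ ∧ ∀ ψ, IsCliquePartition G ψ → edgesInside G ψ ≤ edgesInside G φ

/-! ### The machine model

A random access machine with structured programs. The memory holds finitely many named word
variables and word arrays, whose cells are natural numbers bounded by a word bound `W`, and real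
variables and real arrays, whose cells are exact real numbers. Words can be added, subtracted
(truncated), multiplied, compared, and used as array indices. Reals can only be moved, added,
compared, and produced by the unit that maps a word `c` to the real number `f c`; no information
flows from reals to words other than through comparisons. -/

/-- The contents of the memory. -/
structure Mem where
  wvar : ℕ → ℕ
  warr : ℕ → ℕ → ℕ
  rvar : ℕ → ℝ
  rarr : ℕ → ℕ → ℝ

/-- Word expressions. `get a e` is the cell with index `e` of the word array `a`. -/
inductive WExpr where
  | lit (c : ℕ)
  | var (x : ℕ)
  | get (a : ℕ) (e : WExpr)
  | add (e₁ e₂ : WExpr)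
  | sub (e₁ e₂ : WExpr)
  | mul (e₁ e₂ : WExpr)

namespace WExpr

def eval (s : Mem) : WExpr → ℕ
  | lit c => c
  | var x => s.wvar x
  | get a e => s.warr a (e.eval s)
  | add e₁ e₂ => e₁.eval s + e₂.eval s
  | sub e₁ e₂ => e₁.eval s - e₂.eval s
  | mul e₁ e₂ => e₁.eval s * e₂.eval s

/-- The evaluation causes no overflow: every literal and every intermediate result is at
most `W`. -/
def Fits (W : ℕ) (s : Mem) : WExpr → Prop
  | lit c => c ≤ W
  | var _ => True
  | get _ e => e.Fits W s
  | add e₁ e₂ => e₁.Fits W s ∧ e₂.Fits W s ∧ e₁.eval s + e₂.eval s ≤ W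
  | sub e₁ e₂ => e₁.Fits W s ∧ e₂.Fits W s
  | mul e₁ e₂ => e₁.Fits W s ∧ e₂.Fits W s ∧ e₁.eval s * e₂.eval s ≤ W

/-- The cost of an evaluation: one step for each elementary operation. -/
def cost : WExpr → ℕ
  | lit _ => 1
  | var _ => 1
  | get _ e => e.cost + 1
  | add e₁ e₂ => e₁.cost + e₂.cost + 1
  | sub e₁ e₂ => e₁.cost + e₂.cost + 1
  | mul e₁ e₂ => e₁.cost + e₂.cost + 1

end WExpr

/-- Real expressions. `unit e` is the real number `f c`, where `c` is the value of the word
expression `e` and `f` is the function computed by the unit of the machine. -/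
inductive RExpr where
  | var (x : ℕ)
  | get (a : ℕ) (e : WExpr)
  | unit (e : WExpr)
  | add (r₁ r₂ : RExpr)

namespace RExpr

def eval (f : ℕ → ℝ) (s : Mem) : RExpr → ℝ
  | var x => s.rvar x
  | get a e => s.rarr a (e.eval s)
  | unit e => f (e.eval s)
  | add r₁ r₂ => r₁.eval f s + r₂.eval f s

def Fits (W : ℕ) (s : Mem) : RExpr → Prop
  | var _ => True
  | get _ e => e.Fits W s
  | unit e => e.Fits W s
  | add r₁ r₂ => r₁.Fits W s ∧ r₂.Fits W s

def cost : RExpr → ℕ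
  | var _ => 1
  | get _ e => e.cost + 1
  | unit e => e.cost + 1
  | add r₁ r₂ => r₁.cost + r₂.cost + 1

end RExpr

/-- Tests. -/
inductive Test where
  | wle (e₁ e₂ : WExpr)
  | rle (r₁ r₂ : RExpr)
  | neg (b : Test)
  | conj (b₁ b₂ : Test)

namespace Test

def Holds (f : ℕ → ℝ) (s : Mem) : Test → Prop
  | wle e₁ e₂ => e₁.eval s ≤ e₂.eval s
  | rle r₁ r₂ => r₁.eval f s ≤ r₂.eval f s
  | neg b => ¬ b.Holds f s
  | conj b₁ b₂ => b₁.Holds f s ∧ b₂.Holds f s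

def Fits (W : ℕ) (s : Mem) : Test → Prop
  | wle e₁ e₂ => e₁.Fits W s ∧ e₂.Fits W s
  | rle r₁ r₂ => r₁.Fits W s ∧ r₂.Fits W s
  | neg b => b.Fits W s
  | conj b₁ b₂ => b₁.Fits W s ∧ b₂.Fits W s

def cost : Test → ℕ
  | wle e₁ e₂ => e₁.cost + e₂.cost + 1
  | rle r₁ r₂ => r₁.cost + r₂.cost + 1
  | neg b => b.cost + 1
  | conj b₁ b₂ => b₁.cost + b₂.cost + 1

/-- The test does not compare reals. -/
def WordOnly : Test → Prop
  | wle _ _ => True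
  | rle _ _ => False
  | neg b => b.WordOnly
  | conj b₁ b₂ => b₁.WordOnly ∧ b₂.WordOnly

end Test

/-- Programs: assignments to word variables, to cells of word arrays, to real variables and to
cells of real arrays, composition, conditional, and loop. -/
inductive Prog where
  | skip
  | wset (x : ℕ) (e : WExpr)
  | wput (a : ℕ) (i e : WExpr)
  | rset (x : ℕ) (r : RExpr)
  | rput (a : ℕ) (i : WExpr) (r : RExpr)
  | seq (c₁ c₂ : Prog)
  | ite (b : Test) (c₁ c₂ : Prog)
  | loop (b : Test) (c : Prog)

/-- The program uses words only, so it is a program of an ordinary word RAM. -/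
def Prog.WordOnly : Prog → Prop
  | skip => True
  | wset _ _ => True
  | wput _ _ _ => True
  | rset _ _ => False
  | rput _ _ _ => False
  | seq c₁ c₂ => c₁.WordOnly ∧ c₂.WordOnly
  | ite b c₁ c₂ => b.WordOnly ∧ c₁.WordOnly ∧ c₂.WordOnly
  | loop b c => b.WordOnly ∧ c.WordOnly

namespace Mem

def setW (s : Mem) (x v : ℕ) : Mem :=
  { s with wvar := Function.update s.wvar x v }

def putW (s : Mem) (a i v : ℕ) : Mem :=
  { s with warr := Function.update s.warr a (Function.update (s.warr a) i v) }

def setR (s : Mem) (x : ℕ) (v : ℝ) : Mem :=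
  { s with rvar := Function.update s.rvar x v }

def putR (s : Mem) (a i : ℕ) (v : ℝ) : Mem :=
  { s with rarr := Function.update s.rarr a (Function.update (s.rarr a) i v) }

end Mem

/-- `Run f W c s s' t`: on the machine with unit `f` and word bound `W`, the program `c` started
with memory `s` halts after `t` steps with memory `s'`, and no overflow occurs. -/
inductive Run (f : ℕ → ℝ) (W : ℕ) : Prog → Mem → Mem → ℕ → Prop
  | skip (s : Mem) : Run f W .skip s s 1
  | wset (s : Mem) (x : ℕ) (e : WExpr) (h : e.Fits W s) :
      Run f W (.wset x e) s (s.setW x (e.eval s)) (e.cost + 1)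
  | wput (s : Mem) (a : ℕ) (i e : WExpr) (hi : i.Fits W s) (h : e.Fits W s) :
      Run f W (.wput a i e) s (s.putW a (i.eval s) (e.eval s)) (i.cost + e.cost + 1)
  | rset (s : Mem) (x : ℕ) (r : RExpr) (h : r.Fits W s) :
      Run f W (.rset x r) s (s.setR x (r.eval f s)) (r.cost + 1)
  | rput (s : Mem) (a : ℕ) (i : WExpr) (r : RExpr) (hi : i.Fits W s) (h : r.Fits W s) :
      Run f W (.rput a i r) s (s.putR a (i.eval s) (r.eval f s)) (i.cost + r.cost + 1)
  | seq {c₁ c₂ : Prog} {s s₁ s₂ : Mem} {t₁ t₂ : ℕ} (h₁ : Run f W c₁ s s₁ t₁)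
      (h₂ : Run f W c₂ s₁ s₂ t₂) : Run f W (.seq c₁ c₂) s s₂ (t₁ + t₂)
  | ite_true {b : Test} {c₁ c₂ : Prog} {s s₁ : Mem} {t : ℕ} (hf : b.Fits W s)
      (hb : b.Holds f s) (h : Run f W c₁ s s₁ t) : Run f W (.ite b c₁ c₂) s s₁ (b.cost + t + 1)
  | ite_false {b : Test} {c₁ c₂ : Prog} {s s₁ : Mem} {t : ℕ} (hf : b.Fits W s)
      (hb : ¬ b.Holds f s) (h : Run f W c₂ s s₁ t) :
      Run f W (.ite b c₁ c₂) s s₁ (b.cost + t + 1)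
  | loop_true {b : Test} {c : Prog} {s s₁ s₂ : Mem} {t₁ t₂ : ℕ} (hf : b.Fits W s)
      (hb : b.Holds f s) (h₁ : Run f W c s s₁ t₁) (h₂ : Run f W (.loop b c) s₁ s₂ t₂) :
      Run f W (.loop b c) s s₂ (b.cost + t₁ + t₂ + 1)
  | loop_false {b : Test} {c : Prog} {s : Mem} (hf : b.Fits W s) (hb : ¬ b.Holds f s) :
      Run f W (.loop b c) s s (b.cost + 1)

/-- The machine is deterministic: the final memory and the number of steps are unique. -/
theorem Run.deterministic {f : ℕ → ℝ} {W : ℕ} {c : Prog} {s s₁ s₂ : Mem} {t₁ t₂ : ℕ}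
    (h₁ : Run f W c s s₁ t₁) (h₂ : Run f W c s s₂ t₂) : s₁ = s₂ ∧ t₁ = t₂ := by
  induction h₁ generalizing s₂ t₂ with
  | skip => cases h₂; exact ⟨rfl, rfl⟩
  | wset => cases h₂; exact ⟨rfl, rfl⟩
  | wput => cases h₂; exact ⟨rfl, rfl⟩
  | rset => cases h₂; exact ⟨rfl, rfl⟩
  | rput => cases h₂; exact ⟨rfl, rfl⟩
  | seq _ _ ih₁ ih₂ =>
    cases h₂ with
    | seq k₁ k₂ =>
      obtain ⟨rfl, rfl⟩ := ih₁ k₁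
      obtain ⟨rfl, rfl⟩ := ih₂ k₂
      exact ⟨rfl, rfl⟩
  | ite_true hf hb _ ih =>
    cases h₂ with
    | ite_true _ _ k => obtain ⟨rfl, rfl⟩ := ih k; exact ⟨rfl, rfl⟩
    | ite_false _ kb _ => exact absurd hb kb
  | ite_false hf hb _ ih =>
    cases h₂ with
    | ite_true _ kb _ => exact absurd kb hb
    | ite_false _ _ k => obtain ⟨rfl, rfl⟩ := ih k; exact ⟨rfl, rfl⟩
  | loop_true hf hb _ _ ih₁ ih₂ =>
    cases h₂ with
    | loop_true _ _ k₁ k₂ =>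
      obtain ⟨rfl, rfl⟩ := ih₁ k₁
      obtain ⟨rfl, rfl⟩ := ih₂ k₂
      exact ⟨rfl, rfl⟩
    | loop_false _ kb => exact absurd hb kb
  | loop_false hf hb =>
    cases h₂ with
    | loop_true _ kb _ _ => exact absurd kb hb
    | loop_false => exact ⟨rfl, rfl⟩

open Classical in
/-- The initial memory for the graph `G` on the vertices `0, …, n - 1`: word variable `0` holds `n`,
word array `0` holds the adjacency matrix of `G`, row by row, and all other cells are `0`. -/
noncomputable def inputMem {n : ℕ} (G : SimpleGraph (Fin n)) : Mem where
  wvar := Function.update (fun _ => 0) 0 n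
  warr := Function.update (fun _ _ => 0) 0
    (fun i => if ∃ u v : Fin n, i = (u : ℕ) * n + (v : ℕ) ∧ G.Adj u v then 1 else 0)
  rvar := fun _ => 0
  rarr := fun _ _ => 0

/-- The labelling of the vertices that a program returns in the first `n` cells of the word
array `1`. -/
def output (n : ℕ) (s : Mem) : Fin n → ℕ := fun v => s.warr 1 v

end PMean

namespace PMean

/-! ### Interval orders -/

/-! Grouping vertices by parts turns both objectives into a sum of `g (size)` over the parts. The
sum of `a_v ^ p` is the sum of `size ^ (p + 1)`, and `M_p` is an increasing function of it. The sum
of `a_v` is twice the number of inner edges plus `n`, so Max-ECP is the case `g a = a ^ 2`. All that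
is used of `g` is `IsGain`: moving elements from a part to one that is at least as large never loses
value. This follows from convexity.

Suppose that an interval model with integral endpoints between `1` and `n` is known. Consider the
intervals strictly inside a window `(i, j)`, partitioned into cliques. By Helly's theorem on the
line the largest part has a common point `m`. Moving all other intervals through `m` into it loses
nothing, and the remaining intervals lie in `(i, m)` or `(m, j)`, with no part meeting both sides.
Hence the optimum of a window is the maximum over `m` of `g (number through m)` plus the optima of
the two subwindows (`IsDPTable.value_le`). Conversely, following the optimal choices down gives each
interval a label that is one of its points, so the classes are cliques, and their value is that of
the table (`IsDPTable.value_eq`). There are quadratically many windows with linearly many choices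
each.

The model has to be built from the adjacency matrix. Non-adjacency in an interval graph is
comparability in an interval order, an irreflexive relation with the Ferrers property. An ordered
partition is refined while it stays consistent with some such order (`RankConsistent`). A vertex
that distinguishes two members of another class splits that class, and the same order still works.
If no vertex does so, every class is a module; the order inside it may be replaced by any other one
(`IsIntervalOrderOn.substitute`), and a vertex that is minimal in some order of the class is split
off in front. After at most `n` splits the order is known. Numbers of predecessors then serve as
left endpoints, and right endpoints are the largest left endpoints in closed neighbourhoods
(`RankConsistent.isModel`).

A minimal vertex is found by narrowing a set `M` of candidates (`PickInv`). A pivot with a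
non-neighbour among the candidates keeps only its non-neighbours, and the discarded candidates
become pivots. Once no pivots are left, `M` is a module containing a first element of the set where
the search was last restarted, so minimality inside `M` suffices. The search restarts inside `M`
with a candidate as pivot, and it ends at a candidate adjacent to all others.

The programs are verified by weakest preconditions. All loops run at most `n + 2` times and are
nested at most three deep, so `wp_sound` gives cubic time. -/

/-- `P` is an interval order on `C` whose incomparability graph is the graph induced by `G`. -/
structure IsIntervalOrderOn {V : Type*} (G : SimpleGraph V) (C : Set V) (P : V → V → Prop) :
    Prop where
  irrefl : ∀ a ∈ C, ¬ P a a
  ferrers : ∀ a ∈ C, ∀ b ∈ C, ∀ c ∈ C, ∀ d ∈ C, P a b → P c d → P a d ∨ P c b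
  adj_iff : ∀ a ∈ C, ∀ b ∈ C, a ≠ b → (G.Adj a b ↔ ¬ P a b ∧ ¬ P b a)

namespace IsIntervalOrderOn

variable {V : Type*} {G : SimpleGraph V} {C D : Set V} {P Q : V → V → Prop}

theorem mono (h : IsIntervalOrderOn G C P) (hD : D ⊆ C) : IsIntervalOrderOn G D P :=
  ⟨fun a ha => h.irrefl a (hD ha),
    fun a ha b hb c hc d hd => h.ferrers a (hD ha) b (hD hb) c (hD hc) d (hD hd),
    fun a ha b hb => h.adj_iff a (hD ha) b (hD hb)⟩

theorem flip (h : IsIntervalOrderOn G C P) : IsIntervalOrderOn G C (fun a b => P b a) :=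
  ⟨h.irrefl,
    fun a ha b hb c hc d hd hab hcd => (h.ferrers b hb a ha d hd c hc hab hcd).symm,
    fun a ha b hb hne => (h.adj_iff a ha b hb hne).trans and_comm⟩

theorem trans (h : IsIntervalOrderOn G C P) {a b c : V} (ha : a ∈ C) (hb : b ∈ C) (hc : c ∈ C)
    (hab : P a b) (hbc : P b c) : P a c :=
  (h.ferrers a ha b hb b hb c hc hab hbc).resolve_right (h.irrefl b hb)

theorem not_adj (h : IsIntervalOrderOn G C P) {a b : V} (ha : a ∈ C) (hb : b ∈ C)
    (hab : P a b) : ¬ G.Adj a b := fun hadj =>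
  ((h.adj_iff a ha b hb hadj.ne).1 hadj).1 hab

theorem total (h : IsIntervalOrderOn G C P) {a b : V} (ha : a ∈ C) (hb : b ∈ C) (hne : a ≠ b)
    (hab : ¬ G.Adj a b) : P a b ∨ P b a := by
  have := h.adj_iff a ha b hb hne
  tauto

/-- By the Ferrers property the sets of successors form a chain under inclusion, so an element with
the most successors dominates every other element. This is stronger than having no predecessor, and
it is what lets a module be moved to the front. -/
theorem exists_first {C : Finset V} (h : IsIntervalOrderOn G (C : Set V) P) (hC : C.Nonempty) :
    ∃ v ∈ C, ∀ c ∈ C, ∀ d ∈ C, P c d → P v d := by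
  classical
  obtain ⟨v, hv, hmax⟩ := C.exists_max_image (fun v => (C.filter fun e => P v e).card) hC
  refine ⟨v, hv, fun c hc d hd hcd => ?_⟩
  by_contra hvd
  have hss : (C.filter fun e => P v e) ⊂ C.filter fun e => P c e := by
    refine Finset.ssubset_iff_subset_ne.2 ⟨fun e he => ?_, fun heq => ?_⟩
    · simp only [Finset.mem_filter] at he ⊢
      exact ⟨he.1, (h.ferrers v hv e he.1 c hc d hd he.2 hcd).resolve_left hvd⟩
    · have : d ∈ C.filter fun e => P c e := by simp [hd, hcd]
      rw [← heq] at this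
      exact hvd (Finset.mem_filter.1 this).2
  exact absurd (hmax c hc) (not_le.2 (Finset.card_lt_card hss))

/-- Substitution of an interval order into a module whose elements are placed uniformly. -/
theorem substitute {B : Set V} (h : IsIntervalOrderOn G B P) (hC : C ⊆ B)
    (hQ : IsIntervalOrderOn G C Q)
    (hl : ∀ c ∈ B, c ∉ C → ∀ m ∈ C, ∀ m' ∈ C, P c m → P c m')
    (hr : ∀ c ∈ B, c ∉ C → ∀ m ∈ C, ∀ m' ∈ C, P m c → P m' c) :
    IsIntervalOrderOn G B (fun a b => (a ∈ C ∧ b ∈ C ∧ Q a b) ∨ (¬ (a ∈ C ∧ b ∈ C) ∧ P a b)) := by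
  refine ⟨fun a ha => ?_, fun a ha b hb c hc d hd => ?_, fun a ha b hb hne => ?_⟩
  · have := h.irrefl a ha
    have := hQ.irrefl a
    tauto
  · have key : ∀ a ∈ C, ∀ b ∈ C, ∀ c ∈ B, ∀ d ∈ B, Q a b → ¬ (c ∈ C ∧ d ∈ C) → P c d →
        (¬ (a ∈ C ∧ d ∈ C) ∧ P a d) ∨ (¬ (c ∈ C ∧ b ∈ C) ∧ P c b) := by
      intro a ha b hb c hc d hd hab hn hcd
      by_cases hcC : c ∈ C
      · have hdC : d ∉ C := fun hdC => hn ⟨hcC, hdC⟩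
        exact Or.inl ⟨fun hh => hdC hh.2, hr d hd hdC c hcC a ha hcd⟩
      · by_cases hdC : d ∈ C
        · exact Or.inr ⟨fun hh => hcC hh.1, hl c hc hcC d hdC b hb hcd⟩
        · have hne : a ≠ b := fun e => hQ.irrefl a ha (e ▸ hab)
          have hnadj := hQ.not_adj ha hb hab
          have : P a d ∨ P c b := by
            rcases h.total (hC ha) (hC hb) hne hnadj with h1 | h1
            · exact h.ferrers a (hC ha) b (hC hb) c hc d hd h1 hcd
            · exact (h.ferrers b (hC hb) a (hC ha) c hc d hd h1 hcd).imp
                (hr d hd hdC b hb a ha) (hl c hc hcC a ha b hb)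
          exact this.imp (fun h1 => ⟨fun hh => hdC hh.2, h1⟩) (fun h1 => ⟨fun hh => hcC hh.1, h1⟩)
    -- The only danger is that `P a d` falls inside `C`, where `P` is no longer valid. Then `c` is
    -- outside, so `P c d` moves to `P c a`, and transitivity gives the other alternative.
    have key2 : ∀ a ∈ B, ∀ b ∈ B, ∀ c ∈ B, ∀ d ∈ B, ¬ (a ∈ C ∧ b ∈ C) → ¬ (c ∈ C ∧ d ∈ C) →
        P a b → P c d → P a d →
        (¬ (a ∈ C ∧ d ∈ C) ∧ P a d) ∨ (¬ (c ∈ C ∧ b ∈ C) ∧ P c b) := by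
      intro a ha b hb c hc d hd h1 h2 hab hcd had
      by_cases hh : a ∈ C ∧ d ∈ C
      · have hcC : c ∉ C := fun hcC => h2 ⟨hcC, hh.2⟩
        exact Or.inr ⟨fun h3 => hcC h3.1,
          h.trans hc ha hb (hl c hc hcC d hh.2 a hh.1 hcd) hab⟩
      · exact Or.inl ⟨hh, had⟩
    rintro (⟨haC, hbC, hab⟩ | ⟨h1, hab⟩) (⟨hcC, hdC, hcd⟩ | ⟨h2, hcd⟩)
    · have := hQ.ferrers a haC b hbC c hcC d hdC hab hcd
      tauto
    · exact (key a haC b hbC c hc d hd hab h2 hcd).imp Or.inr Or.inr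
    · exact (key c hcC d hdC a ha b hb hcd h1 hab).symm.imp Or.inr Or.inr
    · rcases h.ferrers a ha b hb c hc d hd hab hcd with h3 | h3
      · exact (key2 a ha b hb c hc d hd h1 h2 hab hcd h3).imp Or.inr Or.inr
      · exact (key2 c hc d hd a ha b hb h2 h1 hcd hab h3).symm.imp Or.inr Or.inr
  · by_cases hh : a ∈ C ∧ b ∈ C
    · have := hQ.adj_iff a hh.1 b hh.2 hne
      tauto
    · have := h.adj_iff a ha b hb hne
      tauto

/-- A module that contains a first element can be moved to the front. -/
theorem substitute_first {B : Set V} (h : IsIntervalOrderOn G B P) (hC : C ⊆ B)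
    (hQ : IsIntervalOrderOn G C Q) {v : V} (hv : v ∈ C)
    (hfirst : ∀ c ∈ B, ∀ d ∈ B, P c d → P v d)
    (hmod : ∀ x ∈ B, x ∉ C → ∀ y ∈ C, G.Adj x y ↔ G.Adj x v) :
    IsIntervalOrderOn G B (fun a b => (a ∈ C ∧ b ∈ C ∧ Q a b) ∨
      (a ∈ C ∧ b ∉ C ∧ ¬ G.Adj a b) ∨ (a ∉ C ∧ b ∉ C ∧ P a b)) := by
  have hvB := hC hv
  have hsrc : ∀ c ∈ B, ¬ P c v := fun c hc hcv =>
    h.irrefl v hvB (hfirst c hc v hvB hcv)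
  -- Nothing precedes `v`, so an outside vertex is non-adjacent to `v` exactly when `v` precedes it.
  -- The module property carries this to all of `C`.
  have hP : ∀ m ∈ C, ∀ c ∈ B, c ∉ C → (¬ G.Adj m c ↔ P v c) := by
    intro m hm c hc hcC
    have h1 := hmod c hc hcC m hm
    have h2 := h.adj_iff c hc v hvB (fun e => hcC (e ▸ hv))
    have h3 := hsrc c hc
    rw [G.adj_comm m c]
    tauto
  refine ⟨fun a ha => ?_, fun a ha b hb c hc d hd => ?_, fun a ha b hb hne => ?_⟩
  · have := h.irrefl a ha
    have := hQ.irrefl a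
    tauto
  · rintro (⟨haC, hbC, hab⟩ | ⟨haC, hbC, hab⟩ | ⟨haC, hbC, hab⟩)
      (⟨hcC, hdC, hcd⟩ | ⟨hcC, hdC, hcd⟩ | ⟨hcC, hdC, hcd⟩)
    · exact (hQ.ferrers a haC b hbC c hcC d hdC hab hcd).imp (fun hh => Or.inl ⟨haC, hdC, hh⟩)
        (fun hh => Or.inl ⟨hcC, hbC, hh⟩)
    · exact Or.inl (Or.inr (Or.inl
        ⟨haC, hdC, (hP a haC d hd hdC).2 ((hP c hcC d hd hdC).1 hcd)⟩))
    · exact Or.inl (Or.inr (Or.inl ⟨haC, hdC, (hP a haC d hd hdC).2 (hfirst c hc d hd hcd)⟩))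
    · exact Or.inr (Or.inr (Or.inl
        ⟨hcC, hbC, (hP c hcC b hb hbC).2 ((hP a haC b hb hbC).1 hab)⟩))
    · exact Or.inl (Or.inr (Or.inl
        ⟨haC, hdC, (hP a haC d hd hdC).2 ((hP c hcC d hd hdC).1 hcd)⟩))
    · exact Or.inl (Or.inr (Or.inl ⟨haC, hdC, (hP a haC d hd hdC).2 (hfirst c hc d hd hcd)⟩))
    · exact Or.inr (Or.inr (Or.inl ⟨hcC, hbC, (hP c hcC b hb hbC).2 (hfirst a ha b hb hab)⟩))
    · exact Or.inr (Or.inr (Or.inl ⟨hcC, hbC, (hP c hcC b hb hbC).2 (hfirst a ha b hb hab)⟩))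
    · exact (h.ferrers a ha b hb c hc d hd hab hcd).imp
        (fun hh => Or.inr (Or.inr ⟨haC, hdC, hh⟩)) (fun hh => Or.inr (Or.inr ⟨hcC, hbC, hh⟩))
  · by_cases haC : a ∈ C <;> by_cases hbC : b ∈ C
    · simpa [haC, hbC] using hQ.adj_iff a haC b hbC hne
    · simp [haC, hbC]
    · simp [haC, hbC, G.adj_comm a b]
    · simpa [haC, hbC] using h.adj_iff a ha b hb hne

end IsIntervalOrderOn

/-- Every first element of the induced graph on `M` is a first element of the one on `C`. -/
def EndSet {V : Type*} (G : SimpleGraph V) (C M : Set V) : Prop :=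
  ∀ Q y, IsIntervalOrderOn G M Q → y ∈ M → (∀ c ∈ M, ¬ Q c y) →
    ∃ P, IsIntervalOrderOn G C P ∧ ∀ c ∈ C, ¬ P c y

theorem EndSet.trans {V : Type*} {G : SimpleGraph V} {C M M' : Set V} (hMC : M' ⊆ M)
    (h : EndSet G C M) (h' : EndSet G M M') : EndSet G C M' := by
  intro Q y hQ hy hs
  obtain ⟨P, hP, hPs⟩ := h' Q y hQ hy hs
  exact h P y hP (hMC hy) hPs

/-- The module is moved to the front with an arbitrary order `Q` inside it. A minimal element of `Q`
is then minimal in the whole set. -/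
theorem endSet_of_module {V : Type*} {G : SimpleGraph V} {B M : Set V} {P : V → V → Prop}
    (h : IsIntervalOrderOn G B P) (hM : M ⊆ B) {v : V} (hv : v ∈ M)
    (hfirst : ∀ c ∈ B, ∀ d ∈ B, P c d → P v d)
    (hmod : ∀ x ∈ B, x ∉ M → (∀ y ∈ M, G.Adj x y) ∨ ∀ y ∈ M, ¬ G.Adj x y) : EndSet G B M := by
  intro Q y hQ hy hs
  refine ⟨_, h.substitute_first hM hQ hv hfirst ?_, ?_⟩
  · intro x hx hxM z hz
    rcases hmod x hx hxM with h1 | h1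
    · exact ⟨fun _ => h1 v hv, fun _ => h1 z hz⟩
    · exact ⟨fun h2 => absurd h2 (h1 z hz), fun h2 => absurd h2 (h1 v hv)⟩
  · intro c _
    have := hs c
    tauto

/-! ### The search for an end vertex -/

/-- The invariant of the search for a first element of `C`: the candidates are in `M`, and the
vertices in `U` have yet to be used as pivots. -/
structure PickInv {V : Type*} (G : SimpleGraph V) (C M U : Finset V) : Prop where
  subset : M ⊆ C
  nonempty : M.Nonempty
  disj : Disjoint M U
  -- `B` is the candidate set at the last restart and `x₀` the vertex that restarted the search.
  -- Vertices that are neither candidates nor waiting pivots no longer distinguish candidates. In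
  -- each order of `B`, the candidates before `x₀` have no predecessors outside `M`, and if there
  -- are any, every first element of `B` is in `M`. All orders are quantified over because `M` may
  -- contain vertices on both sides of `x₀`.
  inner : ∃ B : Finset V, M ⊆ B ∧ B ⊆ C ∧ U ⊆ B ∧ EndSet G (C : Set V) (B : Set V) ∧
    (∀ x ∈ B, x ∉ M → x ∉ U → (∀ y ∈ M, G.Adj x y) ∨ ∀ y ∈ M, ¬ G.Adj x y) ∧
    (M = B ∨ ∃ x₀ ∈ B, (∀ y ∈ M, y ≠ x₀ ∧ ¬ G.Adj y x₀) ∧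
      ∀ P, IsIntervalOrderOn G (B : Set V) P →
        (∀ y ∈ M, P y x₀ → ∀ o ∈ B, o ∉ M → ¬ P o y) ∧
        ∀ v ∈ B, (∀ c ∈ B, ∀ d ∈ B, P c d → P v d) → (∃ y ∈ M, P y x₀) → v ∈ M)

namespace PickInv

variable {V : Type*} {G : SimpleGraph V} {C M U : Finset V}

theorem init (hC : C.Nonempty) : PickInv G C C ∅ where
  subset := subset_rfl
  nonempty := hC
  disj := by simp
  inner := ⟨C, subset_rfl, subset_rfl, by simp, fun Q y hQ _ hs => ⟨Q, hQ, hs⟩,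
    fun x hx hx' => absurd hx hx', Or.inl rfl⟩

/-- Without waiting pivots `M` is a module of `B`. It contains a first element of `B` for some
order, so `endSet_of_module` applies. -/
theorem endSet (h : PickInv G C M ∅) {P : V → V → Prop}
    (hP : IsIntervalOrderOn G (C : Set V) P) : EndSet G (C : Set V) (M : Set V) := by
  obtain ⟨B, hMB, hBC, -, hend, hmod, hor⟩ := h.inner
  rcases hor with rfl | ⟨x₀, hx₀, hna, hall⟩
  · exact hend
  · refine hend.trans (by exact_mod_cast hMB) ?_
    have hPB := hP.mono (Finset.coe_subset.2 hBC)
    obtain ⟨y, hy⟩ := h.nonempty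
    have key : ∀ P, IsIntervalOrderOn G (B : Set V) P → P y x₀ →
        EndSet G (B : Set V) (M : Set V) := by
      intro P hP hyx
      obtain ⟨v, hv, hfirst⟩ := hP.exists_first ⟨y, hMB hy⟩
      exact endSet_of_module hP (by exact_mod_cast hMB)
        ((hall P hP).2 v hv hfirst ⟨y, hy, hyx⟩) hfirst
        (fun x hx hxM => hmod x hx hxM (by simp))
    -- `x₀` is comparable to `y`. If it comes before `y`, the reversed order is used.
    rcases hPB.total (hMB hy) hx₀ (hna y hy).1 (hna y hy).2 with h1 | h1
    · exact key P hPB h1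
    · exact key _ hPB.flip h1

theorem skip [DecidableEq V] (h : PickInv G C M U) {x : V} (hx : ∀ y ∈ M, G.Adj x y) :
    PickInv G C M (U.erase x) where
  subset := h.subset
  nonempty := h.nonempty
  disj := h.disj.mono_right (Finset.erase_subset _ _)
  inner := by
    obtain ⟨B, hMB, hBC, hU, hend, hmod, hor⟩ := h.inner
    refine ⟨B, hMB, hBC, (Finset.erase_subset _ _).trans hU, hend, fun z hz hzM hzU => ?_, hor⟩
    by_cases e : z = x
    · exact Or.inl (e ▸ hx)
    · exact hmod z hz hzM (fun hh => hzU (Finset.mem_erase.2 ⟨e, hh⟩))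

/-- A pivot `x` is outside `M`, so it cannot precede a candidate `z` that is before `x₀`. If `z`
survives, it is non-adjacent to `x`, and so `z` precedes `x`. A discarded candidate before `z` would
also precede its neighbour `x`, which is impossible. A first element of `B` precedes `x` as well, so
it survives. -/
theorem pivot [DecidableEq V] [DecidableRel G.Adj] (h : PickInv G C M U) {x y : V} (hx : x ∈ U) (hy : y ∈ M) (hxy : ¬ G.Adj x y) :
    PickInv G C (M.filter fun z => z ≠ x ∧ ¬ G.Adj x z)
      ((U ∪ M.filter fun z => G.Adj x z).erase x) := by
  have hxM : x ∉ M := fun hh => Finset.disjoint_left.1 h.disj hh hx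
  refine ⟨(Finset.filter_subset _ _).trans h.subset,
    ⟨y, Finset.mem_filter.2 ⟨hy, fun e => hxM (e ▸ hy), hxy⟩⟩, ?_, ?_⟩
  · rw [Finset.disjoint_left]
    intro z hz hz'
    have : z ∈ M → z ∉ U := fun h1 => Finset.disjoint_left.1 h.disj h1
    simp only [Finset.mem_filter, Finset.mem_erase, Finset.mem_union] at hz hz'
    tauto
  · obtain ⟨B, hMB, hBC, hU, hend, hmod, hor⟩ := h.inner
    refine ⟨B, (Finset.filter_subset _ _).trans hMB, hBC, ?_, hend, ?_, Or.inr ?_⟩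
    · exact (Finset.erase_subset _ _).trans
        (Finset.union_subset hU ((Finset.filter_subset _ _).trans hMB))
    · intro z hz hzM hzU
      simp only [Finset.mem_filter, Finset.mem_erase, Finset.mem_union] at hzM hzU ⊢
      by_cases e : z = x
      · subst e
        exact Or.inr fun w hw => hw.2.2
      · have := hmod z hz (by tauto) (by tauto)
        exact this.imp (fun h1 w hw => h1 w hw.1) (fun h1 w hw => h1 w hw.1)
    · rcases hor with rfl | ⟨x₀, hx₀, hna, hall⟩
      · exact absurd (hU hx) hxM
      · refine ⟨x₀, hx₀, fun z hz => hna z (Finset.mem_filter.1 hz).1, fun P hP => ?_⟩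
        obtain ⟨h1, h2⟩ := hall P hP
        have hxB := hU hx
        -- All surviving candidates on the side of `x₀` under consideration lie before the pivot.
        have hright : ∀ z ∈ M, z ≠ x ∧ ¬ G.Adj x z → P z x₀ → P z x := by
          intro z hz hzx hzx0
          have := h1 z hz hzx0 x hxB hxM
          exact (hP.total hxB (hMB hz) hzx.1.symm hzx.2).resolve_left this
        refine ⟨?_, ?_⟩
        · intro z hz hzx0 o ho hoM hoz
          simp only [Finset.mem_filter] at hz hoM
          by_cases hoM' : o ∈ M
          · have hox : o ≠ x := fun e => hxM (e ▸ hoM')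
            have hadj : G.Adj x o := by tauto
            exact hP.not_adj ho hxB (hP.trans ho (hMB hz.1) hxB hoz (hright z hz.1 hz.2 hzx0))
              hadj.symm
          · exact h1 z hz.1 hzx0 o ho hoM' hoz
        · rintro v hv hfirst ⟨z, hz, hzx0⟩
          simp only [Finset.mem_filter] at hz ⊢
          have hvM := h2 v hv hfirst ⟨z, hz.1, hzx0⟩
          have hvx := hfirst z (hMB hz.1) x hxB (hright z hz.1 hz.2 hzx0)
          exact ⟨hvM, fun e => hxM (e ▸ hvM), fun hadj => hP.not_adj hv hxB hvx hadj.symm⟩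

/-- The old candidate set takes the role of `B`, and the chosen candidate that of `x₀`. A
predecessor of a vertex before `x` is itself before `x`, hence among the non-neighbours that are
kept. -/
theorem restart [DecidableEq V] [DecidableRel G.Adj] (h : PickInv G C M ∅) {P : V → V → Prop}
    (hP : IsIntervalOrderOn G (C : Set V) P) {x y : V} (hx : x ∈ M) (hy : y ∈ M) (hyx : y ≠ x)
    (hxy : ¬ G.Adj x y) :
    PickInv G C (M.filter fun z => z ≠ x ∧ ¬ G.Adj x z)
      ((∅ ∪ M.filter fun z => G.Adj x z).erase x) := by
  refine ⟨(Finset.filter_subset _ _).trans h.subset, ⟨y, by simp [hy, hxy, hyx]⟩, ?_, ?_⟩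
  · rw [Finset.disjoint_left]
    intro z hz hz'
    simp only [Finset.mem_filter, Finset.mem_erase, Finset.mem_union] at hz hz'
    tauto
  · refine ⟨M, Finset.filter_subset _ _, h.subset, ?_, h.endSet hP, ?_, Or.inr ⟨x, hx, ?_, ?_⟩⟩
    · exact (Finset.erase_subset _ _).trans
        (Finset.union_subset (by simp) (Finset.filter_subset _ _))
    · intro z hz hzM hzU
      simp only [Finset.mem_filter, Finset.mem_erase, Finset.mem_union] at hzM hzU ⊢
      have e : z = x := by tauto
      subst e
      exact Or.inr fun w hw => hw.2.2
    · intro z hz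
      have hz := (Finset.mem_filter.1 hz).2
      exact ⟨hz.1, fun hadj => hz.2 hadj.symm⟩
    · intro P hP
      refine ⟨?_, ?_⟩
      · intro z hz hzx o ho hoM hoz
        simp only [Finset.mem_filter] at hz hoM
        have hox := hP.trans ho hz.1 hx hoz hzx
        have := hP.not_adj ho hx hox
        have h3 : o ≠ x := fun e => hP.irrefl x hx (e ▸ hox)
        exact hoM ⟨ho, h3, fun hadj => this hadj.symm⟩
      · rintro v hv hfirst ⟨z, hz, hzx⟩
        simp only [Finset.mem_filter] at hz ⊢
        have hvx := hfirst z hz.1 x hx hzx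
        exact ⟨hv, fun e => hP.irrefl x hx (e ▸ hvx),
          fun hadj => hP.not_adj hv hx hvx hadj.symm⟩

/-- A vertex adjacent to all other candidates is incomparable to them in any order, hence minimal.
-/
theorem finish (h : PickInv G C M ∅) {P : V → V → Prop}
    (hP : IsIntervalOrderOn G (C : Set V) P) {x : V} (hx : x ∈ M)
    (hall : ∀ y ∈ M, y ≠ x → G.Adj x y) :
    ∃ Q, IsIntervalOrderOn G (C : Set V) Q ∧ ∀ c ∈ C, ¬ Q c x := by
  have hPM := hP.mono (Finset.coe_subset.2 h.subset)
  refine h.endSet hP P x hPM hx fun c hc hcx => ?_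
  by_cases e : c = x
  · subst e
    exact hPM.irrefl c hc hcx
  · exact hPM.not_adj hc hx hcx (hall c hc e).symm

end PickInv

/-! ### Ordered partitions -/

/-- The ranks `rk` of the vertices below `n` are consistent with some interval order. -/
def RankConsistent (G : SimpleGraph ℕ) (n : ℕ) (rk : ℕ → ℕ) : Prop :=
  ∃ P, IsIntervalOrderOn G {v | v < n} P ∧ ∀ u < n, ∀ v < n, P u v → rk u ≤ rk v

/-- The ranks after the class of rank `pc` has been split according to `key`. -/
def splitRank (rk key : ℕ → ℕ) (pc : ℕ) (v : ℕ) : ℕ :=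
  if pc + 1 ≤ rk v + key v then rk v + 1 else rk v

theorem splitRank_le {rk key : ℕ → ℕ} {pc u v : ℕ} (hu : key u ≤ 1) (hv : key v ≤ 1)
    (h : rk u ≤ rk v) (h' : rk u = pc → rk v = pc → key u = 1 → key v = 1) :
    splitRank rk key pc u ≤ splitRank rk key pc v := by
  unfold splitRank
  split_ifs <;> omega

/-- The order need not change. If `x` lies before the class, it precedes its non-neighbours there,
and whatever follows one of these is again a non-neighbour. So neighbours come before
non-neighbours. If `x` lies behind the class, the roles are exchanged. -/
theorem RankConsistent.split_pivot {G : SimpleGraph ℕ} {n : ℕ} {rk key : ℕ → ℕ}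
    (h : RankConsistent G n rk) {x pc : ℕ} (hx : x < n) (hpc : rk x ≠ pc)
    (hk : ∀ v < n, key v ≤ 1)
    (hkey : ∀ v < n, rk v = pc → (key v = 1 ↔ (rk x < pc ↔ ¬ G.Adj x v))) :
    RankConsistent G n (splitRank rk key pc) := by
  obtain ⟨P, hP, hrk⟩ := h
  refine ⟨P, hP, fun u hu v hv huv => splitRank_le (hk u hu) (hk v hv) (hrk u hu v hv huv) ?_⟩
  intro hru hrv hku
  by_contra hkv
  have h1 := (hkey u hu hru).1 hku
  have h2 := (not_congr (hkey v hv hrv)).1 hkv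
  have hxu : x ≠ u := fun e => hpc (e ▸ hru)
  have hxv : x ≠ v := fun e => hpc (e ▸ hrv)
  rcases lt_or_gt_of_ne hpc with hlt | hlt
  · have hnu : ¬ G.Adj x u := h1.1 hlt
    have hav : G.Adj x v := by tauto
    rcases hP.total hx hu hxu hnu with h3 | h3
    · exact hP.not_adj hx hv (hP.trans hx hu hv h3 huv) hav
    · have := hrk u hu x hx h3
      omega
  · have hlt' : ¬ rk x < pc := by omega
    have hau : G.Adj x u := by tauto
    have hnv : ¬ G.Adj x v := by tauto
    rcases hP.total hx hv hxv hnv with h3 | h3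
    · have := hrk x hx v hv h3
      omega
    · exact hP.not_adj hu hx (hP.trans hu hv hx huv h3) hau.symm

/-- When no outside vertex distinguishes members of the class, consistency of the ranks makes the
class uniform for `P` too. The order inside it can then be replaced by one in which `x` has no
predecessor. -/
theorem RankConsistent.split_first {G : SimpleGraph ℕ} {n : ℕ} {rk key : ℕ → ℕ}
    (h : RankConsistent G n rk) {x pc : ℕ}
    (hmod : ∀ z < n, rk z ≠ pc → ∀ u < n, ∀ v < n, rk u = pc → rk v = pc →
      (G.Adj z u ↔ G.Adj z v))
    {Q : ℕ → ℕ → Prop} (hQ : IsIntervalOrderOn G {v | v < n ∧ rk v = pc} Q)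
    (hsrc : ∀ c < n, rk c = pc → ¬ Q c x)
    (hkey : ∀ v < n, key v = if v = x then 0 else 1) :
    RankConsistent G n (splitRank rk key pc) := by
  obtain ⟨P, hP, hrk⟩ := h
  have hP' := hP.substitute (C := {v | v < n ∧ rk v = pc}) (fun v hv => hv.1) hQ ?_ ?_
  · refine ⟨_, hP', fun u hu v hv huv => ?_⟩
    have hk : ∀ v < n, key v ≤ 1 := fun v hv => by rw [hkey v hv]; split_ifs <;> omega
    rcases huv with ⟨huC, hvC, huv⟩ | ⟨hn, huv⟩
    · refine splitRank_le (hk u hu) (hk v hv) (by rw [huC.2, hvC.2]) fun _ _ _ => ?_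
      rw [hkey v hv, if_neg]
      rintro rfl
      exact hsrc u hu huC.2 huv
    · refine splitRank_le (hk u hu) (hk v hv) (hrk u hu v hv huv) fun h1 h2 _ => ?_
      exact absurd ⟨⟨hu, h1⟩, ⟨hv, h2⟩⟩ hn
  · rintro c hc hcC m ⟨hm, hmr⟩ m' ⟨hm', hmr'⟩ hcm
    have hcr : rk c ≠ pc := fun e => hcC ⟨hc, e⟩
    have hna := hP.not_adj hc hm hcm
    rw [hmod c hc hcr m hm m' hm' hmr hmr'] at hna
    refine (hP.total hc hm' (fun e => hcr (e ▸ hmr')) hna).resolve_right fun h1 => ?_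
    have e1 := hrk _ hm' _ hc h1
    have e2 := hrk _ hc _ hm hcm
    omega
  · rintro c hc hcC m ⟨hm, hmr⟩ m' ⟨hm', hmr'⟩ hcm
    have hcr : rk c ≠ pc := fun e => hcC ⟨hc, e⟩
    have hna : ¬ G.Adj c m := fun hadj => hP.not_adj hm hc hcm hadj.symm
    rw [hmod c hc hcr m hm m' hm' hmr hmr'] at hna
    refine (hP.total hc hm' (fun e => hcr (e ▸ hmr')) hna).resolve_left fun h1 => ?_
    have e1 := hrk _ hc _ hm' h1
    have e2 := hrk _ hm _ hc hcm
    omega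

theorem splitRank_surj {rk key : ℕ → ℕ} {n pc k u v : ℕ} (hpc : pc ≤ k) (hu : u < n) (hv : v < n)
    (hru : rk u = pc) (hrv : rk v = pc) (hku : key u = 0) (hkv : key v = 1)
    (hk : ∀ v < n, key v ≤ 1) (h : ∀ c ≤ k, ∃ y < n, rk y = c) :
    ∀ c ≤ k + 1, ∃ y < n, splitRank rk key pc y = c := by
  intro c hc
  unfold splitRank
  rcases lt_trichotomy c pc with h1 | h1 | h1
  · obtain ⟨y, hy, hyc⟩ := h c (by omega)
    have := hk y hy
    exact ⟨y, hy, by rw [if_neg (by omega), hyc]⟩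
  · exact ⟨u, hu, by rw [if_neg (by omega)]; omega⟩
  · by_cases h2 : c = pc + 1
    · exact ⟨v, hv, by rw [if_pos (by omega)]; omega⟩
    · obtain ⟨y, hy, hyc⟩ := h (c - 1) (by omega)
      exact ⟨y, hy, by rw [if_pos (by omega)]; omega⟩

/-! ### Integral interval models -/

/-- The intervals `[L v, R v]` represent the graph on the vertices below `n`, and their endpoints
are integers between `1` and `n`. -/
structure IsModel (G : SimpleGraph ℕ) (n : ℕ) (L R : ℕ → ℕ) : Prop where
  one_le : ∀ v < n, 1 ≤ L v
  le : ∀ v < n, L v ≤ R v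
  le_n : ∀ v < n, R v ≤ n
  adj_iff : ∀ u < n, ∀ v < n, u ≠ v → (G.Adj u v ↔ L u ≤ R v ∧ L v ≤ R u)

-- With distinct ranks the order is determined: `u` precedes `v` iff its rank is smaller and they
-- are non-adjacent. Sets of predecessors form a chain, so their sizes can serve as left endpoints.
-- An interval extends just far enough to reach the left endpoints of all its neighbours.
open Classical in
theorem RankConsistent.isModel {G : SimpleGraph ℕ} {n : ℕ} {rk L R : ℕ → ℕ}
    (h : RankConsistent G n rk) (hinj : ∀ u < n, ∀ v < n, rk u = rk v → u = v)
    (hL : ∀ v < n, L v = ((Finset.range n).filter fun u => rk u < rk v ∧ ¬ G.Adj u v).card + 1)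
    (hR : ∀ v < n, L v ≤ R v ∧ (∀ w < n, G.Adj v w → L w ≤ R v) ∧
      (R v = L v ∨ ∃ w < n, G.Adj v w ∧ R v = L w)) : IsModel G n L R := by
  obtain ⟨P, hP, hrk⟩ := h
  have hPiff : ∀ u < n, ∀ v < n, (P u v ↔ rk u < rk v ∧ ¬ G.Adj u v) := by
    intro u hu v hv
    constructor
    · intro huv
      refine ⟨lt_of_le_of_ne (hrk u hu v hv huv) fun e => ?_, hP.not_adj hu hv huv⟩
      exact hP.irrefl u hu ((hinj u hu v hv e) ▸ huv)
    · rintro ⟨h1, h2⟩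
      refine (hP.total hu hv (fun e => by subst e; omega) h2).resolve_right fun h3 => ?_
      have := hrk v hv u hu h3
      omega
  have hL' : ∀ v < n, L v = ((Finset.range n).filter fun u => P u v).card + 1 := by
    intro v hv
    rw [hL v hv]
    congr 2
    exact Finset.filter_congr fun u hu => (hPiff u (Finset.mem_range.1 hu) v hv).symm
  have hLn : ∀ v < n, L v ≤ n := by
    intro v hv
    have := Finset.card_lt_card (Finset.filter_ssubset.2
      ⟨v, Finset.mem_range.2 hv, hP.irrefl v hv⟩ : (Finset.range n).filter (fun u => P u v) ⊂ _)
    rw [Finset.card_range] at this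
    rw [hL' v hv]
    exact this
  -- A predecessor of `v` that does not precede `w` makes the inclusion between the two predecessor
  -- sets strict.
  have hlt : ∀ u < n, ∀ v < n, ∀ w < n, P u v → ¬ P u w → L w < L v := by
    intro u hu v hv w hw huv huw
    rw [hL' v hv, hL' w hw, Nat.succ_lt_succ_iff]
    refine Finset.card_lt_card (Finset.ssubset_iff_subset_ne.2 ⟨fun z hz => ?_, fun e => ?_⟩)
    · simp only [Finset.mem_filter, Finset.mem_range] at hz ⊢
      exact ⟨hz.1, (hP.ferrers z hz.1 w hw u hu v hv hz.2 huv).resolve_right huw⟩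
    · have : u ∈ (Finset.range n).filter fun u => P u v := by simp [hu, huv]
      rw [← e] at this
      exact huw (Finset.mem_filter.1 this).2
  -- `R u` is the left endpoint of `u` or of a neighbour of `u`. Neither is preceded by `u`, whereas
  -- `v` is.
  have hsep : ∀ u < n, ∀ v < n, P u v → R u < L v := by
    intro u hu v hv huv
    rcases (hR u hu).2.2 with e | ⟨w, hw, huw, e⟩
    · rw [e]
      exact hlt u hu v hv u hu huv (hP.irrefl u hu)
    · rw [e]
      exact hlt u hu v hv w hw huv fun h1 => hP.not_adj hu hw h1 huw
  refine ⟨fun v hv => by rw [hL' v hv]; omega, fun v hv => (hR v hv).1, fun v hv => ?_, ?_⟩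
  · rcases (hR v hv).2.2 with e | ⟨w, hw, -, e⟩
    · rw [e]; exact hLn v hv
    · rw [e]; exact hLn w hw
  · intro u hu v hv hne
    constructor
    · intro hadj
      exact ⟨(hR v hv).2.1 u hu hadj.symm, (hR u hu).2.1 v hv hadj⟩
    · rintro ⟨h1, h2⟩
      by_contra hn
      rcases hP.total hu hv hne hn with h3 | h3
      · have := hsep u hu v hv h3
        omega
      · have := hsep v hv u hu h3
        omega

/-! ### The recursion over pairs of points -/

/-- The vertices whose intervals lie strictly between the points `i` and `j`. -/
def inside (n : ℕ) (L R : ℕ → ℕ) (i j : ℕ) : Finset ℕ :=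
  (Finset.range n).filter fun v => i < L v ∧ R v < j

/-- The number of intervals strictly between `i` and `j` that contain `m`. -/
def throughCount (n : ℕ) (L R : ℕ → ℕ) (i j m : ℕ) : ℕ :=
  (inside n L R i j).card - (inside n L R i m).card - (inside n L R m j).card

/-- The functions of the size of a part for which it pays to enlarge the largest part. -/
structure IsGain (f : ℕ → ℝ) : Prop where
  zero : f 0 = 0
  nonneg : ∀ a, 0 ≤ f a
  shift : ∀ a b d, d ≤ b → b ≤ a → f a + f b ≤ f (a + d) + f (b - d)

/-- `best i j` is the optimal value between the points `i` and `j`, and `ch i j` is a point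
where it is attained. -/
structure IsDPTable (f : ℕ → ℝ) (n : ℕ) (L R : ℕ → ℕ) (best : ℕ → ℕ → ℝ) (ch : ℕ → ℕ → ℕ) :
    Prop where
  base : ∀ i ≤ n, best i (i + 1) = 0
  ch_mem : ∀ i j, i + 1 < j → j ≤ n + 1 → i < ch i j ∧ ch i j < j
  eq : ∀ i j, i + 1 < j → j ≤ n + 1 →
    best i j = f (throughCount n L R i j (ch i j)) + best i (ch i j) + best (ch i j) j
  le : ∀ i j m, i < m → m < j → j ≤ n + 1 →
    f (throughCount n L R i j m) + best i m + best m j ≤ best i j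

/-- Descending along the choices `ch` from the pair `i, j`, the vertex `v` first meets the
point `c`. -/
inductive Reach (L R : ℕ → ℕ) (ch : ℕ → ℕ → ℕ) (v : ℕ) : ℕ → ℕ → ℕ → Prop
  | here {i j : ℕ} (h₁ : L v ≤ ch i j) (h₂ : ch i j ≤ R v) : Reach L R ch v i j (ch i j)
  | left {i j c : ℕ} (h : R v < ch i j) (hr : Reach L R ch v i (ch i j) c) : Reach L R ch v i j c
  | right {i j c : ℕ} (h : ch i j < L v) (hr : Reach L R ch v (ch i j) j c) : Reach L R ch v i j c

/-- The value of a labelling of the vertices below `n`. -/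
def gainValue (f : ℕ → ℝ) (n : ℕ) (φ : ℕ → ℕ) : ℝ :=
  ∑ c ∈ (Finset.range n).image φ, f ((Finset.range n).filter fun v => φ v = c).card

theorem sum_gain_eq {f : ℕ → ℝ} (hf : IsGain f) {S T : Finset ℕ} {φ : ℕ → ℕ}
    (hT : S.image φ ⊆ T) :
    ∑ c ∈ T, f (S.filter fun v => φ v = c).card
      = ∑ c ∈ S.image φ, f (S.filter fun v => φ v = c).card := by
  refine (Finset.sum_subset hT fun c _ hc => ?_).symm
  rw [Finset.filter_eq_empty_iff.2, Finset.card_empty, hf.zero]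
  intro v hv e
  exact hc (Finset.mem_image.2 ⟨v, hv, e⟩)

/-- Moving elements from small parts to a part that is at least as large. -/
theorem IsGain.merge {f : ℕ → ℝ} (hf : IsGain f) {ι : Type*} (T : Finset ι) (s b : ι → ℕ) (A : ℕ)
    (h : ∀ c ∈ T, s c + b c ≤ A) :
    f A + ∑ c ∈ T, f (s c + b c) ≤ f (A + ∑ c ∈ T, s c) + ∑ c ∈ T, f (b c) := by
  classical
  induction T using Finset.induction_on generalizing A with
  | empty => simp
  | insert c T hc ih =>
    rw [Finset.sum_insert hc, Finset.sum_insert hc, Finset.sum_insert hc]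
    have h1 := ih (A + s c) fun d hd => (h d (Finset.mem_insert_of_mem hd)).trans (by omega)
    have h2 := hf.shift A (s c + b c) (s c) (by omega) (h c (Finset.mem_insert_self _ _))
    rw [Nat.add_sub_cancel_left] at h2
    rw [← add_assoc A]
    linarith

/-! ### Correctness of the recursion over windows -/

section Tables

variable {G : SimpleGraph ℕ} {n : ℕ} {L R : ℕ → ℕ}

/-- An interval inside the window contains `m` or lies on one side of it. The predicate `p` allows
the same count for all intervals and for a single part. -/
theorem card_split (hM : IsModel G n L R) {i j m : ℕ} (hi : i < m) (hj : m < j)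
    (p : ℕ → Prop) [DecidablePred p] :
    ((inside n L R i j).filter p).card =
      (((inside n L R i j).filter fun v => L v ≤ m ∧ m ≤ R v).filter p).card +
      (((inside n L R i m).filter p).card + ((inside n L R m j).filter p).card) := by
  have hd1 : Disjoint ((inside n L R i m).filter p) ((inside n L R m j).filter p) := by
    rw [Finset.disjoint_left]
    intro v hv hv'
    simp only [inside, Finset.mem_filter, Finset.mem_range] at hv hv'
    have := hM.le v hv.1.1
    omega
  have hd2 : Disjoint (((inside n L R i j).filter fun v => L v ≤ m ∧ m ≤ R v).filter p)
      ((inside n L R i m).filter p ∪ (inside n L R m j).filter p) := by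
    rw [Finset.disjoint_left]
    intro v hv hv'
    simp only [inside, Finset.mem_filter, Finset.mem_range, Finset.mem_union] at hv hv'
    omega
  rw [← Finset.card_union_of_disjoint hd1, ← Finset.card_union_of_disjoint hd2]
  congr 1
  ext v
  simp only [inside, Finset.mem_filter, Finset.mem_range, Finset.mem_union]
  constructor
  · rintro ⟨⟨hv, h1, h2⟩, hp⟩
    have := hM.le v hv
    by_cases h3 : R v < m
    · exact Or.inr (Or.inl ⟨⟨hv, h1, h3⟩, hp⟩)
    · by_cases h4 : m < L v
      · exact Or.inr (Or.inr ⟨⟨hv, h4, h2⟩, hp⟩)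
      · exact Or.inl ⟨⟨⟨hv, h1, h2⟩, by omega, by omega⟩, hp⟩
  · rintro (⟨⟨⟨hv, h1, h2⟩, -⟩, hp⟩ | ⟨⟨hv, h1, h2⟩, hp⟩ | ⟨⟨hv, h1, h2⟩, hp⟩)
    · exact ⟨⟨hv, h1, h2⟩, hp⟩
    · exact ⟨⟨hv, h1, by omega⟩, hp⟩
    · exact ⟨⟨hv, by omega, h2⟩, hp⟩

theorem throughCount_eq (hM : IsModel G n L R) {i j m : ℕ} (hi : i < m) (hj : m < j) :
    throughCount n L R i j m
      = ((inside n L R i j).filter fun v => L v ≤ m ∧ m ≤ R v).card := by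
  have := card_split hM hi hj (fun _ => True)
  simp only [Finset.filter_true] at this
  unfold throughCount
  omega

theorem inside_full (hM : IsModel G n L R) : inside n L R 0 (n + 1) = Finset.range n := by
  refine Finset.filter_true_of_mem fun v hv => ?_
  have := hM.one_le v (Finset.mem_range.1 hv)
  have := hM.le_n v (Finset.mem_range.1 hv)
  omega

theorem inside_succ (hM : IsModel G n L R) (i : ℕ) : inside n L R i (i + 1) = ∅ := by
  refine Finset.filter_false_of_mem fun v hv => ?_
  have := hM.le v (Finset.mem_range.1 hv)
  omega

variable {f : ℕ → ℝ} {best : ℕ → ℕ → ℝ} {ch : ℕ → ℕ → ℕ}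

theorem IsDPTable.nonneg (hf : IsGain f) (h : IsDPTable f n L R best ch) (d : ℕ) :
    ∀ i j, i < j → j ≤ n + 1 → j ≤ i + d → 0 ≤ best i j := by
  induction d with
  | zero => intros; omega
  | succ d ih =>
    intro i j hij hj hd
    rcases Nat.eq_or_lt_of_le (Nat.succ_le_of_lt hij) with e | hlt
    · rw [← e, Nat.succ_eq_add_one, h.base i (by omega)]
    · obtain ⟨h1, h2⟩ := h.ch_mem i j hlt hj
      rw [h.eq i j hlt hj]
      have := ih i (ch i j) h1 (by omega) (by omega)
      have := ih (ch i j) j h2 (by omega) (by omega)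
      have := hf.nonneg (throughCount n L R i j (ch i j))
      linarith

theorem Reach.inside_left (hM : IsModel G n L R) {v i j c : ℕ} (h : Reach L R ch v i j c)
    (hv : v < n) (hm : R v < ch i j) : Reach L R ch v i (ch i j) c := by
  have := hM.le v hv
  cases h with
  | here h₁ h₂ => omega
  | left h hr => exact hr
  | right h hr => omega

theorem Reach.inside_right (hM : IsModel G n L R) {v i j c : ℕ} (h : Reach L R ch v i j c)
    (hv : v < n) (hm : ch i j < L v) : Reach L R ch v (ch i j) j c := by
  have := hM.le v hv
  cases h with
  | here h₁ h₂ => omega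
  | left h hr => omega
  | right h hr => exact hr

theorem Reach.eq_here {v i j c : ℕ} (h : Reach L R ch v i j c)
    (h1 : L v ≤ ch i j) (h2 : ch i j ≤ R v) : c = ch i j := by
  cases h with
  | here h₁ h₂ => rfl
  | left h hr => omega
  | right h hr => omega

/-- Induction on the width. Labels of intervals left or right of the choice `m` stay on their side,
so the label `m` belongs exactly to the intervals through `m`, and the sum over labels splits like
the recursion. -/
theorem IsDPTable.value_eq (hM : IsModel G n L R) (hf : IsGain f)
    (h : IsDPTable f n L R best ch) (φ : ℕ → ℕ) (d : ℕ) :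
    ∀ i j, i < j → j ≤ n + 1 → j ≤ i + d → (∀ v ∈ inside n L R i j, Reach L R ch v i j (φ v)) →
      (∀ v ∈ inside n L R i j, i < φ v ∧ φ v < j ∧ L v ≤ φ v ∧ φ v ≤ R v) ∧
      ∑ c ∈ Finset.Ioo i j, f ((inside n L R i j).filter fun v => φ v = c).card = best i j := by
  induction d with
  | zero => intros; omega
  | succ d ih =>
    intro i j hij hj hd hr
    rcases Nat.eq_or_lt_of_le (Nat.succ_le_of_lt hij) with e | hlt
    · rw [← e, Nat.succ_eq_add_one, h.base i (by omega), inside_succ hM]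
      simp [hf.zero]
    · obtain ⟨h1, h2⟩ := h.ch_mem i j hlt hj
      set m := ch i j with hm
      have hl := ih i m h1 (by omega) (by omega) (by
        intro v hv
        simp only [inside, Finset.mem_filter, Finset.mem_range] at hv
        refine (hr v ?_).inside_left hM hv.1 hv.2.2
        simp only [inside, Finset.mem_filter, Finset.mem_range]
        omega)
      have hrr := ih m j h2 (by omega) (by omega) (by
        intro v hv
        simp only [inside, Finset.mem_filter, Finset.mem_range] at hv
        refine (hr v ?_).inside_right hM hv.1 hv.2.1
        simp only [inside, Finset.mem_filter, Finset.mem_range]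
        omega)
      have hmid : ∀ v ∈ inside n L R i j, L v ≤ m → m ≤ R v → φ v = m := fun v hv h3 h4 =>
        (hr v hv).eq_here h3 h4
      have hall : ∀ v ∈ inside n L R i j, i < φ v ∧ φ v < j ∧ L v ≤ φ v ∧ φ v ≤ R v := by
        intro v hv
        have hv' := hv
        simp only [inside, Finset.mem_filter, Finset.mem_range] at hv'
        by_cases h3 : R v < m
        · have := hl.1 v (by simp only [inside, Finset.mem_filter, Finset.mem_range]; omega)
          omega
        · by_cases h4 : m < L v
          · have := hrr.1 v (by simp only [inside, Finset.mem_filter, Finset.mem_range]; omega)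
            omega
          · have := hmid v hv (by omega) (by omega)
            omega
      refine ⟨hall, ?_⟩
      have hset : Finset.Ioo i j = insert m (Finset.Ioo i m ∪ Finset.Ioo m j) := by
        ext c
        simp only [Finset.mem_Ioo, Finset.mem_insert, Finset.mem_union]
        omega
      have hdis : Disjoint (Finset.Ioo i m) (Finset.Ioo m j) := by
        rw [Finset.disjoint_left]
        intro c
        simp only [Finset.mem_Ioo]
        omega
      rw [hset, Finset.sum_insert (by simp), Finset.sum_union hdis, h.eq i j hlt hj, ← hl.2,
        ← hrr.2, throughCount_eq hM h1 h2, ← add_assoc]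
      congr 1
      · congr 1
        · congr 2
          ext v
          simp only [Finset.mem_filter]
          refine and_congr_right fun hv => ⟨fun e => ?_, fun e => hmid v hv e.1 e.2⟩
          have := hall v hv
          omega
        · refine Finset.sum_congr rfl fun c hc => ?_
          congr 2
          ext v
          rw [Finset.mem_Ioo] at hc
          have hx := hall v
          have hy := hrr.1 v
          simp only [inside, Finset.mem_filter, Finset.mem_range] at hx hy ⊢
          constructor
          · rintro ⟨⟨hv, h3, h4⟩, rfl⟩
            have := hx ⟨hv, h3, h4⟩
            refine ⟨⟨hv, h3, ?_⟩, rfl⟩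
            by_contra h5
            by_cases h6 : m < L v
            · have := hy ⟨hv, h6, h4⟩
              omega
            · have := hmid v (by simp only [inside, Finset.mem_filter, Finset.mem_range]; omega)
                (by omega) (by omega)
              omega
          · rintro ⟨⟨hv, h3, h4⟩, rfl⟩
            exact ⟨⟨hv, h3, by omega⟩, rfl⟩
      · refine Finset.sum_congr rfl fun c hc => ?_
        congr 2
        ext v
        rw [Finset.mem_Ioo] at hc
        have hx := hall v
        have hy := hl.1 v
        simp only [inside, Finset.mem_filter, Finset.mem_range] at hx hy ⊢
        constructor
        · rintro ⟨⟨hv, h3, h4⟩, rfl⟩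
          have := hx ⟨hv, h3, h4⟩
          refine ⟨⟨hv, ?_, h4⟩, rfl⟩
          by_contra h5
          by_cases h6 : R v < m
          · have := hy ⟨hv, h3, h6⟩
            omega
          · have := hmid v (by simp only [inside, Finset.mem_filter, Finset.mem_range]; omega)
              (by omega) (by omega)
            omega
        · rintro ⟨⟨hv, h3, h4⟩, rfl⟩
          exact ⟨⟨hv, by omega, h4⟩, rfl⟩

/-- Induction on the width: the largest part is enlarged to all intervals through one of its common
points `m`, and the remainder is bounded in the two subwindows. -/
theorem IsDPTable.value_le (hM : IsModel G n L R) (hf : IsGain f)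
    (h : IsDPTable f n L R best ch) {φ : ℕ → ℕ}
    (hφ : ∀ u < n, ∀ v < n, u ≠ v → φ u = φ v → G.Adj u v) {T : Finset ℕ}
    (hT : ∀ v < n, φ v ∈ T) (d : ℕ) :
    ∀ i j, i < j → j ≤ n + 1 → j ≤ i + d →
      ∑ c ∈ T, f ((inside n L R i j).filter fun v => φ v = c).card ≤ best i j := by
  induction d with
  | zero => intros; omega
  | succ d ih =>
    intro i j hij hj hd
    rcases (inside n L R i j).eq_empty_or_nonempty with he | ⟨v₀, hv₀⟩
    · rw [he]
      simpa [hf.zero] using h.nonneg hf _ i j hij hj (by omega : j ≤ i + j)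
    · have hT0 : T.Nonempty := ⟨φ v₀, hT v₀ (Finset.mem_range.1 (Finset.mem_filter.1 hv₀).1)⟩
      obtain ⟨c₀, hc₀, hmax⟩ := T.exists_max_image
        (fun c => ((inside n L R i j).filter fun v => φ v = c).card) hT0
      have hK : ((inside n L R i j).filter fun v => φ v = c₀).Nonempty := by
        rw [← Finset.card_pos]
        refine lt_of_lt_of_le ?_ (hmax (φ v₀)
          (hT v₀ (Finset.mem_range.1 (Finset.mem_filter.1 hv₀).1)))
        exact Finset.card_pos.2 ⟨v₀, by simp [hv₀]⟩
      -- Helly on the line: the largest left endpoint in a clique belongs to all its intervals.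
      obtain ⟨w, hw, hwmax⟩ := Finset.exists_max_image _ L hK
      simp only [inside, Finset.mem_filter, Finset.mem_range] at hw hwmax
      obtain ⟨⟨hwn, hwi, hwj⟩, hwc⟩ := hw
      have hwle := hM.le w hwn
      obtain ⟨m, hm⟩ : ∃ m, m = L w := ⟨_, rfl⟩
      have him : i < m := by omega
      have hmj : m < j := by omega
      have hthrough : ∀ v ∈ inside n L R i j, φ v = c₀ → L v ≤ m ∧ m ≤ R v := by
        intro v hv hvc
        simp only [inside, Finset.mem_filter, Finset.mem_range] at hv
        refine ⟨hm ▸ hwmax v ⟨hv, hvc⟩, ?_⟩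
        by_cases e : v = w
        · subst e; omega
        · have := (hM.adj_iff v hv.1 w hwn e).1 (hφ v hv.1 w hwn e (hvc.trans hwc.symm))
          omega
      obtain ⟨s, hs⟩ : ∃ s : ℕ → ℕ, s = fun c =>
        (((inside n L R i j).filter fun v => L v ≤ m ∧ m ≤ R v).filter fun v => φ v = c).card :=
        ⟨_, rfl⟩
      obtain ⟨l, hl⟩ : ∃ l : ℕ → ℕ, l = fun c =>
        ((inside n L R i m).filter fun v => φ v = c).card := ⟨_, rfl⟩
      obtain ⟨r, hr⟩ : ∃ r : ℕ → ℕ, r = fun c =>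
        ((inside n L R m j).filter fun v => φ v = c).card := ⟨_, rfl⟩
      have hsplit : ∀ c, ((inside n L R i j).filter fun v => φ v = c).card = s c + (l c + r c) := by
        intro c
        rw [hs, hl, hr]
        exact card_split hM him hmj _
      have hl0 : l c₀ = 0 := by
        rw [hl]
        refine Finset.card_eq_zero.2 (Finset.filter_eq_empty_iff.2 fun v hv hvc => ?_)
        simp only [inside, Finset.mem_filter, Finset.mem_range] at hv
        have := hthrough v (by simp only [inside, Finset.mem_filter, Finset.mem_range]; omega) hvc
        omega
      have hr0 : r c₀ = 0 := by
        rw [hr]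
        refine Finset.card_eq_zero.2 (Finset.filter_eq_empty_iff.2 fun v hv hvc => ?_)
        simp only [inside, Finset.mem_filter, Finset.mem_range] at hv
        have := hthrough v (by simp only [inside, Finset.mem_filter, Finset.mem_range]; omega) hvc
        omega
      -- A part cannot have members on both sides of `m`, since they would be non-adjacent. So one
      -- of the two summands is empty.
      have hlr : ∀ c, f (l c + r c) = f (l c) + f (r c) := by
        intro c
        by_cases h1 : l c = 0
        · rw [h1, hf.zero, Nat.zero_add, zero_add]
        by_cases h2 : r c = 0
        · rw [h2, hf.zero, Nat.add_zero, add_zero]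
        exfalso
        rw [hl] at h1
        rw [hr] at h2
        obtain ⟨u, hu⟩ := Finset.card_pos.1 (Nat.pos_of_ne_zero h1)
        obtain ⟨v, hv⟩ := Finset.card_pos.1 (Nat.pos_of_ne_zero h2)
        simp only [inside, Finset.mem_filter, Finset.mem_range] at hu hv
        have hu' := hM.le u hu.1.1
        have hv' := hM.le v hv.1.1
        have hne : u ≠ v := by rintro rfl; omega
        have := (hM.adj_iff u hu.1.1 v hv.1.1 hne).1
          (hφ u hu.1.1 v hv.1.1 hne (hu.2.trans hv.2.symm))
        omega
      have hsum : ∑ c ∈ T, s c = throughCount n L R i j m := by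
        rw [throughCount_eq hM him hmj, hs]
        refine (Finset.card_eq_sum_card_fiberwise fun v hv => ?_).symm
        simp only [inside, Finset.coe_filter, Finset.mem_filter, Finset.mem_range,
          Set.mem_ofPred_eq] at hv
        exact hT v hv.1.1
      -- The whole part `c₀` passes through `m` and is at least as large as any other part, so it
      -- may absorb the portions of the others through `m`.
      have hmerge := hf.merge (T.erase c₀) s (fun c => l c + r c) (s c₀) (by
        intro c hc
        have := hmax c (Finset.mem_of_mem_erase hc)
        simp only [hsplit] at this
        omega)
      have e1 : s c₀ + ∑ c ∈ T.erase c₀, s c = throughCount n L R i j m := by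
        rw [Finset.add_sum_erase _ _ hc₀, hsum]
      have e2 := Finset.add_sum_erase T (fun c => f (s c + (l c + r c))) hc₀
      have e3 := Finset.add_sum_erase T (fun c => f (l c + r c)) hc₀
      have e4 : ∑ c ∈ T, f (l c + r c) = ∑ c ∈ T, f (l c) + ∑ c ∈ T, f (r c) := by
        rw [← Finset.sum_add_distrib]
        exact Finset.sum_congr rfl fun c _ => hlr c
      have hil := ih i m him (by omega) (by omega)
      have hir := ih m j hmj hj (by omega)
      have hle := h.le i j m him hmj hj
      simp only [hsplit]
      rw [e1] at hmerge
      simp only [hl0, hr0, Nat.add_zero, hf.zero, zero_add] at e2 e3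
      have hil' : ∑ c ∈ T, f (l c) ≤ best i m := by rw [hl]; exact hil
      have hir' : ∑ c ∈ T, f (r c) ≤ best m j := by rw [hr]; exact hir
      linarith

/-- The labelling found by descending along the choices of the table is optimal. -/
theorem IsDPTable.optimal (hM : IsModel G n L R) (hf : IsGain f)
    (h : IsDPTable f n L R best ch) {φ : ℕ → ℕ} (hφ : ∀ v < n, Reach L R ch v 0 (n + 1) (φ v)) :
    (∀ u < n, ∀ v < n, u ≠ v → φ u = φ v → G.Adj u v) ∧
    ∀ ψ : ℕ → ℕ, (∀ u < n, ∀ v < n, u ≠ v → ψ u = ψ v → G.Adj u v) →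
      gainValue f n ψ ≤ gainValue f n φ := by
  obtain ⟨h1, h2⟩ := h.value_eq hM hf φ (n + 1) 0 (n + 1) (by omega) le_rfl (by omega)
    (fun v hv => hφ v (Finset.mem_range.1 (Finset.mem_filter.1 hv).1))
  rw [inside_full hM] at h1 h2
  simp only [Finset.mem_range] at h1
  refine ⟨fun u hu v hv hne e => ?_, fun ψ hψ => ?_⟩
  · have := h1 u hu
    have := h1 v hv
    exact (hM.adj_iff u hu v hv hne).2 (by omega)
  · have h3 := h.value_le hM hf hψ (T := (Finset.range n).image ψ)
      (fun v hv => Finset.mem_image_of_mem _ (Finset.mem_range.2 hv)) (n + 1) 0 (n + 1)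
      (by omega) le_rfl (by omega)
    rw [inside_full hM] at h3
    refine h3.trans (h2.symm.trans (sum_gain_eq hf ?_)).le
    intro c hc
    obtain ⟨v, hv, rfl⟩ := Finset.mem_image.1 hc
    have := h1 v (Finset.mem_range.1 hv)
    exact Finset.mem_Ioo.2 ⟨this.1, this.2.1⟩

end Tables

/-! ### Weakest preconditions -/

/-- The weakest precondition of `c` with respect to `Q`, where no loop is run more than `N`
times. -/
def wp (f : ℕ → ℝ) (W N : ℕ) : Prog → (Mem → Prop) → Mem → Prop
  | .skip, Q, s => Q s
  | .wset x e, Q, s => e.Fits W s ∧ Q (s.setW x (e.eval s))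
  | .wput a i e, Q, s => i.Fits W s ∧ e.Fits W s ∧ Q (s.putW a (i.eval s) (e.eval s))
  | .rset x r, Q, s => r.Fits W s ∧ Q (s.setR x (r.eval f s))
  | .rput a i r, Q, s => i.Fits W s ∧ r.Fits W s ∧ Q (s.putR a (i.eval s) (r.eval f s))
  | .seq c₁ c₂, Q, s => wp f W N c₁ (wp f W N c₂ Q) s
  | .ite b c₁ c₂, Q, s =>
      b.Fits W s ∧ (b.Holds f s → wp f W N c₁ Q s) ∧ (¬ b.Holds f s → wp f W N c₂ Q s)
  | .loop b c, Q, s => ∃ k ≤ N, ∃ I : ℕ → Mem → Prop, I 0 s ∧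
      (∀ i < k, ∀ s, I i s → b.Fits W s ∧ b.Holds f s ∧ wp f W N c (I (i + 1)) s) ∧
      ∀ s, I k s → b.Fits W s ∧ ¬ b.Holds f s ∧ Q s

namespace Prog

/-- The constant factor in the running time. -/
def factor : Prog → ℕ
  | skip => 1
  | wset _ e => e.cost + 1
  | wput _ i e => i.cost + e.cost + 1
  | rset _ r => r.cost + 1
  | rput _ i r => i.cost + r.cost + 1
  | seq c₁ c₂ => c₁.factor + c₂.factor
  | ite b c₁ c₂ => b.cost + c₁.factor + c₂.factor + 1
  | loop b c => b.cost + 1 + c.factor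

/-- The nesting depth of the loops. -/
def depth : Prog → ℕ
  | skip => 0
  | wset _ _ => 0
  | wput _ _ _ => 0
  | rset _ _ => 0
  | rput _ _ _ => 0
  | seq c₁ c₂ => max c₁.depth c₂.depth
  | ite _ c₁ c₂ => max c₁.depth c₂.depth
  | loop _ c => c.depth + 1

/-- The word variables that the program assigns to. -/
def wvars : Prog → List ℕ
  | skip => []
  | wset x _ => [x]
  | wput _ _ _ => []
  | rset _ _ => []
  | rput _ _ _ => []
  | seq c₁ c₂ => c₁.wvars ++ c₂.wvars
  | ite _ c₁ c₂ => c₁.wvars ++ c₂.wvars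
  | loop _ c => c.wvars

/-- The word arrays that the program writes to. -/
def warrs : Prog → List ℕ
  | skip => []
  | wset _ _ => []
  | wput a _ _ => [a]
  | rset _ _ => []
  | rput _ _ _ => []
  | seq c₁ c₂ => c₁.warrs ++ c₂.warrs
  | ite _ c₁ c₂ => c₁.warrs ++ c₂.warrs
  | loop _ c => c.warrs

/-- The real arrays that the program writes to. -/
def rarrs : Prog → List ℕ
  | skip => []
  | wset _ _ => []
  | wput _ _ _ => []
  | rset _ _ => []
  | rput a _ _ => [a]
  | seq c₁ c₂ => c₁.rarrs ++ c₂.rarrs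
  | ite _ c₁ c₂ => c₁.rarrs ++ c₂.rarrs
  | loop _ c => c.rarrs

end Prog

/-- The memories `s` and `s'` agree on everything that the program `c` does not write to. -/
structure Agree (c : Prog) (s s' : Mem) : Prop where
  wvar : ∀ x, x ∉ c.wvars → s'.wvar x = s.wvar x
  warr : ∀ a, a ∉ c.warrs → s'.warr a = s.warr a
  rarr : ∀ a, a ∉ c.rarrs → s'.rarr a = s.rarr a

theorem Agree.refl (c : Prog) (s : Mem) : Agree c s s :=
  ⟨fun _ _ => rfl, fun _ _ => rfl, fun _ _ => rfl⟩

theorem Agree.trans {c : Prog} {s s₁ s₂ : Mem} (h₁ : Agree c s s₁) (h₂ : Agree c s₁ s₂) :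
    Agree c s s₂ :=
  ⟨fun x hx => (h₂.wvar x hx).trans (h₁.wvar x hx),
    fun a ha => (h₂.warr a ha).trans (h₁.warr a ha),
    fun a ha => (h₂.rarr a ha).trans (h₁.rarr a ha)⟩

theorem Agree.mono {c d : Prog} {s s' : Mem} (h : Agree c s s') (hw : c.wvars ⊆ d.wvars)
    (ha : c.warrs ⊆ d.warrs) (hr : c.rarrs ⊆ d.rarrs) : Agree d s s' :=
  ⟨fun x hx => h.wvar x fun hh => hx (hw hh), fun a hx => h.warr a fun hh => hx (ha hh),
    fun a hx => h.rarr a fun hh => hx (hr hh)⟩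

section

variable {f : ℕ → ℝ} {W N : ℕ}

theorem wp_mono {c : Prog} : ∀ {Q Q' : Mem → Prop} {s : Mem}, (∀ s, Q s → Q' s) →
    wp f W N c Q s → wp f W N c Q' s := by
  induction c with
  | skip => exact fun h => h _
  | wset x e => exact fun h hw => ⟨hw.1, h _ hw.2⟩
  | wput a i e => exact fun h hw => ⟨hw.1, hw.2.1, h _ hw.2.2⟩
  | rset x e => exact fun h hw => ⟨hw.1, h _ hw.2⟩
  | rput a i e => exact fun h hw => ⟨hw.1, hw.2.1, h _ hw.2.2⟩
  | seq c₁ c₂ ih₁ ih₂ => exact fun h hw => ih₁ (fun s => ih₂ h) hw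
  | ite b c₁ c₂ ih₁ ih₂ =>
    exact fun h hw => ⟨hw.1, fun hb => ih₁ h (hw.2.1 hb), fun hb => ih₂ h (hw.2.2 hb)⟩
  | loop b c ih =>
    rintro Q Q' s h ⟨k, hk, I, h0, hs, he⟩
    exact ⟨k, hk, I, h0, hs, fun s hI => ⟨(he s hI).1, (he s hI).2.1, h s (he s hI).2.2⟩⟩

/-- Whatever a program does not write to is preserved. Specifications therefore mention only the
changed cells, and preservation reduces to a decidable non-membership in the lists of written cells.
-/
theorem wp_frame {c : Prog} : ∀ {Q : Mem → Prop} {s : Mem}, wp f W N c Q s →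
    wp f W N c (fun s' => Agree c s s' ∧ Q s') s := by
  induction c with
  | skip => exact fun h => ⟨Agree.refl _ _, h⟩
  | wset x e =>
    refine fun h => ⟨h.1, ⟨fun y hy => ?_, fun _ _ => rfl, fun _ _ => rfl⟩, h.2⟩
    simp only [Prog.wvars, List.mem_singleton] at hy
    simp [Mem.setW, hy]
  | wput a i e =>
    refine fun h => ⟨h.1, h.2.1, ⟨fun _ _ => rfl, fun y hy => ?_, fun _ _ => rfl⟩, h.2.2⟩
    simp only [Prog.warrs, List.mem_singleton] at hy
    simp [Mem.putW, hy]
  | rset x e => exact fun h => ⟨h.1, ⟨fun _ _ => rfl, fun _ _ => rfl, fun _ _ => rfl⟩, h.2⟩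
  | rput a i e =>
    refine fun h => ⟨h.1, h.2.1, ⟨fun _ _ => rfl, fun _ _ => rfl, fun y hy => ?_⟩, h.2.2⟩
    simp only [Prog.rarrs, List.mem_singleton] at hy
    simp [Mem.putR, hy]
  | seq c₁ c₂ ih₁ ih₂ =>
    intro Q s h
    show wp f W N c₁ (wp f W N c₂ _) s
    refine wp_mono (fun s₁ h₁ => ?_) (ih₁ h)
    refine wp_mono (fun s₂ h₂ => ?_) (ih₂ h₁.2)
    refine ⟨(h₁.1.mono ?_ ?_ ?_).trans (h₂.1.mono ?_ ?_ ?_), h₂.2⟩ <;>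
    simp [Prog.wvars, Prog.warrs, Prog.rarrs]
  | ite b c₁ c₂ ih₁ ih₂ =>
    refine fun h => ⟨h.1, fun hb => ?_, fun hb => ?_⟩
    · refine wp_mono (fun s₁ h₁ => ⟨h₁.1.mono ?_ ?_ ?_, h₁.2⟩) (ih₁ (h.2.1 hb)) <;>
      simp [Prog.wvars, Prog.warrs, Prog.rarrs]
    · refine wp_mono (fun s₁ h₁ => ⟨h₁.1.mono ?_ ?_ ?_, h₁.2⟩) (ih₂ (h.2.2 hb)) <;>
      simp [Prog.wvars, Prog.warrs, Prog.rarrs]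
  | loop b c ih =>
    rintro Q s ⟨k, hk, I, h0, hs, he⟩
    refine ⟨k, hk, fun i s' => Agree (.loop b c) s s' ∧ I i s', ⟨Agree.refl _ _, h0⟩, ?_, ?_⟩
    · rintro i hi s' ⟨hA, hI⟩
      obtain ⟨h1, h2, h3⟩ := hs i hi s' hI
      refine ⟨h1, h2, wp_mono (fun s₂ h₂ => ⟨hA.trans (h₂.1.mono ?_ ?_ ?_), h₂.2⟩) (ih h3)⟩ <;>
      simp [Prog.wvars, Prog.warrs, Prog.rarrs]
    · rintro s' ⟨hA, hI⟩
      obtain ⟨h1, h2, h3⟩ := he s' hI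
      exact ⟨h1, h2, hA, h3⟩

/-- Weakest preconditions are sound, and the running time is polynomial of degree `depth`. -/
theorem wp_sound {c : Prog} : ∀ {Q : Mem → Prop} {s : Mem}, wp f W N c Q s →
    ∃ s' t, Run f W c s s' t ∧ t ≤ c.factor * (N + 1) ^ c.depth ∧ Q s' := by
  induction c with
  | skip => exact fun h => ⟨_, _, .skip _, by simp [Prog.factor, Prog.depth], h⟩
  | wset x e => exact fun h => ⟨_, _, .wset _ _ _ h.1, by simp [Prog.factor, Prog.depth], h.2⟩
  | wput a i e =>
    exact fun h => ⟨_, _, .wput _ _ _ _ h.1 h.2.1, by simp [Prog.factor, Prog.depth], h.2.2⟩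
  | rset x e => exact fun h => ⟨_, _, .rset _ _ _ h.1, by simp [Prog.factor, Prog.depth], h.2⟩
  | rput a i e =>
    exact fun h => ⟨_, _, .rput _ _ _ _ h.1 h.2.1, by simp [Prog.factor, Prog.depth], h.2.2⟩
  | seq c₁ c₂ ih₁ ih₂ =>
    intro Q s h
    obtain ⟨s₁, t₁, r₁, b₁, h₁⟩ := ih₁ h
    obtain ⟨s₂, t₂, r₂, b₂, h₂⟩ := ih₂ h₁
    refine ⟨s₂, _, .seq r₁ r₂, ?_, h₂⟩
    simp only [Prog.factor, Prog.depth, add_mul]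
    refine Nat.add_le_add (b₁.trans ?_) (b₂.trans ?_)
    · gcongr
      · omega
      · exact le_max_left _ _
    · gcongr
      · omega
      · exact le_max_right _ _
  | ite b c₁ c₂ ih₁ ih₂ =>
    intro Q s h
    have hpos : 1 ≤ (N + 1) ^ max c₁.depth c₂.depth := Nat.one_le_pow _ _ (by omega)
    have e1 : (N + 1) ^ c₁.depth ≤ (N + 1) ^ max c₁.depth c₂.depth := by
      gcongr
      · omega
      · exact le_max_left _ _
    have e2 : (N + 1) ^ c₂.depth ≤ (N + 1) ^ max c₁.depth c₂.depth := by
      gcongr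
      · omega
      · exact le_max_right _ _
    by_cases hb : b.Holds f s
    · obtain ⟨s₁, t₁, r₁, b₁, h₁⟩ := ih₁ (h.2.1 hb)
      refine ⟨s₁, _, .ite_true h.1 hb r₁, ?_, h₁⟩
      simp only [Prog.factor, Prog.depth]
      nlinarith [Nat.mul_le_mul_left c₁.factor e1, Nat.mul_le_mul_left (b.cost + 1) hpos,
        Nat.zero_le (c₂.factor * (N + 1) ^ max c₁.depth c₂.depth)]
    · obtain ⟨s₁, t₁, r₁, b₁, h₁⟩ := ih₂ (h.2.2 hb)
      refine ⟨s₁, _, .ite_false h.1 hb r₁, ?_, h₁⟩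
      simp only [Prog.factor, Prog.depth]
      nlinarith [Nat.mul_le_mul_left c₂.factor e2, Nat.mul_le_mul_left (b.cost + 1) hpos,
        Nat.zero_le (c₁.factor * (N + 1) ^ max c₁.depth c₂.depth)]
  | loop b c ih =>
    rintro Q s ⟨k, hk, I, h0, hs, he⟩
    -- Induction on the number `j` of iterations that remain; the last term pays for the failing
    -- final test.
    have key : ∀ j i s, i + j = k → I i s → ∃ s' t, Run f W (.loop b c) s s' t ∧
        t ≤ j * (b.cost + 1 + c.factor * (N + 1) ^ c.depth) + (b.cost + 1) ∧ Q s' := by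
      intro j
      induction j with
      | zero =>
        intro i s hi hI
        obtain ⟨h1, h2, h3⟩ := he s (by rwa [← hi])
        exact ⟨s, _, .loop_false h1 h2, by omega, h3⟩
      | succ j ihj =>
        intro i s hi hI
        obtain ⟨h1, h2, h3⟩ := hs i (by omega) s hI
        obtain ⟨s₁, t₁, r₁, b₁, hI₁⟩ := ih h3
        obtain ⟨s₂, t₂, r₂, b₂, hQ⟩ := ihj (i + 1) s₁ (by omega) hI₁
        refine ⟨s₂, _, .loop_true h1 h2 r₁ r₂, ?_, hQ⟩
        rw [add_mul, one_mul]
        omega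
    obtain ⟨s', t, hr, ht, hQ⟩ := key k 0 s (by omega) h0
    refine ⟨s', t, hr, ht.trans ?_, hQ⟩
    simp only [Prog.factor, Prog.depth, pow_succ]
    have hpos : 1 ≤ (N + 1) ^ c.depth := Nat.one_le_pow _ _ (by omega)
    calc k * (b.cost + 1 + c.factor * (N + 1) ^ c.depth) + (b.cost + 1)
        ≤ N * (b.cost + 1 + c.factor * (N + 1) ^ c.depth) +
          (b.cost + 1 + c.factor * (N + 1) ^ c.depth) :=
          Nat.add_le_add (Nat.mul_le_mul_right _ hk) (Nat.le_add_right _ _)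
      _ = (b.cost + 1 + c.factor * (N + 1) ^ c.depth) * (N + 1) := by ring
      _ ≤ ((b.cost + 1 + c.factor) * (N + 1) ^ c.depth) * (N + 1) := by
          gcongr
          nlinarith
      _ = _ := by ring

/-! ### Counting loops -/

/-- Run `body` with the word variable `x` going from `0` to the value of the word variable `h`,
exclusive. -/
def forUp (x h : ℕ) (body : Prog) : Prog :=
  .seq (.wset x (.lit 0)) (.loop (.neg (.wle (.var h) (.var x)))
    (.seq body (.wset x (.add (.var x) (.lit 1)))))

/-- The invariant `I i` is required just after the counter has been set to `i`. The hypotheses `hx`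
and `hh` keep the body from changing the counter and the limit. The limit plus one must fit into a
word because the counter ends at the limit. -/
theorem wp_forUp {x h : ℕ} {body : Prog} {s : Mem} {Q : Mem → Prop} (I : ℕ → Mem → Prop)
    (hx : x ∉ body.wvars) (hh : h ∉ body.wvars) (hne : h ≠ x) (hN : s.wvar h ≤ N)
    (hW : s.wvar h + 1 ≤ W)
    (h0 : I 0 (s.setW x 0))
    (hstep : ∀ i < s.wvar h, ∀ s', Agree (forUp x h body) s s' → s'.wvar x = i → I i s' →
      wp f W N body (fun s'' => I (i + 1) (s''.setW x (i + 1))) s')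
    (hend : ∀ s', Agree (forUp x h body) s s' → s'.wvar x = s.wvar h → I (s.wvar h) s' → Q s') :
    wp f W N (forUp x h body) Q s := by
  have hxm : x ∈ (forUp x h body).wvars := by simp [forUp, Prog.wvars]
  have hhm : h ∉ (forUp x h body).wvars := by simp [forUp, Prog.wvars, hh, hne]
  refine ⟨by simp [WExpr.Fits], s.wvar h, hN, fun i s' =>
    Agree (forUp x h body) s s' ∧ s'.wvar x = i ∧ I i s', ⟨?_, ?_, h0⟩, ?_, ?_⟩
  · refine ⟨fun y hy => ?_, fun _ _ => rfl, fun _ _ => rfl⟩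
    have : y ≠ x := fun e => hy (e ▸ hxm)
    simp [Mem.setW, this]
  · simp [Mem.setW, WExpr.eval]
  · rintro i hi s' ⟨hA, hxi, hI⟩
    have hh' := hA.wvar h hhm
    refine ⟨by simp [Test.Fits, WExpr.Fits], by simp [Test.Holds, WExpr.eval, hh', hxi, hi], ?_⟩
    show wp f W N body (wp f W N (.wset x _) _) s'
    refine wp_mono ?_ (wp_frame (hstep i hi s' hA hxi hI))
    rintro s'' ⟨hA', hI'⟩
    have hx' := hA'.wvar x hx
    have e : (WExpr.add (.var x) (.lit 1)).eval s'' = i + 1 := by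
      simp [WExpr.eval, hx', hxi]
    refine ⟨by simp only [WExpr.Fits, WExpr.eval, hx', hxi, true_and]; omega, ?_⟩
    rw [e]
    refine ⟨hA.trans ((hA'.mono (d := forUp x h body) ?_ ?_ ?_).trans ⟨fun y hy => ?_, fun _ _ => rfl,
      fun _ _ => rfl⟩), by simp [Mem.setW], hI'⟩
    · simp [forUp, Prog.wvars]
    · simp [forUp, Prog.warrs]
    · simp [forUp, Prog.rarrs]
    · have : y ≠ x := fun e => hy (e ▸ hxm)
      simp [Mem.setW, this]
  · rintro s' ⟨hA, hxi, hI⟩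
    have hh' := hA.wvar h hhm
    exact ⟨by simp [Test.Fits, WExpr.Fits], by simp [Test.Holds, WExpr.eval, hh', hxi],
      hend s' hA hxi hI⟩

end

attribute [simp] wp WExpr.eval WExpr.Fits RExpr.eval RExpr.Fits Test.Holds Test.Fits

namespace Mem

@[simp] theorem setW_wvar (s : Mem) (x v y : ℕ) :
    (s.setW x v).wvar y = if y = x then v else s.wvar y := by
  simp [setW, Function.update_apply]

@[simp] theorem setW_warr (s : Mem) (x v : ℕ) : (s.setW x v).warr = s.warr := rfl

@[simp] theorem putW_wvar (s : Mem) (a i v : ℕ) : (s.putW a i v).wvar = s.wvar := rfl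

@[simp] theorem putW_warr (s : Mem) (a i v b j : ℕ) :
    (s.putW a i v).warr b j = if b = a then if j = i then v else s.warr b j else s.warr b j := by
  by_cases h : b = a
  · subst h; simp [putW, Function.update_apply]
  · simp [putW, h]

@[simp] theorem putW_rarr (s : Mem) (a i v : ℕ) : (s.putW a i v).rarr = s.rarr := rfl

@[simp] theorem putR_warr (s : Mem) (a i : ℕ) (v : ℝ) : (s.putR a i v).warr = s.warr := rfl

@[simp] theorem putR_rarr (s : Mem) (a i : ℕ) (v : ℝ) (b j : ℕ) :
    (s.putR a i v).rarr b j = if b = a then if j = i then v else s.rarr b j else s.rarr b j := by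
  by_cases h : b = a
  · subst h; simp [putR, Function.update_apply]
  · simp [putR, h]

end Mem

/-- The test for equality of words. -/
def weq (e₁ e₂ : WExpr) : Test := .conj (.wle e₁ e₂) (.wle e₂ e₁)

@[simp] theorem weq_holds {f : ℕ → ℝ} {s : Mem} {e₁ e₂ : WExpr} :
    (weq e₁ e₂).Holds f s ↔ e₁.eval s = e₂.eval s := by
  simp [weq, le_antisymm_iff]

@[simp] theorem weq_fits {W : ℕ} {s : Mem} {e₁ e₂ : WExpr} :
    (weq e₁ e₂).Fits W s ↔ e₁.Fits W s ∧ e₂.Fits W s := by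
  simp [weq]; tauto

/-! ### Searching, counting and filling arrays -/

section

variable {f : ℕ → ℝ} {W N : ℕ}

/-- Set the word variable `x` to the last value of `y` that passes the test `b`, if any. -/
def findLast (x y h : ℕ) (b : Test) : Prog :=
  forUp y h (.ite b (.wset x (.var y)) .skip)

theorem wp_findLast {x y h : ℕ} {b : Test} {s : Mem} {Q : Mem → Prop} (p : ℕ → Prop)
    (hxy : x ≠ y) (hxh : x ≠ h) (hyh : y ≠ h) (hN : s.wvar h ≤ N) (hW : s.wvar h + 1 ≤ W)
    (hb : ∀ i < s.wvar h, ∀ s', Agree (findLast x y h b) s s' → s'.wvar y = i →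
      b.Fits W s' ∧ (b.Holds f s' ↔ p i))
    (hQ : ∀ s', Agree (findLast x y h b) s s' →
      ((s'.wvar x = s.wvar x ∧ ∀ i < s.wvar h, ¬ p i) ∨
        (s'.wvar x < s.wvar h ∧ p (s'.wvar x))) → Q s') :
    wp f W N (findLast x y h b) Q s := by
  refine wp_forUp (fun i s' => (s'.wvar x = s.wvar x ∧ ∀ j < i, ¬ p j) ∨
    (s'.wvar x < s.wvar h ∧ p (s'.wvar x))) ?_ ?_ hyh.symm hN hW ?_ ?_ ?_
  · simp [Prog.wvars, hxy.symm]
  · simp [Prog.wvars, hxh.symm]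
  · simp [hxy]
  · intro i hi s' hA hy hI
    obtain ⟨h1, h2⟩ := hb i hi s' hA hy
    refine ⟨h1, fun hh => ?_, fun hh => ?_⟩
    · simp [hy, hxy, hi, h2.1 hh]
    · rcases hI with hI | hI
      · left
        refine ⟨by simp [hxy, hI.1], fun j hj hpj => ?_⟩
        rcases Nat.lt_succ_iff_lt_or_eq.1 hj with h3 | h3
        · exact hI.2 j h3 hpj
        · exact hh (h2.2 (h3 ▸ hpj))
      · right
        simpa [hxy] using hI
  · intro s' hA _ hI
    exact hQ s' hA hI

/-- Count the values of `y` that pass the test `b`. -/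
def countUp (x y h : ℕ) (b : Test) : Prog :=
  .seq (.wset x (.lit 0)) (forUp y h (.ite b (.wset x (.add (.var x) (.lit 1))) .skip))

theorem wp_countUp {x y h : ℕ} {b : Test} {s : Mem} {Q : Mem → Prop} (p : ℕ → Prop)
    [DecidablePred p]
    (hxy : x ≠ y) (hxh : x ≠ h) (hyh : y ≠ h) (hN : s.wvar h ≤ N) (hW : s.wvar h + 1 ≤ W)
    (hb : ∀ i < s.wvar h, ∀ s', Agree (countUp x y h b) s s' → s'.wvar y = i →
      b.Fits W s' ∧ (b.Holds f s' ↔ p i))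
    (hQ : ∀ s', Agree (countUp x y h b) s s' →
      s'.wvar x = ((Finset.range (s.wvar h)).filter p).card → Q s') :
    wp f W N (countUp x y h b) Q s := by
  have hA0 : Agree (countUp x y h b) s (s.setW x 0) :=
    ⟨fun z hz => by simp [countUp, Prog.wvars] at hz; simp [hz], fun _ _ => rfl, fun _ _ => rfl⟩
  have hmono : ∀ s', Agree (forUp y h (.ite b (.wset x (.add (.var x) (.lit 1))) .skip))
      (s.setW x 0) s' → Agree (countUp x y h b) s s' := fun s' hA =>
    hA0.trans (hA.mono (by simp [countUp, Prog.wvars]) (by simp [countUp, Prog.warrs])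
      (by simp [countUp, Prog.rarrs]))
  refine ⟨by simp, wp_forUp (fun i s' => s'.wvar x = ((Finset.range i).filter p).card)
    ?_ ?_ hyh.symm ?_ ?_ ?_ ?_ ?_⟩
  · simp [Prog.wvars, hxy.symm]
  · simp [Prog.wvars, hxh.symm]
  · simpa [hxh.symm] using hN
  · simpa [hxh.symm] using hW
  · simp [hxy]
  · intro i hi s' hA hy hI
    simp only [Mem.setW_wvar, hxh.symm, if_false] at hi
    obtain ⟨h1, h2⟩ := hb i hi s' (hmono s' hA) hy
    have hcard : ((Finset.range i).filter p).card ≤ i := by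
      simpa using Finset.card_filter_le (Finset.range i) p
    refine ⟨h1, fun hh => ?_, fun hh => ?_⟩
    · simp only [wp, WExpr.Fits, WExpr.eval, hI, true_and]
      refine ⟨by omega, ?_⟩
      rw [Finset.range_add_one, Finset.filter_insert, if_pos (h2.1 hh),
        Finset.card_insert_of_notMem (by simp)]
      simp [hxy]
    · rw [Finset.range_add_one, Finset.filter_insert, if_neg (fun hp => hh (h2.2 hp))]
      simpa [hxy] using hI
  · intro s' hA _ hI
    simp only [Mem.setW_wvar, hxh.symm, if_false] at hI
    exact hQ s' (hmono s' hA) hI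

/-- A loop whose body computes one cell of the array `a` after the other. -/
theorem wp_map {a y h : ℕ} {body : Prog} {s : Mem} {Q : Mem → Prop} (g : ℕ → ℕ)
    (hy : y ∉ body.wvars) (hh : h ∉ body.wvars) (hne : h ≠ y) (hN : s.wvar h ≤ N)
    (hW : s.wvar h + 1 ≤ W)
    (hstep : ∀ i < s.wvar h, ∀ s', Agree (forUp y h body) s s' → s'.wvar y = i →
      s'.warr a i = s.warr a i →
      wp f W N body (fun s'' => s''.warr a i = g i ∧ ∀ k, k ≠ i → s''.warr a k = s'.warr a k) s')
    (hQ : ∀ s', Agree (forUp y h body) s s' → (∀ i < s.wvar h, s'.warr a i = g i) → Q s') :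
    wp f W N (forUp y h body) Q s := by
  refine wp_forUp (fun i s' => ∀ k, s'.warr a k = if k < i then g k else s.warr a k)
    hy hh hne hN hW ?_ ?_ ?_
  · simp
  · intro i hi s' hA hyi hI
    refine wp_mono (fun s'' h2 k => ?_) (hstep i hi s' hA hyi (by simp [hI i]))
    rw [Mem.setW_warr]
    rcases lt_trichotomy k i with h3 | h3 | h3
    · rw [h2.2 k h3.ne, hI k, if_pos h3, if_pos (by omega)]
    · rw [h3, h2.1, if_pos (by omega)]
    · rw [h2.2 k h3.ne', hI k, if_neg (by omega), if_neg (by omega)]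
  · intro s' hA _ hI
    exact hQ s' hA fun i hi => by rw [hI i, if_pos hi]

end

/-! ### Access to the graph -/

open Classical in
/-- The entries of the adjacency matrix. -/
noncomputable def adjNat (G : SimpleGraph ℕ) (u v : ℕ) : ℕ := if G.Adj u v then 1 else 0

@[simp] theorem one_le_adjNat {G : SimpleGraph ℕ} {u v : ℕ} : 1 ≤ adjNat G u v ↔ G.Adj u v := by
  unfold adjNat; split_ifs with h <;> simp [h]

theorem adjNat_eq_iff {G : SimpleGraph ℕ} {u v u' v' : ℕ} :
    adjNat G u v = adjNat G u' v' ↔ (G.Adj u v ↔ G.Adj u' v') := by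
  unfold adjNat; split_ifs with h h' h' <;> simp [h, h']

/-- The memory holds the graph `G` on the vertices below `n`. -/
structure Ctx (G : SimpleGraph ℕ) (n : ℕ) (s : Mem) : Prop where
  size : s.wvar 0 = n
  size2 : s.wvar 1 = n + 2
  adj : ∀ u < n, ∀ v < n, s.warr 0 (u * n + v) = adjNat G u v

theorem Ctx.agree {G : SimpleGraph ℕ} {n : ℕ} {s s' : Mem} {c : Prog} (h : Ctx G n s)
    (hA : Agree c s s') (h0 : 0 ∉ c.wvars) (h1 : 1 ∉ c.wvars) (h2 : 0 ∉ c.warrs) : Ctx G n s' :=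
  ⟨(hA.wvar 0 h0).trans h.size, (hA.wvar 1 h1).trans h.size2, by
    rw [hA.warr 0 h2]; exact h.adj⟩

/-- The entry of the adjacency matrix for two vertices. -/
def adjE (e₁ e₂ : WExpr) : WExpr := .get 0 (.add (.mul e₁ (.var 0)) e₂)

theorem index_le {n m W u v : ℕ} (hW : 4 * (n + 2) ^ 2 ≤ W) (hm : m ≤ n + 2) (hu : u < m)
    (hv : v < m) : u * m ≤ W ∧ u * m + v ≤ W := by
  have : u * m + v ≤ W := by nlinarith
  omega

theorem Ctx.adjE_eval {G : SimpleGraph ℕ} {n : ℕ} {s : Mem} (h : Ctx G n s) {e₁ e₂ : WExpr}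
    (h₁ : e₁.eval s < n) (h₂ : e₂.eval s < n) :
    (adjE e₁ e₂).eval s = adjNat G (e₁.eval s) (e₂.eval s) := by
  simp [adjE, h.size, h.adj _ h₁ _ h₂]

theorem Ctx.adjE_fits {G : SimpleGraph ℕ} {n W : ℕ} {s : Mem} (h : Ctx G n s)
    (hW : 4 * (n + 2) ^ 2 ≤ W) {e₁ e₂ : WExpr}
    (h₁ : e₁.eval s < n) (h₂ : e₂.eval s < n) (hf₁ : e₁.Fits W s) (hf₂ : e₂.Fits W s) :
    (adjE e₁ e₂).Fits W s := by
  have := index_le hW (by omega) h₁ h₂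
  simp [adjE, h.size, hf₁, hf₂, this]

theorem wp_seq {f : ℕ → ℝ} {W N : ℕ} {c₁ c₂ : Prog} {Q : Mem → Prop} {s : Mem}
    (h : wp f W N c₁ (wp f W N c₂ Q) s) : wp f W N (.seq c₁ c₂) Q s := h

/-! ### The program that searches for an end vertex

The word variables are `0`: `n`; `1`: `n + 2`; `3`, `4`: vertices `x`, `y`; `6`: the pivot or the
end vertex; `7`: the rank of the class; `8`: a flag; `10`: a vertex. The word array `2` holds the
ranks, and the word array `4` the states of the vertices: `0` for candidates, `1` for pivots
to be used, `2` for used pivots. -/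

/-- Select the next pivot. -/
def pickSelect : Prog :=
  .seq (.wset 3 (.var 0))
  (.seq (findLast 3 4 0 (weq (.get 4 (.var 4)) (.lit 0)))
    (findLast 3 4 0 (weq (.get 4 (.var 4)) (.lit 1))))

/-- Search for a candidate that is not adjacent to the pivot. -/
def pickTest : Prog :=
  .seq (.wset 10 (.var 0))
  (findLast 10 4 0 (.conj (.conj (weq (.get 4 (.var 4)) (.lit 0)) (.neg (weq (.var 4) (.var 3))))
    (.neg (.wle (.lit 1) (adjE (.var 3) (.var 4))))))

/-- Turn the candidates that are adjacent to the pivot into pivots. -/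
def pickMove : Prog :=
  forUp 4 0 (.ite (.conj (weq (.get 4 (.var 4)) (.lit 0)) (.wle (.lit 1) (adjE (.var 3) (.var 4))))
    (.wput 4 (.var 4) (.lit 1)) .skip)

/-- Use one pivot. -/
def pickRound : Prog :=
  .seq pickSelect
  (.seq pickTest
    (.ite (.neg (.wle (.var 0) (.var 10)))
      (.seq pickMove (.wput 4 (.var 3) (.lit 2)))
      (.ite (weq (.get 4 (.var 3)) (.lit 0))
        (.seq (.wset 8 (.lit 1)) (.wset 6 (.var 3)))
        (.wput 4 (.var 3) (.lit 2)))))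

/-- Find an end vertex of the class of rank `7`. -/
def pick : Prog :=
  .seq (forUp 4 0 (.ite (weq (.get 2 (.var 4)) (.var 7))
    (.wput 4 (.var 4) (.lit 0)) (.wput 4 (.var 4) (.lit 3))))
  (.seq (.wset 8 (.lit 0))
    (forUp 9 0 (.ite (weq (.var 8) (.lit 0)) pickRound .skip)))

/-- The vertices below `n` in the state `k`. -/
def stSet (n : ℕ) (st : ℕ → ℕ) (k : ℕ) : Finset ℕ := (Finset.range n).filter fun v => st v = k

@[simp] theorem mem_stSet {n : ℕ} {st : ℕ → ℕ} {k v : ℕ} :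
    v ∈ stSet n st k ↔ v < n ∧ st v = k := by
  simp [stSet]

/-! ### Correctness of the search for an end vertex -/

section

variable {f : ℕ → ℝ} {W : ℕ} {G : SimpleGraph ℕ} {n : ℕ} {s : Mem} {Q : Mem → Prop}

/-- The second search overwrites the result of the first. So a waiting pivot has priority, and a
candidate is chosen only if there is no such pivot. -/
theorem wp_pickSelect (hW : 4 * (n + 2) ^ 2 ≤ W) (hc : Ctx G n s)
    (hM : (stSet n (s.warr 4) 0).Nonempty)
    (hQ : ∀ s', Agree pickSelect s s' → s'.wvar 3 < n →
      (s.warr 4 (s'.wvar 3) = 1 ∨ s.warr 4 (s'.wvar 3) = 0 ∧ ∀ y < n, s.warr 4 y ≠ 1) → Q s') :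
    wp f W (n + 2) pickSelect Q s := by
  have h0 := hc.size
  have hnW : n + 2 ≤ W := by nlinarith
  obtain ⟨v, hv⟩ := hM
  rw [mem_stSet] at hv
  refine wp_mono (fun s' h => hQ s' h.1 h.2.1 h.2.2) (wp_frame
    (Q := fun s' => s'.wvar 3 < n ∧
      (s.warr 4 (s'.wvar 3) = 1 ∨ s.warr 4 (s'.wvar 3) = 0 ∧ ∀ y < n, s.warr 4 y ≠ 1)) ?_)
  refine wp_seq ⟨trivial, wp_seq (wp_findLast (fun y => s.warr 4 y = 0) (by decide) (by decide)
    (by decide) (by simp [h0]) (by simp [h0]; omega) ?_ ?_)⟩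
  · intro i hi s₁ hA hy
    have := hA.warr 4 (by decide)
    simp [hy, this]
  · intro s₁ hA₁ h₁
    have e0 : s₁.wvar 0 = n := by rw [hA₁.wvar 0 (by decide)]; simp [h0]
    have e4 : s₁.warr 4 = s.warr 4 := by rw [hA₁.warr 4 (by decide)]; simp
    simp only [Mem.setW_wvar, WExpr.eval, h0] at h₁
    norm_num [h0] at h₁
    refine wp_findLast (fun y => s.warr 4 y = 1) (by decide) (by decide)
      (by decide) (by simp [e0]) (by omega) ?_ ?_
    · intro i hi s₂ hA hy
      have := hA.warr 4 (by decide)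
      have hW1 : 1 ≤ W := by omega
      simp [hy, this, e4, hW1]
    · intro s₂ hA₂ h₂
      rw [e0] at h₂
      rcases h₁ with h₁ | h₁
      · exact absurd hv.2 (h₁.2 v hv.1)
      · rcases h₂ with h₂ | h₂
        · rw [h₂.1]
          exact ⟨h₁.1, Or.inr ⟨h₁.2, h₂.2⟩⟩
        · exact ⟨h₂.1, Or.inl h₂.2⟩

theorem wp_pickTest (hW : 4 * (n + 2) ^ 2 ≤ W) (hc : Ctx G n s) (hx : s.wvar 3 < n)
    (hQ : ∀ s', Agree pickTest s s' →
      ((n ≤ s'.wvar 10 ∧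
          ∀ y ∈ stSet n (s.warr 4) 0, y ≠ s.wvar 3 → G.Adj (s.wvar 3) y) ∨
        (s'.wvar 10 < n ∧ ∃ y ∈ stSet n (s.warr 4) 0, y ≠ s.wvar 3 ∧ ¬ G.Adj (s.wvar 3) y)) →
      Q s') :
    wp f W (n + 2) pickTest Q s := by
  have h0 := hc.size
  have hnW : n + 2 ≤ W := by nlinarith
  refine wp_mono (fun s' h => hQ s' h.1 h.2) (wp_frame ?_)
  refine wp_seq ⟨trivial, wp_findLast
    (fun y => s.warr 4 y = 0 ∧ y ≠ s.wvar 3 ∧ ¬ G.Adj (s.wvar 3) y) (by decide) (by decide)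
    (by decide) (by simp [h0]) (by simp [h0]; omega) ?_ ?_⟩
  · intro i hi s₁ hA hy
    simp [h0] at hi
    have hc1 : Ctx G n s₁ := by
      have hc' : Ctx G n (s.setW 10 (s.wvar 0)) := ⟨by simp [h0], by simp [hc.size2], hc.adj⟩
      exact hc'.agree hA (by decide) (by decide) (by decide)
    have e3 : s₁.wvar 3 = s.wvar 3 := by rw [hA.wvar 3 (by decide)]; simp
    have e4 : s₁.warr 4 = s.warr 4 := by rw [hA.warr 4 (by decide)]; simp
    have hx1 : (WExpr.var 3).eval s₁ < n := by simp [e3, hx]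
    have hy1 : (WExpr.var 4).eval s₁ < n := by simp [hy, hi]
    have hW1 : 1 ≤ W := by omega
    constructor
    · simp [hc1.adjE_fits hW hx1 hy1 trivial trivial, hW1]
    · simp only [Test.Holds, weq_holds, hc1.adjE_eval hx1 hy1]
      simp [e3, e4, hy, and_assoc]
  · intro s₁ hA₁ h₁
    norm_num [h0] at h₁
    rcases h₁ with h₁ | h₁
    · left
      refine ⟨h₁.1.ge, fun y hy hne => ?_⟩
      rw [mem_stSet] at hy
      exact h₁.2 y hy.1 hy.2 hne
    · right
      exact ⟨h₁.1, _, mem_stSet.2 ⟨h₁.1, h₁.2.1⟩, h₁.2.2⟩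

open Classical in
theorem wp_pickMove (hW : 4 * (n + 2) ^ 2 ≤ W) (hc : Ctx G n s) (hx : s.wvar 3 < n)
    (hQ : ∀ s', Agree pickMove s s' → (∀ y < n, s'.warr 4 y =
      if s.warr 4 y = 0 ∧ G.Adj (s.wvar 3) y then 1 else s.warr 4 y) → Q s') :
    wp f W (n + 2) pickMove Q s := by
  have h0 := hc.size
  have hnW : n + 2 ≤ W := by nlinarith
  refine wp_map (a := 4) (fun y => if s.warr 4 y = 0 ∧ G.Adj (s.wvar 3) y then 1 else s.warr 4 y)
    (by decide) (by decide) (by decide) (by omega) (by omega) ?_ (by rw [h0]; exact hQ)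
  intro i hi s₁ hA hy hst
  rw [h0] at hi
  have hc1 : Ctx G n s₁ := hc.agree hA (by decide) (by decide) (by decide)
  have e3 : s₁.wvar 3 = s.wvar 3 := hA.wvar 3 (by decide)
  have hx1 : (WExpr.var 3).eval s₁ < n := by simp [e3, hx]
  have hy1 : (WExpr.var 4).eval s₁ < n := by simp [hy, hi]
  have hW1 : 1 ≤ W := by omega
  refine ⟨by simp [hc1.adjE_fits hW hx1 hy1 trivial trivial, hW1], fun hb => ?_, fun hb => ?_⟩
  · simp only [Test.Holds, weq_holds, hc1.adjE_eval hx1 hy1] at hb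
    simp [e3, hst, hy] at hb
    simp only [wp, WExpr.Fits, WExpr.eval, hW1, true_and, Mem.putW_warr, hy, if_true, if_pos hb]
    intro k hk
    simp [hk]
  · simp only [Test.Holds, weq_holds, hc1.adjE_eval hx1 hy1] at hb
    simp [e3, hst, hy] at hb
    simp only [wp]
    refine ⟨?_, fun _ _ => trivial⟩
    rw [if_neg (by tauto), hst]

/-- An end vertex of `C` has been found. -/
def IsEnd (G : SimpleGraph ℕ) (C : Finset ℕ) (x : ℕ) : Prop :=
  x ∈ C ∧ ∃ P, IsIntervalOrderOn G (C : Set ℕ) P ∧ ∀ c ∈ C, ¬ P c x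

/-- A round is a `pivot` or a `restart` step if some candidate is non-adjacent to the chosen vertex.
Otherwise it is a `skip` for a pivot and a `finish` for a candidate. Every round except the last
marks one more vertex as used, which bounds the number of rounds. -/
theorem wp_pickRound (hW : 4 * (n + 2) ^ 2 ≤ W) (hc : Ctx G n s) {C : Finset ℕ}
    {P : ℕ → ℕ → Prop} (hP : IsIntervalOrderOn G (C : Set ℕ) P) (hflag : s.wvar 8 = 0)
    (hI : PickInv G C (stSet n (s.warr 4) 0) (stSet n (s.warr 4) 1))
    (hQ : ∀ s', Agree pickRound s s' →
      ((s'.wvar 8 = 1 ∧ IsEnd G C (s'.wvar 6)) ∨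
        (s'.wvar 8 = 0 ∧ PickInv G C (stSet n (s'.warr 4) 0) (stSet n (s'.warr 4) 1) ∧
          (stSet n (s.warr 4) 2).card < (stSet n (s'.warr 4) 2).card)) → Q s') :
    wp f W (n + 2) pickRound Q s := by
  classical
  have hnW : n + 2 ≤ W := by nlinarith
  have hW1 : 1 ≤ W := by omega
  have hW2 : 2 ≤ W := by omega
  refine wp_mono (fun s' h => hQ s' h.1 h.2) (wp_frame ?_)
  refine wp_seq (wp_pickSelect hW hc hI.nonempty fun s₁ hA₁ hx hsel => ?_)
  have hc₁ := hc.agree hA₁ (by decide) (by decide) (by decide)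
  have e4 : s₁.warr 4 = s.warr 4 := hA₁.warr 4 (by decide)
  have e8 : s₁.wvar 8 = 0 := (hA₁.wvar 8 (by decide)).trans hflag
  refine wp_seq (wp_pickTest hW hc₁ hx fun s₂ hA₂ htest => ?_)
  have hc₂ := hc₁.agree hA₂ (by decide) (by decide) (by decide)
  have e4' : s₂.warr 4 = s.warr 4 := (hA₂.warr 4 (by decide)).trans e4
  have e8' : s₂.wvar 8 = 0 := (hA₂.wvar 8 (by decide)).trans e8
  have e3' : s₂.wvar 3 = s₁.wvar 3 := hA₂.wvar 3 (by decide)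
  rw [e4] at htest
  obtain ⟨x, hxdef⟩ : ∃ x, x = s₁.wvar 3 := ⟨_, rfl⟩
  obtain ⟨st, hst⟩ : ∃ st, st = s.warr 4 := ⟨_, rfl⟩
  rw [← hxdef] at hx hsel htest e3'
  rw [← hst] at hI hsel htest e4' ⊢
  -- The chosen vertex had state `0` or `1`, so it is newly marked.
  have hcard : ∀ st' : ℕ → ℕ, st' x = 2 → (∀ y < n, st y = 2 → st' y = 2) →
      (stSet n st 2).card < (stSet n st' 2).card := by
    intro st' h1 h2
    refine Finset.card_lt_card (Finset.ssubset_iff_subset_ne.2 ⟨fun y hy => ?_, fun e => ?_⟩)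
    · rw [mem_stSet] at hy ⊢
      exact ⟨hy.1, h2 y hy.1 hy.2⟩
    · have : x ∈ stSet n st' 2 := mem_stSet.2 ⟨hx, h1⟩
      rw [← e, mem_stSet] at this
      rcases hsel with h3 | h3 <;> omega
  refine ⟨by simp, fun hb => ?_, fun hb => ?_⟩
  · simp [hc₂.size] at hb
    obtain ⟨y, hy, hyx, hxy⟩ := (htest.resolve_left fun h => by omega).2
    refine wp_seq (wp_pickMove hW hc₂ (by rw [e3']; exact hx) fun s₃ hA₃ hmove => ?_)
    have e8₃ : s₃.wvar 8 = 0 := (hA₃.wvar 8 (by decide)).trans e8'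
    have e3₃ : s₃.wvar 3 = x := (hA₃.wvar 3 (by decide)).trans e3'
    rw [e3', e4'] at hmove
    refine ⟨by simp, by simpa using hW2, Or.inr ⟨by simpa using e8₃, ?_, ?_⟩⟩
    · have hst' : ∀ z < n, (s₃.putW 4 ((WExpr.var 3).eval s₃) ((WExpr.lit 2).eval s₃)).warr 4 z
          = if z = x then 2 else if st z = 0 ∧ G.Adj x z then 1 else st z := by
        intro z hz
        simp [e3₃, hmove z hz]
      have hset0 : stSet n ((s₃.putW 4 ((WExpr.var 3).eval s₃)
          ((WExpr.lit 2).eval s₃)).warr 4) 0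
          = (stSet n st 0).filter fun z => z ≠ x ∧ ¬ G.Adj x z := by
        ext z
        rw [mem_stSet, Finset.mem_filter, mem_stSet]
        by_cases hz : z < n
        · rw [hst' z hz]
          split_ifs <;> simp_all
        · simp [hz]
      have hset1 : stSet n ((s₃.putW 4 ((WExpr.var 3).eval s₃)
          ((WExpr.lit 2).eval s₃)).warr 4) 1
          = (stSet n st 1 ∪ (stSet n st 0).filter fun z => G.Adj x z).erase x := by
        ext z
        rw [mem_stSet, Finset.mem_erase, Finset.mem_union, Finset.mem_filter, mem_stSet, mem_stSet]
        by_cases hz : z < n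
        · rw [hst' z hz]
          split_ifs <;> simp_all
        · simp [hz]
      rw [hset0, hset1]
      rcases hsel with h1 | ⟨h1, h2⟩
      · exact hI.pivot (mem_stSet.2 ⟨hx, h1⟩) hy hxy
      · have hU : stSet n st 1 = ∅ := by
          ext z
          simp only [mem_stSet, Finset.notMem_empty, iff_false, not_and]
          exact h2 z
        rw [hU] at hI ⊢
        exact hI.restart hP (mem_stSet.2 ⟨hx, h1⟩) hy hyx hxy
    · refine hcard _ (by simp [e3₃]) fun z hz hz2 => ?_
      simp [e3₃, hmove z hz, hz2]
  · simp [hc₂.size] at hb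
    have hall := (htest.resolve_right fun h => by omega).2
    refine ⟨by simp, fun hb0 => ?_, fun hb0 => ?_⟩
    · simp [e3', e4'] at hb0
      have hU : stSet n st 1 = ∅ := by
        ext z
        simp only [mem_stSet, Finset.notMem_empty, iff_false, not_and]
        rcases hsel with h1 | h1
        · omega
        · exact h1.2 z
      rw [hU] at hI
      have hxM : x ∈ stSet n st 0 := mem_stSet.2 ⟨hx, hb0⟩
      have hend := hI.finish hP hxM hall
      have hxC := hI.subset hxM
      simp [hW1, e3', IsEnd, hend, hxC]
    · simp [e3', e4'] at hb0
      have h1 : st x = 1 := by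
        rcases hsel with h1 | h1
        · exact h1
        · exact absurd h1.1 hb0
      refine ⟨by simp, by simpa using hW2, Or.inr ⟨by simpa using e8', ?_, ?_⟩⟩
      · have hst' : ∀ z, (s₂.putW 4 ((WExpr.var 3).eval s₂) ((WExpr.lit 2).eval s₂)).warr 4 z
            = if z = x then 2 else st z := by
          intro z
          simp [e3', e4']
        have hset0 : stSet n ((s₂.putW 4 ((WExpr.var 3).eval s₂)
            ((WExpr.lit 2).eval s₂)).warr 4) 0 = stSet n st 0 := by
          ext z
          rw [mem_stSet, mem_stSet, hst' z]
          split_ifs <;> simp_all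
        have hset1 : stSet n ((s₂.putW 4 ((WExpr.var 3).eval s₂)
            ((WExpr.lit 2).eval s₂)).warr 4) 1 = (stSet n st 1).erase x := by
          ext z
          rw [mem_stSet, Finset.mem_erase, mem_stSet, hst' z]
          split_ifs <;> simp_all
        rw [hset0, hset1]
        refine hI.skip fun y hy => hall y hy ?_
        rintro rfl
        rw [mem_stSet] at hy
        omega
      · refine hcard _ (by simp [e3']) fun z hz hz2 => ?_
        simp [e3', e4', hz2]

theorem wp_pick (hW : 4 * (n + 2) ^ 2 ≤ W) (hc : Ctx G n s) {P : ℕ → ℕ → Prop}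
    (hP : IsIntervalOrderOn G (stSet n (s.warr 2) (s.wvar 7) : Set ℕ) P)
    (hne : (stSet n (s.warr 2) (s.wvar 7)).Nonempty)
    (hQ : ∀ s', Agree pick s s' → IsEnd G (stSet n (s.warr 2) (s.wvar 7)) (s'.wvar 6) → Q s') :
    wp f W (n + 2) pick Q s := by
  have hnW : n + 3 ≤ W := by nlinarith
  have h0 := hc.size
  obtain ⟨C, hC⟩ : ∃ C, C = stSet n (s.warr 2) (s.wvar 7) := ⟨_, rfl⟩
  rw [← hC] at hP hne hQ
  refine wp_mono (fun s' h => hQ s' h.1 h.2) (wp_frame ?_)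
  refine wp_seq (wp_map (a := 4) (fun y => if s.warr 2 y = s.wvar 7 then 0 else 3)
    (by decide) (by decide) (by decide) (by omega) (by omega) ?_ ?_)
  · intro i hi s₁ hA hy _
    have e2 : s₁.warr 2 = s.warr 2 := hA.warr 2 (by decide)
    have e7 : s₁.wvar 7 = s.wvar 7 := hA.wvar 7 (by decide)
    refine ⟨by simp, fun hb => ?_, fun hb => ?_⟩
    · simp [e2, e7, hy] at hb
      simp [hb, hy]
      intro k hk
      simp [hk]
    · simp [e2, e7, hy] at hb
      simp [hb, hy, show 3 ≤ W by omega]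
      intro k hk
      simp [hk]
  · intro s₁ hA₁ hst
    have hc₁ := hc.agree hA₁ (by decide) (by decide) (by decide)
    rw [h0] at hst
    refine wp_seq ⟨by simp, wp_forUp (fun t s' => (s'.wvar 8 = 1 ∧ IsEnd G C (s'.wvar 6)) ∨
        (s'.wvar 8 = 0 ∧ PickInv G C (stSet n (s'.warr 4) 0) (stSet n (s'.warr 4) 1) ∧
          t ≤ (stSet n (s'.warr 4) 2).card)) (by decide) (by decide) (by decide)
        (by simp [hc₁.size]) (by simp [hc₁.size]; omega) ?_ ?_ ?_⟩
    · right
      have hset0 : stSet n (s₁.warr 4) 0 = C := by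
        ext z
        rw [hC, mem_stSet, mem_stSet]
        refine and_congr_right fun hz => ?_
        rw [hst z hz]
        split_ifs with h <;> simp [h]
      have hset1 : stSet n (s₁.warr 4) 1 = ∅ := by
        ext z
        simp only [mem_stSet, Finset.notMem_empty, iff_false, not_and]
        intro hz
        rw [hst z hz]
        split_ifs <;> simp
      simp only [Mem.setW_warr, hset0, hset1]
      exact ⟨by simp, PickInv.init hne, by simp⟩
    · intro t _ s₂ hA₂ ht hI
      have hc₂ : Ctx G n s₂ := by
        have hc' : Ctx G n (s₁.setW 8 ((WExpr.lit 0).eval s₁)) :=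
          ⟨by simp [hc₁.size], by simp [hc₁.size2], hc₁.adj⟩
        exact hc'.agree hA₂ (by decide) (by decide) (by decide)
      refine ⟨by simp, fun hb => ?_, fun hb => ?_⟩
      · simp at hb
        rcases hI with hI | hI
        · omega
        refine wp_pickRound hW hc₂ hP hb hI.2.1 fun s₃ hA₃ h₃ => ?_
        rcases h₃ with h₃ | h₃
        · exact Or.inl (by simpa using h₃)
        · refine Or.inr ⟨by simpa using h₃.1, h₃.2.1, ?_⟩
          have := h₃.2.2
          have := hI.2.2
          simp only [Mem.setW_warr]
          omega
      · simp at hb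
        rcases hI with hI | hI
        · exact Or.inl (by simpa using hI)
        · omega
    · intro s₂ hA₂ _ hI
      rcases hI with hI | ⟨-, hI, hcard⟩
      · exact hI.2
      · exfalso
        simp [hc₁.size] at hcard
        -- If `n` rounds brought no success, all `n` vertices would be used, yet a candidate is
        -- left.
        obtain ⟨v, hv⟩ := hI.nonempty
        rw [mem_stSet] at hv
        have : stSet n (s₂.warr 4) 2 ⊂ Finset.range n :=
          Finset.filter_ssubset.2 ⟨v, Finset.mem_range.2 hv.1, by omega⟩
        have := Finset.card_lt_card this
        rw [Finset.card_range] at this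
        omega

end

/-! ### The program that refines the ordered partition

The word array `3` holds a representative of each class, and the word array `5` the keys by
which a class is split. -/

/-- The state of the ranks after `k` rounds. -/
structure RankInv (G : SimpleGraph ℕ) (n k : ℕ) (rk : ℕ → ℕ) : Prop where
  consistent : RankConsistent G n rk
  le : ∀ v < n, rk v ≤ k
  -- Until the ranks are distinct, every round creates a new class, so all of `0, …, k` occur as
  -- ranks.
  progress : (∀ u < n, ∀ v < n, rk u = rk v → u = v) ∨ ∀ c ≤ k, ∃ y < n, rk y = c

theorem RankConsistent.congr {G : SimpleGraph ℕ} {n : ℕ} {rk rk' : ℕ → ℕ}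
    (h : RankConsistent G n rk) (e : ∀ v < n, rk' v = rk v) : RankConsistent G n rk' := by
  obtain ⟨P, hP, hrk⟩ := h
  exact ⟨P, hP, fun u hu v hv huv => by rw [e u hu, e v hv]; exact hrk u hu v hv huv⟩

theorem RankInv.congr {G : SimpleGraph ℕ} {n k : ℕ} {rk rk' : ℕ → ℕ}
    (h : RankInv G n k rk) (e : ∀ v < n, rk' v = rk v) : RankInv G n k rk' := by
  refine ⟨h.consistent.congr e, fun v hv => by rw [e v hv]; exact h.le v hv, ?_⟩
  refine h.progress.imp (fun h1 u hu v hv => ?_) (fun h1 c hc => ?_)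
  · rw [e u hu, e v hv]
    exact h1 u hu v hv
  · obtain ⟨y, hy, hyc⟩ := h1 c hc
    exact ⟨y, hy, by rw [e y hy, hyc]⟩

theorem RankInv.split {G : SimpleGraph ℕ} {n k : ℕ} {rk key : ℕ → ℕ} (h : RankInv G n k rk)
    {pc u v : ℕ} (hc : RankConsistent G n (splitRank rk key pc)) (hu : u < n) (hv : v < n)
    (hru : rk u = pc) (hrv : rk v = pc) (hku : key u = 0) (hkv : key v = 1)
    (hk : ∀ v < n, key v ≤ 1) : RankInv G n (k + 1) (splitRank rk key pc) := by
  refine ⟨hc, fun w hw => ?_, Or.inr ?_⟩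
  · have := h.le w hw
    unfold splitRank
    split_ifs <;> omega
  · refine splitRank_surj (hru ▸ h.le u hu) hu hv hru hrv hku hkv hk (h.progress.resolve_left ?_)
    intro hinj
    have := hinj u hu v hv (hru.trans hrv.symm)
    subst this
    omega

theorem RankInv.skip {G : SimpleGraph ℕ} {n k : ℕ} {rk : ℕ → ℕ} (h : RankInv G n k rk)
    (hinj : ∀ u < n, ∀ v < n, rk u = rk v → u = v) : RankInv G n (k + 1) rk :=
  ⟨h.consistent, fun v hv => (h.le v hv).trans (by omega), Or.inl hinj⟩

/-- By pigeonhole, `n` vertices cannot have all `n + 1` ranks from `0` to `n`. -/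
theorem RankInv.injective {G : SimpleGraph ℕ} {n : ℕ} {rk : ℕ → ℕ} (h : RankInv G n n rk) :
    ∀ u < n, ∀ v < n, rk u = rk v → u = v := by
  refine h.progress.resolve_right fun hs => ?_
  have hsub : Finset.range (n + 1) ⊆ (Finset.range n).image rk := by
    intro c hc
    obtain ⟨y, hy, hyc⟩ := hs c (Nat.lt_succ_iff.1 (Finset.mem_range.1 hc))
    exact Finset.mem_image.2 ⟨y, Finset.mem_range.2 hy, hyc⟩
  have := (Finset.card_le_card hsub).trans Finset.card_image_le
  simp at this

theorem RankInv.init {G : SimpleGraph ℕ} {n : ℕ} {P : ℕ → ℕ → Prop}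
    (hP : IsIntervalOrderOn G {v | v < n} P) {rk : ℕ → ℕ} (h0 : ∀ v < n, rk v = 0) :
    RankInv G n 0 rk := by
  refine ⟨⟨P, hP, fun u hu v hv _ => by rw [h0 u hu, h0 v hv]⟩, fun v hv => (h0 v hv).le, ?_⟩
  rcases Nat.eq_zero_or_pos n with rfl | hn
  · exact Or.inl fun u hu => absurd hu (Nat.not_lt_zero u)
  · exact Or.inr fun c hc => ⟨0, hn, by rw [h0 0 hn]; omega⟩

/-- `rep` picks a representative of each class. -/
def IsRep (n : ℕ) (rk rep : ℕ → ℕ) : Prop := ∀ y < n, rep (rk y) < n ∧ rk (rep (rk y)) = rk y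

/-- Compute a representative of each class. -/
def repFill : Prog := forUp 4 0 (.wput 3 (.get 2 (.var 4)) (.var 4))

/-- Search for a pivot `6` that splits another class, of rank `7`. -/
def splitFind : Prog :=
  .seq (.wset 5 (.lit 0))
  (forUp 3 0 (forUp 4 0 (.ite
    (.conj (.neg (weq (.get 2 (.var 3)) (.get 2 (.var 4))))
      (.neg (weq (adjE (.var 3) (.var 4)) (adjE (.var 3) (.get 3 (.get 2 (.var 4)))))))
    (.seq (.wset 5 (.lit 1)) (.seq (.wset 6 (.var 3)) (.wset 7 (.get 2 (.var 4))))) .skip)))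

/-- Search for a class with at least two elements. -/
def classFind : Prog :=
  .seq (.wset 10 (.var 0)) (findLast 10 4 0 (.neg (weq (.get 3 (.get 2 (.var 4))) (.var 4))))

/-- The keys when a class is split by a vertex of another class. -/
def pivotKey : Prog :=
  .ite (.neg (.wle (.var 7) (.get 2 (.var 6))))
    (forUp 4 0 (.wput 5 (.var 4) (.sub (.lit 1) (adjE (.var 6) (.var 4)))))
    (forUp 4 0 (.wput 5 (.var 4) (adjE (.var 6) (.var 4))))

/-- The keys when a first element of a class is split off. -/
def firstKey : Prog :=
  forUp 4 0 (.ite (weq (.var 4) (.var 6)) (.wput 5 (.var 4) (.lit 0)) (.wput 5 (.var 4) (.lit 1)))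

/-- Split the class of rank `7` by the keys. -/
def rankUpdate : Prog :=
  forUp 4 0 (.ite (.wle (.add (.var 7) (.lit 1)) (.add (.get 2 (.var 4)) (.get 5 (.var 4))))
    (.wput 2 (.var 4) (.add (.get 2 (.var 4)) (.lit 1))) .skip)

/-- Split one class. -/
def rankRound : Prog :=
  .seq repFill (.seq splitFind
    (.ite (.wle (.lit 1) (.var 5))
      (.seq pivotKey rankUpdate)
      (.seq classFind
        (.ite (.neg (.wle (.var 0) (.var 10)))
          (.seq (.wset 7 (.get 2 (.var 10))) (.seq pick (.seq firstKey rankUpdate)))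
          .skip))))

/-- Compute an ordered partition into single vertices. -/
def rankProg : Prog := forUp 2 0 rankRound

/-! ### Correctness of the refinement -/

section

variable {f : ℕ → ℝ} {W : ℕ} {G : SimpleGraph ℕ} {n : ℕ} {s : Mem} {Q : Mem → Prop}

theorem wp_repFill (hW : 4 * (n + 2) ^ 2 ≤ W) (hc : Ctx G n s)
    (hQ : ∀ s', Agree repFill s s' → IsRep n (s.warr 2) (s'.warr 3) → Q s') :
    wp f W (n + 2) repFill Q s := by
  have h0 := hc.size
  have hnW : n + 2 ≤ W := by nlinarith
  refine wp_forUp (fun i s' => ∀ y < i, s'.warr 3 (s.warr 2 y) < n ∧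
    s.warr 2 (s'.warr 3 (s.warr 2 y)) = s.warr 2 y) (by decide) (by decide) (by decide)
    (by omega) (by omega) (by simp) ?_ ?_
  · intro i hi s₁ hA hy hI
    have e2 : s₁.warr 2 = s.warr 2 := hA.warr 2 (by decide)
    refine ⟨by simp, by simp, fun y hyi => ?_⟩
    simp only [Mem.setW_warr, Mem.putW_warr, WExpr.eval, hy, e2, if_true]
    split_ifs with h
    · exact ⟨by omega, h.symm⟩
    · refine hI y (lt_of_le_of_ne (Nat.lt_succ_iff.1 hyi) ?_)
      rintro rfl
      exact h rfl
  · intro s₁ hA _ hI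
    rw [h0] at hI
    exact hQ s₁ hA hI

/-- Comparing each vertex with the representative of its class suffices to detect whether the class
is homogeneous for `x`. This keeps the search quadratic. -/
theorem wp_splitFind (hW : 4 * (n + 2) ^ 2 ≤ W) (hc : Ctx G n s)
    (hrep : IsRep n (s.warr 2) (s.warr 3))
    (hQ : ∀ s', Agree splitFind s s' →
      ((s'.wvar 5 = 0 ∧ ∀ x < n, ∀ y < n, s.warr 2 x ≠ s.warr 2 y →
          (G.Adj x y ↔ G.Adj x (s.warr 3 (s.warr 2 y)))) ∨
        (s'.wvar 5 = 1 ∧ s'.wvar 6 < n ∧ ∃ y < n, s'.wvar 7 = s.warr 2 y ∧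
          s.warr 2 (s'.wvar 6) ≠ s.warr 2 y ∧
          ¬ (G.Adj (s'.wvar 6) y ↔ G.Adj (s'.wvar 6) (s.warr 3 (s.warr 2 y))))) → Q s') :
    wp f W (n + 2) splitFind Q s := by
  have h0 := hc.size
  have hnW : n + 2 ≤ W := by nlinarith
  have hW1 : 1 ≤ W := by omega
  refine wp_mono (fun s' h => hQ s' h.1 h.2) (wp_frame ?_)
  obtain ⟨Bad, hBad⟩ : ∃ Bad : ℕ → ℕ → Prop, Bad = fun x y => s.warr 2 x ≠ s.warr 2 y ∧
    ¬ (G.Adj x y ↔ G.Adj x (s.warr 3 (s.warr 2 y))) := ⟨_, rfl⟩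
  obtain ⟨Found, hFound⟩ : ∃ Found : Mem → Prop, Found = fun s' => s'.wvar 5 = 1 ∧
    s'.wvar 6 < n ∧ ∃ y < n, s'.wvar 7 = s.warr 2 y ∧ Bad (s'.wvar 6) y := ⟨_, rfl⟩
  have hc0 : Ctx G n (s.setW 5 ((WExpr.lit 0).eval s)) :=
    ⟨by simp [h0], by simp [hc.size2], hc.adj⟩
  refine wp_seq ⟨by simp, wp_forUp (fun i s' => (s'.wvar 5 = 0 ∧ ∀ x < i, ∀ y < n, ¬ Bad x y) ∨
    Found s') (by decide) (by decide) (by decide) (by simp [h0]) (by simp [h0]; omega)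
    (by simp) ?_ ?_⟩
  · intro x hx s₁ hA₁ hx₁ hI₁
    have hc₁ : Ctx G n s₁ := hc0.agree hA₁ (by decide) (by decide) (by decide)
    have e2 : s₁.warr 2 = s.warr 2 := hA₁.warr 2 (by decide)
    have e3 : s₁.warr 3 = s.warr 3 := hA₁.warr 3 (by decide)
    simp [h0] at hx
    refine wp_forUp (fun j s' => (s'.wvar 5 = 0 ∧ (∀ x' < x, ∀ y < n, ¬ Bad x' y) ∧
      ∀ y < j, ¬ Bad x y) ∨ Found s') (by decide) (by decide) (by decide) (by simp [hc₁.size])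
      (by simp [hc₁.size]; omega) ?_ ?_ ?_
    · simpa [hFound] using hI₁
    · intro y hy s₂ hA₂ hy₂ hI₂
      rw [hc₁.size] at hy
      have hc₂ : Ctx G n s₂ := hc₁.agree hA₂ (by decide) (by decide) (by decide)
      have e2' : s₂.warr 2 = s.warr 2 := (hA₂.warr 2 (by decide)).trans e2
      have e3' : s₂.warr 3 = s.warr 3 := (hA₂.warr 3 (by decide)).trans e3
      have hx₂ : s₂.wvar 3 = x := (hA₂.wvar 3 (by decide)).trans hx₁
      have a1 : (WExpr.var 3).eval s₂ < n := by simp [hx₂, hx]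
      have a2 : (WExpr.var 4).eval s₂ < n := by simp [hy₂, hy]
      have a3 : (WExpr.get 3 (.get 2 (.var 4))).eval s₂ < n := by
        simp [hy₂, e2', e3', (hrep y hy).1]
      have b1 := hc₂.adjE_fits hW a1 a2 trivial trivial
      have b2 := hc₂.adjE_fits hW a1 a3 trivial trivial
      refine ⟨by simp [b1, b2], fun hb => ?_, fun hb => ?_⟩
      · simp only [Test.Holds, weq_holds, hc₂.adjE_eval a1 a2, hc₂.adjE_eval a1 a3,
          adjNat_eq_iff] at hb
        simp only [WExpr.eval, hx₂, hy₂, e2', e3'] at hb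
        simp only [hFound, hBad]
        simp only [wp, WExpr.Fits, WExpr.eval, hW1, true_and]
        right
        simp only [Mem.setW_wvar, Mem.setW_warr, hx₂, hy₂, e2']
        norm_num
        exact ⟨hx, y, hy, rfl, hb⟩
      · simp only [Test.Holds, weq_holds, hc₂.adjE_eval a1 a2, hc₂.adjE_eval a1 a3,
          adjNat_eq_iff] at hb
        simp only [WExpr.eval, hx₂, hy₂, e2', e3'] at hb
        rcases hI₂ with hI₂ | hI₂
        · left
          refine ⟨by simpa using hI₂.1, hI₂.2.1, fun z hz => ?_⟩
          rcases Nat.lt_succ_iff_lt_or_eq.1 hz with h3 | rfl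
          · exact hI₂.2.2 z h3
          · rw [hBad]
            exact hb
        · right
          simpa [hFound] using hI₂
    · intro s₂ hA₂ _ hI₂
      rw [hc₁.size] at hI₂
      rcases hI₂ with hI₂ | hI₂
      · left
        refine ⟨by simpa using hI₂.1, fun x' hx' y hy => ?_⟩
        rcases Nat.lt_succ_iff_lt_or_eq.1 hx' with h3 | rfl
        · exact hI₂.2.1 x' h3 y hy
        · exact hI₂.2.2 y hy
      · right
        simpa [hFound] using hI₂
  · intro s₁ hA₁ _ hI
    simp only [Mem.setW_wvar, h0] at hI
    norm_num [h0] at hI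
    rcases hI with hI | hI
    · left
      refine ⟨hI.1, fun x hx y hy hne => ?_⟩
      have := hI.2 x hx y hy
      rw [hBad] at this
      by_contra hn
      exact this ⟨hne, hn⟩
    · right
      simpa only [hFound, hBad] using hI

/-- A vertex that differs from its representative exhibits a class with two members; if there is
none, the ranks are injective. -/
theorem wp_classFind (hW : 4 * (n + 2) ^ 2 ≤ W) (hc : Ctx G n s)
    (hrep : IsRep n (s.warr 2) (s.warr 3))
    (hQ : ∀ s', Agree classFind s s' →
      ((n ≤ s'.wvar 10 ∧ ∀ u < n, ∀ v < n, s.warr 2 u = s.warr 2 v → u = v) ∨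
        (s'.wvar 10 < n ∧ ∃ v < n, v ≠ s'.wvar 10 ∧ s.warr 2 v = s.warr 2 (s'.wvar 10))) →
      Q s') :
    wp f W (n + 2) classFind Q s := by
  have h0 := hc.size
  have hnW : n + 2 ≤ W := by nlinarith
  refine wp_mono (fun s' h => hQ s' h.1 h.2) (wp_frame ?_)
  refine wp_seq ⟨trivial, wp_findLast (fun y => s.warr 3 (s.warr 2 y) ≠ y) (by decide) (by decide)
    (by decide) (by simp [h0]) (by simp [h0]; omega) ?_ ?_⟩
  · intro i hi s₁ hA hy
    have e2 := hA.warr 2 (by decide)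
    have e3 := hA.warr 3 (by decide)
    simp [hy, e2, e3]
  · intro s₁ hA₁ h₁
    norm_num [h0] at h₁
    rcases h₁ with h₁ | h₁
    · left
      refine ⟨h₁.1.ge, fun u hu v hv e => ?_⟩
      rw [← h₁.2 u hu, ← h₁.2 v hv, e]
    · right
      exact ⟨h₁.1, _, (hrep _ h₁.1).1, h₁.2, (hrep _ h₁.1).2⟩

open Classical in
theorem wp_pivotKey (hW : 4 * (n + 2) ^ 2 ≤ W) (hc : Ctx G n s) (hx : s.wvar 6 < n)
    (hQ : ∀ s', Agree pivotKey s s' → (∀ v < n, s'.warr 5 v ≤ 1 ∧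
      (s'.warr 5 v = 1 ↔ (s.warr 2 (s.wvar 6) < s.wvar 7 ↔ ¬ G.Adj (s.wvar 6) v))) → Q s') :
    wp f W (n + 2) pivotKey Q s := by
  have h0 := hc.size
  have hnW : n + 2 ≤ W := by nlinarith
  have hW1 : 1 ≤ W := by omega
  refine wp_mono (fun s' h => hQ s' h.1 h.2) (wp_frame ?_)
  refine ⟨by simp, fun hb => ?_, fun hb => ?_⟩
  · simp at hb
    refine wp_map (a := 5) (fun v => 1 - adjNat G (s.wvar 6) v) (by decide) (by decide) (by decide)
      (by omega) (by omega) ?_ ?_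
    · intro v hv s₁ hA hy _
      rw [h0] at hv
      have hc₁ : Ctx G n s₁ := hc.agree hA (by decide) (by decide) (by decide)
      have e6 : s₁.wvar 6 = s.wvar 6 := hA.wvar 6 (by decide)
      have a1 : (WExpr.var 6).eval s₁ < n := by simp [e6, hx]
      have a2 : (WExpr.var 4).eval s₁ < n := by simp [hy, hv]
      refine ⟨trivial, ⟨hW1, hc₁.adjE_fits hW a1 a2 trivial trivial⟩, ?_, fun k hk => ?_⟩
      · simp only [WExpr.eval, Mem.putW_warr, hc₁.adjE_eval a1 a2, hy, e6, if_true]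
      · simp [hy, hk]
    · intro s₁ _ h v hv
      rw [h v (by omega)]
      unfold adjNat
      split_ifs with hadj <;> simp [hb, hadj]
  · simp at hb
    refine wp_map (a := 5) (fun v => adjNat G (s.wvar 6) v) (by decide) (by decide) (by decide)
      (by omega) (by omega) ?_ ?_
    · intro v hv s₁ hA hy _
      rw [h0] at hv
      have hc₁ : Ctx G n s₁ := hc.agree hA (by decide) (by decide) (by decide)
      have e6 : s₁.wvar 6 = s.wvar 6 := hA.wvar 6 (by decide)
      have a1 : (WExpr.var 6).eval s₁ < n := by simp [e6, hx]
      have a2 : (WExpr.var 4).eval s₁ < n := by simp [hy, hv]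
      refine ⟨trivial, hc₁.adjE_fits hW a1 a2 trivial trivial, ?_, fun k hk => ?_⟩
      · simp only [WExpr.eval, Mem.putW_warr, hc₁.adjE_eval a1 a2, hy, e6, if_true]
      · simp [hy, hk]
    · intro s₁ _ h v hv
      rw [h v (by omega)]
      unfold adjNat
      split_ifs with hadj <;> simp [not_lt.2 hb, hadj]

theorem wp_firstKey (hW : 4 * (n + 2) ^ 2 ≤ W) (hc : Ctx G n s)
    (hQ : ∀ s', Agree firstKey s s' →
      (∀ v < n, s'.warr 5 v = if v = s.wvar 6 then 0 else 1) → Q s') :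
    wp f W (n + 2) firstKey Q s := by
  have h0 := hc.size
  have hnW : n + 2 ≤ W := by nlinarith
  have hW1 : 1 ≤ W := by omega
  refine wp_map (a := 5) (fun v => if v = s.wvar 6 then 0 else 1) (by decide) (by decide)
    (by decide) (by omega) (by omega) ?_ (by rw [h0]; exact hQ)
  intro v hv s₁ hA hy _
  have e6 : s₁.wvar 6 = s.wvar 6 := hA.wvar 6 (by decide)
  refine ⟨by simp, fun hb => ?_, fun hb => ?_⟩
  · simp [hy, e6] at hb
    simp [hy, hb]
    intro k hk
    simp [hk]
  · simp [hy, e6] at hb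
    simp [hy, hb, hW1]
    intro k hk
    simp [hk]

theorem wp_rankUpdate (hW : 4 * (n + 2) ^ 2 ≤ W) (hc : Ctx G n s)
    (hrk : ∀ v < n, s.warr 2 v ≤ n) (hpc : s.wvar 7 ≤ n) (hkey : ∀ v < n, s.warr 5 v ≤ 1)
    (hQ : ∀ s', Agree rankUpdate s s' →
      (∀ v < n, s'.warr 2 v = splitRank (s.warr 2) (s.warr 5) (s.wvar 7) v) → Q s') :
    wp f W (n + 2) rankUpdate Q s := by
  have h0 := hc.size
  have hnW : n + 3 ≤ W := by nlinarith
  have hW1 : 1 ≤ W := by omega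
  refine wp_map (a := 2) (fun v => splitRank (s.warr 2) (s.warr 5) (s.wvar 7) v) (by decide)
    (by decide) (by decide) (by omega) (by omega) ?_ (by rw [h0]; exact hQ)
  intro v hv s₁ hA hy h2
  rw [h0] at hv
  have e7 : s₁.wvar 7 = s.wvar 7 := hA.wvar 7 (by decide)
  have e5 : s₁.warr 5 = s.warr 5 := hA.warr 5 (by decide)
  have b1 := hrk v hv
  have b2 := hkey v hv
  refine ⟨?_, fun hb => ?_, fun hb => ?_⟩
  · simp only [Test.Fits, WExpr.Fits, WExpr.eval, hy, e7, e5, h2, true_and]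
    omega
  · simp only [Test.Holds, WExpr.eval, hy, e7, e5, h2] at hb
    simp only [wp, WExpr.Fits, WExpr.eval, hy, h2, true_and, Mem.putW_warr, if_true, splitRank,
      if_pos hb]
    exact ⟨⟨hW1, by omega⟩, fun k hk => by simp [hk]⟩
  · simp only [Test.Holds, WExpr.eval, hy, e7, e5, h2] at hb
    simp only [wp, splitRank, if_neg hb]
    exact ⟨h2, fun _ _ => trivial⟩

/-- Either a vertex splits a foreign class, or all classes are modules. In the latter case a minimal
vertex of a class with two members is split off, or all classes are single vertices and nothing
remains to be done. -/
theorem wp_rankRound (hW : 4 * (n + 2) ^ 2 ≤ W) (hc : Ctx G n s) {k : ℕ} (hk : k < n)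
    (hI : RankInv G n k (s.warr 2))
    (hQ : ∀ s', Agree rankRound s s' → RankInv G n (k + 1) (s'.warr 2) → Q s') :
    wp f W (n + 2) rankRound Q s := by
  have hnW : n + 2 ≤ W := by nlinarith
  have hW1 : 1 ≤ W := by omega
  refine wp_mono (fun s' h => hQ s' h.1 h.2) (wp_frame ?_)
  refine wp_seq (wp_repFill hW hc fun s₁ hA₁ hrep => ?_)
  have hc₁ := hc.agree hA₁ (by decide) (by decide) (by decide)
  have e2₁ : s₁.warr 2 = s.warr 2 := hA₁.warr 2 (by decide)
  rw [← e2₁] at hI hrep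
  refine wp_seq (wp_splitFind hW hc₁ hrep fun s₂ hA₂ hsplit => ?_)
  have hc₂ := hc₁.agree hA₂ (by decide) (by decide) (by decide)
  have e2₂ : s₂.warr 2 = s₁.warr 2 := hA₂.warr 2 (by decide)
  have e3₂ : s₂.warr 3 = s₁.warr 3 := hA₂.warr 3 (by decide)
  rw [← e2₂] at hI hrep hsplit
  rw [← e3₂] at hrep hsplit
  refine ⟨by simp [hW1], fun hb => ?_, fun hb => ?_⟩
  · simp at hb
    obtain ⟨-, hx, y, hy, hpc, hxy, hbad⟩ := hsplit.resolve_left fun h => by omega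
    refine wp_seq (wp_pivotKey hW hc₂ hx fun s₃ hA₃ hkey => ?_)
    have hc₃ := hc₂.agree hA₃ (by decide) (by decide) (by decide)
    have e2₃ : s₃.warr 2 = s₂.warr 2 := hA₃.warr 2 (by decide)
    have e7₃ : s₃.wvar 7 = s₂.wvar 7 := hA₃.wvar 7 (by decide)
    refine wp_rankUpdate hW hc₃ ?_ ?_ (fun v hv => (hkey v hv).1) fun s₄ hA₄ hrk => ?_
    · intro v hv
      rw [e2₃]
      exact (hI.le v hv).trans (by omega)
    · rw [e7₃, hpc]
      exact (hI.le y hy).trans (by omega)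
    · rw [e2₃, e7₃] at hrk
      refine RankInv.congr ?_ hrk
      have hcons := hI.consistent.split_pivot hx (pc := s₂.wvar 7) (by rw [hpc]; exact hxy)
        (fun v hv => (hkey v hv).1) (fun v hv _ => (hkey v hv).2)
      obtain ⟨hz, hzr⟩ := hrep y hy
      have k1 := hkey y hy
      have k2 := hkey _ hz
      -- The pivot distinguishes `y` from its representative, so their keys differ and both new
      -- classes are nonempty. Which of the two gets key `1` depends on the side on which the pivot
      -- lies.
      by_cases h1 : s₃.warr 5 y = 1
      · have h2 : s₃.warr 5 (s₂.warr 3 (s₂.warr 2 y)) ≠ 1 := by tauto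
        exact hI.split hcons hz hy (hzr.trans hpc.symm) hpc.symm (by omega) h1
          (fun v hv => (hkey v hv).1)
      · have h2 : s₃.warr 5 (s₂.warr 3 (s₂.warr 2 y)) = 1 := by tauto
        exact hI.split hcons hy hz hpc.symm (hzr.trans hpc.symm) (by omega) h2
          (fun v hv => (hkey v hv).1)
  · simp at hb
    have hstable := (hsplit.resolve_right fun h => by omega).2
    refine wp_seq (wp_classFind hW hc₂ hrep fun s₃ hA₃ hclass => ?_)
    have hc₃ := hc₂.agree hA₃ (by decide) (by decide) (by decide)
    have e2₃ : s₃.warr 2 = s₂.warr 2 := hA₃.warr 2 (by decide)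
    refine ⟨by simp, fun hb0 => ?_, fun hb0 => ?_⟩
    · simp [hc₃.size] at hb0
      obtain ⟨v, hv, hvz, hvr⟩ := (hclass.resolve_left fun h => by omega).2
      refine wp_seq ⟨by simp, ?_⟩
      obtain ⟨s₄, hs₄⟩ : ∃ s₄, s₄ = s₃.setW 7 ((WExpr.get 2 (.var 10)).eval s₃) := ⟨_, rfl⟩
      rw [← hs₄]
      obtain ⟨z, hz⟩ : ∃ z, z = s₃.wvar 10 := ⟨_, rfl⟩
      rw [← hz] at hb0 hvz hvr
      have hc₄ : Ctx G n s₄ := by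
        rw [hs₄]
        exact ⟨by simp [hc₃.size], by simp [hc₃.size2], hc₃.adj⟩
      have e2₄ : s₄.warr 2 = s₂.warr 2 := by rw [hs₄]; exact e2₃
      have e7₄ : s₄.wvar 7 = s₂.warr 2 z := by rw [hs₄]; simp [e2₃, hz]
      obtain ⟨P, hP, -⟩ := id hI.consistent
      refine wp_seq (wp_pick hW hc₄ (P := P) (hP.mono ?_) ?_ fun s₅ hA₅ hend => ?_)
      · intro w hw
        exact (mem_stSet.1 hw).1
      · exact ⟨z, mem_stSet.2 ⟨hb0, by rw [e2₄, e7₄]⟩⟩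
      have hc₅ := hc₄.agree hA₅ (by decide) (by decide) (by decide)
      have e2₅ : s₅.warr 2 = s₂.warr 2 := (hA₅.warr 2 (by decide)).trans e2₄
      have e7₅ : s₅.wvar 7 = s₂.warr 2 z := (hA₅.wvar 7 (by decide)).trans e7₄
      rw [e2₄, e7₄] at hend
      obtain ⟨hxC, T, hT, hsrc⟩ := hend
      rw [mem_stSet] at hxC
      refine wp_seq (wp_firstKey hW hc₅ fun s₆ hA₆ hkey => ?_)
      have hc₆ := hc₅.agree hA₆ (by decide) (by decide) (by decide)
      have e2₆ : s₆.warr 2 = s₂.warr 2 := (hA₆.warr 2 (by decide)).trans e2₅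
      have e7₆ : s₆.wvar 7 = s₂.warr 2 z := (hA₆.wvar 7 (by decide)).trans e7₅
      have hkey1 : ∀ v < n, s₆.warr 5 v ≤ 1 := by
        intro v hv
        rw [hkey v hv]
        split_ifs <;> omega
      refine wp_rankUpdate hW hc₆ ?_ ?_ hkey1 fun s₇ hA₇ hrk => ?_
      · intro v hv
        rw [e2₆]
        exact (hI.le v hv).trans (by omega)
      · rw [e7₆]
        exact (hI.le z hb0).trans (by omega)
      · rw [e2₆, e7₆] at hrk
        refine RankInv.congr ?_ hrk
        have hcons := hI.consistent.split_first (x := s₅.wvar 6) (pc := s₂.warr 2 z)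
          (key := s₆.warr 5) ?_ (Q := T) (hT.mono fun w hw => mem_stSet.2 hw) ?_ hkey
        -- The class has the two members `z` and `v`, so at least one of them is not the vertex
        -- split off.
        · obtain ⟨w, hw, hwx, hwr⟩ : ∃ w < n, w ≠ s₅.wvar 6 ∧ s₂.warr 2 w = s₂.warr 2 z := by
            by_cases e : z = s₅.wvar 6
            · exact ⟨v, hv, by rw [← e]; exact hvz, hvr⟩
            · exact ⟨z, hb0, e, rfl⟩
          exact hI.split hcons hxC.1 hw hxC.2 hwr (by rw [hkey _ hxC.1, if_pos rfl])
            (by rw [hkey _ hw, if_neg hwx]) hkey1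
        · intro x hx hxr u hu w hw hru hrw
          rw [hstable x hx u hu (by rw [hru]; exact hxr),
            hstable x hx w hw (by rw [hrw]; exact hxr), hru, hrw]
        · intro c hc hcr
          exact hsrc c (mem_stSet.2 ⟨hc, hcr⟩)
    · simp [hc₃.size] at hb0
      have hinj := (hclass.resolve_right fun h => by omega).2
      show RankInv G n (k + 1) (s₃.warr 2)
      rw [e2₃]
      exact hI.skip hinj

theorem wp_rankProg (hW : 4 * (n + 2) ^ 2 ≤ W) (hc : Ctx G n s)
    (hI : RankInv G n 0 (s.warr 2))
    (hQ : ∀ s', Agree rankProg s s' → RankConsistent G n (s'.warr 2) →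
      (∀ u < n, ∀ v < n, s'.warr 2 u = s'.warr 2 v → u = v) → Q s') :
    wp f W (n + 2) rankProg Q s := by
  have hnW : n + 2 ≤ W := by nlinarith
  have h0 := hc.size
  refine wp_forUp (fun k s' => RankInv G n k (s'.warr 2)) (by decide) (by decide) (by decide)
    (by omega) (by omega) hI ?_ ?_
  · intro k hk s₁ hA₁ _ hI₁
    have hc₁ : Ctx G n s₁ := hc.agree hA₁ (by decide) (by decide) (by decide)
    exact wp_rankRound hW hc₁ (by omega) hI₁ fun s₂ _ h => h
  · intro s₁ hA₁ _ hI₁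
    rw [h0] at hI₁
    exact hQ s₁ hA₁ hI₁.consistent hI₁.injective

end

/-! ### The program that computes an interval model

The word arrays `6` and `7` hold the endpoints of the intervals, and the word array `8` the numbers
of intervals between two points. -/

/-- Compute the left endpoints. -/
def leftProg : Prog :=
  forUp 3 0 (.seq (countUp 11 4 0 (.conj (.neg (.wle (.get 2 (.var 3)) (.get 2 (.var 4))))
    (.neg (.wle (.lit 1) (adjE (.var 4) (.var 3))))))
    (.wput 6 (.var 3) (.add (.var 11) (.lit 1))))

/-- Compute the right endpoint of one interval. -/
def rightMax : Prog :=
  .seq (.wset 11 (.get 6 (.var 3)))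
  (forUp 4 0 (.ite (.conj (.wle (.lit 1) (adjE (.var 3) (.var 4)))
      (.neg (.wle (.get 6 (.var 4)) (.var 11))))
    (.wset 11 (.get 6 (.var 4))) .skip))

/-- Compute the right endpoints. -/
def rightProg : Prog := forUp 3 0 (.seq rightMax (.wput 7 (.var 3) (.var 11)))

/-- The index of a pair of points in a table. -/
def pairE (x y : ℕ) : WExpr := .add (.mul (.var x) (.var 1)) (.var y)

/-- Count the intervals between any two points. -/
def insideProg : Prog :=
  forUp 3 1 (forUp 12 1 (.seq
    (countUp 11 4 0 (.conj (.neg (.wle (.get 6 (.var 4)) (.var 3)))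
      (.neg (.wle (.var 12) (.get 7 (.var 4))))))
    (.wput 8 (pairE 3 12) (.var 11))))

theorem pair_inj {m a b c d : ℕ} (hb : b < m) (hd : d < m) :
    a * m + b = c * m + d ↔ a = c ∧ b = d := by
  constructor
  · intro h
    have h1 : (a * m + b) / m = (c * m + d) / m := by rw [h]
    rw [Nat.mul_comm a, Nat.mul_comm c, Nat.mul_add_div (by omega), Nat.mul_add_div (by omega),
      Nat.div_eq_of_lt hb, Nat.div_eq_of_lt hd] at h1
    have h2 : a = c := by simpa using h1
    subst h2
    exact ⟨rfl, by omega⟩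
  · rintro ⟨rfl, rfl⟩
    rfl

section

variable {f : ℕ → ℝ} {W : ℕ} {G : SimpleGraph ℕ} {n : ℕ} {s : Mem} {Q : Mem → Prop}

open Classical in
theorem wp_leftProg (hW : 4 * (n + 2) ^ 2 ≤ W) (hc : Ctx G n s)
    (hQ : ∀ s', Agree leftProg s s' → (∀ v < n, s'.warr 6 v =
      ((Finset.range n).filter fun u => s.warr 2 u < s.warr 2 v ∧ ¬ G.Adj u v).card + 1) → Q s') :
    wp f W (n + 2) leftProg Q s := by
  have h0 := hc.size
  have hnW : n + 2 ≤ W := by nlinarith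
  have hW1 : 1 ≤ W := by omega
  refine wp_map (a := 6) _ (by decide) (by decide) (by decide) (by omega) (by omega) ?_
    (by rw [h0]; exact hQ)
  intro v hv s₁ hA₁ hx _
  rw [h0] at hv
  have hc₁ : Ctx G n s₁ := hc.agree hA₁ (by decide) (by decide) (by decide)
  have e2 : s₁.warr 2 = s.warr 2 := hA₁.warr 2 (by decide)
  refine wp_seq (wp_countUp (fun u => s.warr 2 u < s.warr 2 v ∧ ¬ G.Adj u v) (by decide)
    (by decide) (by decide) (by simp [hc₁.size]) (by simp [hc₁.size]; omega) ?_ ?_)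
  · intro u hu s₂ hA₂ hy
    rw [hc₁.size] at hu
    have hc₂ : Ctx G n s₂ := hc₁.agree hA₂ (by decide) (by decide) (by decide)
    have e2' : s₂.warr 2 = s.warr 2 := (hA₂.warr 2 (by decide)).trans e2
    have e3' : s₂.wvar 3 = v := (hA₂.wvar 3 (by decide)).trans hx
    have a1 : (WExpr.var 3).eval s₂ < n := by simp [e3', hv]
    have a2 : (WExpr.var 4).eval s₂ < n := by simp [hy, hu]
    constructor
    · simp [hW1, hc₂.adjE_fits hW a2 a1 trivial trivial]
    · simp only [Test.Holds, hc₂.adjE_eval a2 a1]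
      simp [e2', e3', hy]
  · intro s₂ hA₂ hcnt
    rw [hc₁.size] at hcnt
    have e3' : s₂.wvar 3 = v := (hA₂.wvar 3 (by decide)).trans hx
    have hle : s₂.wvar 11 ≤ n := by
      rw [hcnt]
      simpa using Finset.card_filter_le (Finset.range n)
        fun u => s.warr 2 u < s.warr 2 v ∧ ¬ G.Adj u v
    have e6 : s₂.warr 6 = s₁.warr 6 := hA₂.warr 6 (by decide)
    refine ⟨trivial, ⟨trivial, hW1, ?_⟩, ?_, fun k hk => ?_⟩
    · simp only [WExpr.eval]; omega
    · simp only [WExpr.eval, Mem.putW_warr, e3', if_true, hcnt]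
    · simp [e3', hk, e6]

theorem wp_rightMax (hW : 4 * (n + 2) ^ 2 ≤ W) (hc : Ctx G n s) (hv : s.wvar 3 < n)
    (hQ : ∀ s', Agree rightMax s s' → s.warr 6 (s.wvar 3) ≤ s'.wvar 11 →
      (∀ w < n, G.Adj (s.wvar 3) w → s.warr 6 w ≤ s'.wvar 11) →
      (s'.wvar 11 = s.warr 6 (s.wvar 3) ∨
        ∃ w < n, G.Adj (s.wvar 3) w ∧ s'.wvar 11 = s.warr 6 w) → Q s') :
    wp f W (n + 2) rightMax Q s := by
  have h0 := hc.size
  have hnW : n + 2 ≤ W := by nlinarith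
  have hW1 : 1 ≤ W := by omega
  obtain ⟨v, hvd⟩ : ∃ v, v = s.wvar 3 := ⟨_, rfl⟩
  rw [← hvd] at hv hQ
  refine wp_mono (fun s' h => hQ s' h.1 h.2.1 h.2.2.1 h.2.2.2) (wp_frame
    (Q := fun s' => s.warr 6 v ≤ s'.wvar 11 ∧ (∀ w < n, G.Adj v w → s.warr 6 w ≤ s'.wvar 11) ∧
      (s'.wvar 11 = s.warr 6 v ∨ ∃ w < n, G.Adj v w ∧ s'.wvar 11 = s.warr 6 w)) ?_)
  obtain ⟨s₁, hs₁⟩ : ∃ s₁, s₁ = s.setW 11 ((WExpr.get 6 (.var 3)).eval s) := ⟨_, rfl⟩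
  have hc₁ : Ctx G n s₁ := by
    rw [hs₁]
    exact ⟨by simp [h0], by simp [hc.size2], hc.adj⟩
  have e6₁ : s₁.warr 6 = s.warr 6 := by rw [hs₁]; simp
  have e3₁ : s₁.wvar 3 = v := by rw [hs₁]; simp [hvd]
  have e11₁ : s₁.wvar 11 = s.warr 6 v := by rw [hs₁]; simp [hvd]
  refine wp_seq ⟨by simp, ?_⟩
  rw [← hs₁]
  refine wp_forUp (fun j s' => s.warr 6 v ≤ s'.wvar 11 ∧
    (∀ w < j, G.Adj v w → s.warr 6 w ≤ s'.wvar 11) ∧ (s'.wvar 11 = s.warr 6 v ∨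
        ∃ w < n, G.Adj v w ∧ s'.wvar 11 = s.warr 6 w)) (by decide) (by decide) (by decide)
      (by simp [hc₁.size]) (by simp [hc₁.size]; omega) ?_ ?_ ?_
  · simp [e11₁]
  · intro w hw s₂ hA₂ hy ⟨i1, i2, i3⟩
    rw [hc₁.size] at hw
    have hc₂ : Ctx G n s₂ := hc₁.agree hA₂ (by decide) (by decide) (by decide)
    have e6' : s₂.warr 6 = s.warr 6 := (hA₂.warr 6 (by decide)).trans e6₁
    have e3' : s₂.wvar 3 = v := (hA₂.wvar 3 (by decide)).trans e3₁
    have a1 : (WExpr.var 3).eval s₂ < n := by simp [e3', hv]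
    have a2 : (WExpr.var 4).eval s₂ < n := by simp [hy, hw]
    refine ⟨by simp [hW1, hc₂.adjE_fits hW a1 a2 trivial trivial], fun hb => ?_, fun hb => ?_⟩
    · simp only [Test.Holds, hc₂.adjE_eval a1 a2] at hb
      simp [e6', e3', hy] at hb
      refine ⟨by simp, ?_⟩
      simp only [Mem.setW_wvar, WExpr.eval, e6', hy]
      norm_num
      refine ⟨by omega, fun u hu hadj => ?_, Or.inr ⟨w, hw, hb.1, rfl⟩⟩
      rcases Nat.lt_or_eq_of_le hu with h3 | rfl
      · have := i2 u h3 hadj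
        omega
      · exact le_rfl
    · simp only [Test.Holds, hc₂.adjE_eval a1 a2] at hb
      simp [e6', e3', hy] at hb
      simp only [wp, Mem.setW_wvar]
      norm_num
      refine ⟨i1, fun u hu hadj => ?_, i3⟩
      rcases Nat.lt_or_eq_of_le hu with h3 | rfl
      · exact i2 u h3 hadj
      · exact hb hadj
  · intro s₂ _ _ hI
    rw [hc₁.size] at hI
    exact hI

theorem wp_rightProg (hW : 4 * (n + 2) ^ 2 ≤ W) (hc : Ctx G n s)
    (hQ : ∀ s', Agree rightProg s s' → (∀ v < n, s.warr 6 v ≤ s'.warr 7 v ∧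
      (∀ w < n, G.Adj v w → s.warr 6 w ≤ s'.warr 7 v) ∧
      (s'.warr 7 v = s.warr 6 v ∨ ∃ w < n, G.Adj v w ∧ s'.warr 7 v = s.warr 6 w)) → Q s') :
    wp f W (n + 2) rightProg Q s := by
  have h0 := hc.size
  have hnW : n + 2 ≤ W := by nlinarith
  refine wp_forUp (fun j s' => ∀ v < j, s.warr 6 v ≤ s'.warr 7 v ∧
      (∀ w < n, G.Adj v w → s.warr 6 w ≤ s'.warr 7 v) ∧
      (s'.warr 7 v = s.warr 6 v ∨ ∃ w < n, G.Adj v w ∧ s'.warr 7 v = s.warr 6 w))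
      (by decide) (by decide) (by decide) (by omega) (by omega) (by simp) ?_ ?_
  · intro v hv s₁ hA₁ hx hI
    rw [h0] at hv
    have hc₁ : Ctx G n s₁ := hc.agree hA₁ (by decide) (by decide) (by decide)
    have e6 : s₁.warr 6 = s.warr 6 := hA₁.warr 6 (by decide)
    refine wp_seq (wp_rightMax hW hc₁ (by omega) fun s₂ hA₂ h1 h2 h3 => ?_)
    rw [e6, hx] at h1 h2 h3
    have e3 : s₂.wvar 3 = v := (hA₂.wvar 3 (by decide)).trans hx
    have e7 : s₂.warr 7 = s₁.warr 7 := hA₂.warr 7 (by decide)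
    refine ⟨trivial, trivial, fun u hu => ?_⟩
    simp only [Mem.setW_warr, Mem.putW_warr, WExpr.eval, e3, e7, if_true]
    by_cases e : u = v
    · subst e
      simp only [if_true]
      exact ⟨h1, h2, h3⟩
    · simp only [if_neg e]
      exact hI u (by omega)
  · intro s₁ hA₁ _ hI
    rw [h0] at hI
    exact hQ s₁ hA₁ hI

theorem wp_insideProg (hW : 4 * (n + 2) ^ 2 ≤ W) (hc : Ctx G n s)
    (hQ : ∀ s', Agree insideProg s s' → (∀ i < n + 2, ∀ j < n + 2,
      s'.warr 8 (i * (n + 2) + j) = (inside n (s.warr 6) (s.warr 7) i j).card) → Q s') :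
    wp f W (n + 2) insideProg Q s := by
  have h1 := hc.size2
  have hnW : n + 3 ≤ W := by nlinarith
  obtain ⟨c, hcd⟩ : ∃ c : ℕ → ℕ → ℕ, c = fun i j => (inside n (s.warr 6) (s.warr 7) i j).card :=
    ⟨_, rfl⟩
  refine wp_forUp (fun i s' => ∀ a < i, ∀ b < n + 2, s'.warr 8 (a * (n + 2) + b) = c a b)
    (by decide) (by decide) (by decide) (by omega) (by omega) (by simp) ?_ ?_
  · intro i hi s₁ hA₁ hx hI
    rw [h1] at hi
    have hc₁ : Ctx G n s₁ := hc.agree hA₁ (by decide) (by decide) (by decide)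
    have e6 : s₁.warr 6 = s.warr 6 := hA₁.warr 6 (by decide)
    have e7 : s₁.warr 7 = s.warr 7 := hA₁.warr 7 (by decide)
    refine wp_forUp (fun j s' => (∀ a < i, ∀ b < n + 2, s'.warr 8 (a * (n + 2) + b) = c a b) ∧
      ∀ b < j, s'.warr 8 (i * (n + 2) + b) = c i b) (by decide) (by decide) (by decide)
      (by simp [hc₁.size2]) (by simp [hc₁.size2]; omega) ⟨hI, by simp⟩ ?_ ?_
    · intro j hj s₂ hA₂ hz hI₂
      rw [hc₁.size2] at hj
      have hc₂ : Ctx G n s₂ := hc₁.agree hA₂ (by decide) (by decide) (by decide)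
      have e6₂ : s₂.warr 6 = s.warr 6 := (hA₂.warr 6 (by decide)).trans e6
      have e7₂ : s₂.warr 7 = s.warr 7 := (hA₂.warr 7 (by decide)).trans e7
      have e3₂ : s₂.wvar 3 = i := (hA₂.wvar 3 (by decide)).trans hx
      refine wp_seq (wp_countUp (fun v => i < s.warr 6 v ∧ s.warr 7 v < j) (by decide) (by decide)
        (by decide) (by simp [hc₂.size]) (by simp [hc₂.size]; omega) ?_ ?_)
      · intro v hv s₃ hA₃ hy
        have e6₃ : s₃.warr 6 = s.warr 6 := (hA₃.warr 6 (by decide)).trans e6₂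
        have e7₃ : s₃.warr 7 = s.warr 7 := (hA₃.warr 7 (by decide)).trans e7₂
        have e3₃ : s₃.wvar 3 = i := (hA₃.wvar 3 (by decide)).trans e3₂
        have ez₃ : s₃.wvar 12 = j := (hA₃.wvar 12 (by decide)).trans hz
        simp [e6₃, e7₃, e3₃, ez₃, hy]
      · intro s₃ hA₃ hcnt
        rw [hc₂.size] at hcnt
        have e3₃ : s₃.wvar 3 = i := (hA₃.wvar 3 (by decide)).trans e3₂
        have ez₃ : s₃.wvar 12 = j := (hA₃.wvar 12 (by decide)).trans hz
        have e1₃ : s₃.wvar 1 = n + 2 := (hA₃.wvar 1 (by decide)).trans hc₂.size2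
        have e8₃ : s₃.warr 8 = s₂.warr 8 := hA₃.warr 8 (by decide)
        have hb := index_le hW le_rfl hi hj
        have hcij : s₃.wvar 11 = c i j := by rw [hcnt, hcd]; rfl
        refine ⟨?_, trivial, ?_⟩
        · simp only [pairE, WExpr.Fits, WExpr.eval, e3₃, e1₃, ez₃, true_and]
          exact hb
        · simp only [pairE, Mem.setW_warr, Mem.putW_warr, WExpr.eval, e3₃, e1₃, ez₃, e8₃, if_true,
            hcij]
          refine ⟨fun a ha b hbn => ?_, fun b hbj => ?_⟩
          · rw [if_neg (by rw [pair_inj hbn hj]; omega)]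
            exact hI₂.1 a ha b hbn
          · by_cases e : b = j
            · rw [e, if_pos rfl]
            · rw [if_neg (by rw [pair_inj (by omega) hj]; omega)]
              exact hI₂.2 b (by omega)
    · intro s₂ hA₂ _ hI₂ a ha b hb
      rw [hc₁.size2] at hI₂
      simp only [Mem.setW_warr]
      rcases Nat.lt_succ_iff_lt_or_eq.1 ha with h3 | rfl
      · exact hI₂.1 a h3 b hb
      · exact hI₂.2 b hb
  · intro s₁ hA₁ _ hI
    rw [h1, hcd] at hI
    exact hQ s₁ hA₁ hI

end

/-! ### The state of the table during the recursion -/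

section

variable (f : ℕ → ℝ) (n : ℕ) (L R : ℕ → ℕ)

/-- The value of the choice `m` between the points `i` and `j`. -/
def dpCand (V : ℕ → ℕ → ℝ) (i j m : ℕ) : ℝ := f (throughCount n L R i j m) + V i m + V m j

/-- The cell `i, j` of the table after all choices below `M` have been tried. -/
structure DPCell (V : ℕ → ℕ → ℝ) (ch : ℕ → ℕ → ℕ) (i j M : ℕ) : Prop where
  nonneg : 0 ≤ V i j
  -- For square gains this keeps the entries below `n ^ 2`, so the version on words does not
  -- overflow.
  bound : V i j ≤ f (inside n L R i j).card
  le : ∀ m, i < m → m < j → m < M → dpCand f n L R V i j m ≤ V i j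
  attained : (V i j = 0 ∧ ∀ m, i < m → m < j → M ≤ m) ∨
    (i < ch i j ∧ ch i j < j ∧ V i j = dpCand f n L R V i j (ch i j))

/-- The table when the cell `i, j` has been computed up to the choice `M`. -/
structure DPInv (V : ℕ → ℕ → ℝ) (ch : ℕ → ℕ → ℕ) (i j M : ℕ) : Prop where
  past : ∀ a b, a < b → b ≤ n + 1 → (i < a ∨ a = i ∧ b < j) → DPCell f n L R V ch a b (n + 2)
  future : ∀ a b, a < b → b ≤ n + 1 → (a < i ∨ a = i ∧ j < b) → V a b = 0
  now : i < j → j ≤ n + 1 → DPCell f n L R V ch i j M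

variable {f n L R} {V V' : ℕ → ℕ → ℝ} {ch ch' : ℕ → ℕ → ℕ} {i j M : ℕ}

/-- A cell depends only on entries within its window, and on `M` only through the choices strictly
inside it. So finished cells survive later updates elsewhere. -/
theorem DPCell.congr {M' : ℕ} (h : DPCell f n L R V ch i j M)
    (hV : ∀ a b, i ≤ a → b ≤ j → a < b → V' a b = V a b) (hc : ch' i j = ch i j) (hij : i < j)
    (hM : ∀ m, i < m → m < j → (m < M' ↔ m < M)) : DPCell f n L R V' ch' i j M' := by
  have hcand : ∀ m, i < m → m < j → dpCand f n L R V' i j m = dpCand f n L R V i j m := by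
    intro m h1 h2
    unfold dpCand
    rw [hV i m le_rfl h2.le h1, hV m j h1.le le_rfl h2]
  have e := hV i j le_rfl le_rfl hij
  refine ⟨by rw [e]; exact h.nonneg, by rw [e]; exact h.bound, fun m h1 h2 h3 => ?_, ?_⟩
  · rw [hcand m h1 h2, e]
    exact h.le m h1 h2 ((hM m h1 h2).1 h3)
  · rw [e, hc]
    refine h.attained.imp (fun h1 => ⟨h1.1, fun m h2 h3 => ?_⟩) (fun h1 => ?_)
    · have := h1.2 m h2 h3
      have := hM m h2 h3
      omega
    · rw [hcand _ h1.1 h1.2.1]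
      exact h1

theorem DPInv.cell_bounds (hf : IsGain f) (h : DPInv f n L R V ch i j M) {a b : ℕ} (hab : a < b)
    (hb : b ≤ n + 1) : 0 ≤ V a b ∧ V a b ≤ f (inside n L R a b).card := by
  by_cases h1 : i < a ∨ a = i ∧ b < j
  · exact ⟨(h.past a b hab hb h1).nonneg, (h.past a b hab hb h1).bound⟩
  · by_cases h2 : a < i ∨ a = i ∧ j < b
    · rw [h.future a b hab hb h2]
      exact ⟨le_rfl, hf.nonneg _⟩
    · have e1 : a = i := by omega
      have e2 : b = j := by omega
      subst e1 e2
      exact ⟨(h.now hab hb).nonneg, (h.now hab hb).bound⟩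

/-- Superadditivity is the `shift` property with the whole smaller part moved. -/
theorem IsGain.add_le (hf : IsGain f) (a b : ℕ) : f a + f b ≤ f (a + b) := by
  rcases le_total a b with h | h
  · have := hf.shift b a a le_rfl h
    rw [Nat.sub_self, hf.zero, add_zero, Nat.add_comm b] at this
    linarith
  · have := hf.shift a b b le_rfl h
    rw [Nat.sub_self, hf.zero, add_zero] at this
    exact this

theorem dpCand_bounds {G : SimpleGraph ℕ} (hM : IsModel G n L R) (hf : IsGain f) {m : ℕ}
    (him : i < m) (hmj : m < j)
    (h1 : 0 ≤ V i m ∧ V i m ≤ f (inside n L R i m).card)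
    (h2 : 0 ≤ V m j ∧ V m j ≤ f (inside n L R m j).card) :
    0 ≤ dpCand f n L R V i j m ∧ dpCand f n L R V i j m ≤ f (inside n L R i j).card := by
  have hsplit := card_split hM him hmj (fun _ => True)
  simp only [Finset.filter_true] at hsplit
  rw [← throughCount_eq hM him hmj] at hsplit
  have e1 := hf.add_le (throughCount n L R i j m)
    ((inside n L R i m).card + (inside n L R m j).card)
  have e2 := hf.add_le (inside n L R i m).card (inside n L R m j).card
  have e3 := hf.nonneg (throughCount n L R i j m)
  rw [hsplit]
  unfold dpCand
  constructor <;> linarith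

theorem DPInv.try_choice {G : SimpleGraph ℕ} (hM : IsModel G n L R) (hf : IsGain f) {m : ℕ}
    (him : i < m) (hmj : m < j) (hj : j ≤ n + 1) (h : DPInv f n L R V ch i j m)
    (hstep : (V i j ≤ dpCand f n L R V i j m ∧
        (∀ a b, a < b → b ≤ n + 1 →
          V' a b = if a = i ∧ b = j then dpCand f n L R V i j m else V a b) ∧
        (∀ a b, a < b → b ≤ n + 1 → ch' a b = if a = i ∧ b = j then m else ch a b)) ∨
      (dpCand f n L R V i j m < V i j ∧ (∀ a b, a < b → b ≤ n + 1 → V' a b = V a b) ∧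
        ∀ a b, a < b → b ≤ n + 1 → ch' a b = ch a b)) :
    DPInv f n L R V' ch' i j (m + 1) := by
  have hij : i < j := him.trans hmj
  have hnow := h.now hij hj
  have hb1 := h.cell_bounds hf him (by omega)
  have hb2 := h.cell_bounds hf hmj hj
  have hb := dpCand_bounds (V := V) hM hf him hmj hb1 hb2
  have hne : ∀ a b, a < b → b ≤ n + 1 → ¬ (a = i ∧ b = j) →
      V' a b = V a b ∧ ch' a b = ch a b := by
    intro a b hab hbn hne
    rcases hstep with ⟨-, h1, h2⟩ | ⟨-, h1, h2⟩
    · rw [h1 a b hab hbn, h2 a b hab hbn, if_neg hne, if_neg hne]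
      exact ⟨rfl, rfl⟩
    · exact ⟨h1 a b hab hbn, h2 a b hab hbn⟩
  refine ⟨fun a b hab hbn hp => ?_, fun a b hab hbn hp => ?_, fun _ _ => ?_⟩
  · refine (h.past a b hab hbn hp).congr (fun a' b' ha hb' hab' => ?_) ?_ hab fun _ _ _ => Iff.rfl
    · exact (hne a' b' hab' (by omega) (by omega)).1
    · exact (hne a b hab hbn (by omega)).2
  · rw [(hne a b hab hbn (by omega)).1]
    exact h.future a b hab hbn hp
  · have hcand : ∀ m', i < m' → m' < j →
        dpCand f n L R V' i j m' = dpCand f n L R V i j m' := by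
      intro m' h1 h2
      unfold dpCand
      rw [(hne i m' h1 (by omega) (by omega)).1, (hne m' j h2 hj (by omega)).1]
    rcases hstep with ⟨hle, h1, h2⟩ | ⟨hlt, h1, h2⟩
    · have e1 := h1 i j hij hj
      have e2 := h2 i j hij hj
      rw [if_pos ⟨rfl, rfl⟩] at e1 e2
      refine ⟨by rw [e1]; exact hb.1, by rw [e1]; exact hb.2, fun m' h3 h4 h5 => ?_, Or.inr ?_⟩
      · rw [e1, hcand m' h3 h4]
        rcases Nat.lt_succ_iff_lt_or_eq.1 h5 with h6 | rfl
        · exact (hnow.le m' h3 h4 h6).trans hle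
        · exact le_rfl
      · rw [e2, e1, hcand m him hmj]
        exact ⟨him, hmj, rfl⟩
    · have e1 := h1 i j hij hj
      have e2 := h2 i j hij hj
      refine ⟨by rw [e1]; exact hnow.nonneg, by rw [e1]; exact hnow.bound,
        fun m' h3 h4 h5 => ?_, Or.inr ?_⟩
      · rw [e1, hcand m' h3 h4]
        rcases Nat.lt_succ_iff_lt_or_eq.1 h5 with h6 | rfl
        · exact hnow.le m' h3 h4 h6
        · exact hlt.le
      · rcases hnow.attained with h3 | h3
        -- A cell without a choice has value `0`, and candidates are nonnegative. As the test admits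
        -- equality, the first choice is always recorded, even one of value `0`.
        · linarith [hb.1, h3.1]
        · rw [e2, e1, hcand _ h3.1 h3.2.1]
          exact h3

theorem DPInv.skip_choice {m : ℕ} (hn : ¬ (i < m ∧ m < j)) (h : DPInv f n L R V ch i j m) :
    DPInv f n L R V ch i j (m + 1) :=
  ⟨h.past, h.future, fun h1 h2 => (h.now h1 h2).congr (fun _ _ _ _ _ => rfl) rfl h1
    fun m' h3 h4 => by omega⟩

theorem DPCell.start (hf : IsGain f) (h : V i j = 0) : DPCell f n L R V ch i j 0 :=
  ⟨h.ge, by rw [h]; exact hf.nonneg _, fun m _ _ h3 => absurd h3 (Nat.not_lt_zero m),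
    Or.inl ⟨h, fun m _ _ => Nat.zero_le m⟩⟩

theorem DPInv.next_col (hf : IsGain f) (h : DPInv f n L R V ch i j (n + 2)) :
    DPInv f n L R V ch i (j + 1) 0 := by
  refine ⟨fun a b hab hb hp => ?_, fun a b hab hb hp => h.future a b hab hb (by omega),
    fun h1 h2 => DPCell.start hf (h.future i (j + 1) h1 h2 (by omega))⟩
  by_cases h1 : i < a ∨ a = i ∧ b < j
  · exact h.past a b hab hb h1
  · have e1 : a = i := by omega
    have e2 : b = j := by omega
    subst e1 e2
    exact h.now hab hb

/-- The table before the row `n + 1 - k` is computed. -/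
structure DPRows (f : ℕ → ℝ) (n : ℕ) (L R : ℕ → ℕ) (V : ℕ → ℕ → ℝ) (ch : ℕ → ℕ → ℕ) (k : ℕ) :
    Prop where
  past : ∀ a b, a < b → b ≤ n + 1 → n + 2 ≤ a + k → DPCell f n L R V ch a b (n + 2)
  future : ∀ a b, a < b → b ≤ n + 1 → a + k < n + 2 → V a b = 0

theorem DPRows.inv {k : ℕ} (hk : k < n + 2) (h : DPRows f n L R V ch k) :
    DPInv f n L R V ch (n + 1 - k) 0 0 :=
  ⟨fun a b hab hb hp => h.past a b hab hb (by omega),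
    fun a b hab hb hp => h.future a b hab hb (by omega), fun h1 => absurd h1 (Nat.not_lt_zero _)⟩

theorem DPInv.rows {k : ℕ} (hk : k < n + 2) (h : DPInv f n L R V ch (n + 1 - k) (n + 2) 0) :
    DPRows f n L R V ch (k + 1) :=
  ⟨fun a b hab hb hp => h.past a b hab hb (by omega),
    fun a b hab hb hp => h.future a b hab hb (by omega)⟩

/-- A window with an interior point cannot be in the initial state after all choices have been
tried, so its recorded choice is valid and attains the value. -/
theorem DPRows.isDPTable (h : DPRows f n L R V ch (n + 2)) : IsDPTable f n L R V ch := by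
  have hcell : ∀ a b, a < b → b ≤ n + 1 → DPCell f n L R V ch a b (n + 2) := fun a b hab hb =>
    h.past a b hab hb (by omega)
  have hatt : ∀ i j, i + 1 < j → j ≤ n + 1 →
      i < ch i j ∧ ch i j < j ∧ V i j = dpCand f n L R V i j (ch i j) := by
    intro i j hij hj
    refine (hcell i j (by omega) hj).attained.resolve_left fun h1 => ?_
    have := h1.2 (i + 1) (by omega) hij
    omega
  refine ⟨fun i hi => ?_, fun i j hij hj => ?_, fun i j hij hj => (hatt i j hij hj).2.2,
    fun i j m him hmj hj => (hcell i j (by omega) hj).le m him hmj (by omega)⟩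
  · rcases (hcell i (i + 1) (by omega) (by omega)).attained with h1 | h1
    · exact h1.1
    · omega
  · exact ⟨(hatt i j hij hj).1, (hatt i j hij hj).2.1⟩

end

/-! ### The program that fills the table

The word array `9` holds the choices. The values are in the real array `0` or, for the program that
uses words only, in the word array `10`. -/

/-- The number of intervals through the current choice. -/
def throughE : WExpr :=
  .sub (.sub (.get 8 (pairE 13 4)) (.get 8 (pairE 13 12))) (.get 8 (pairE 12 4))

/-- Try one choice, with real values. -/
def realStep : Prog :=
  .ite (.rle (.get 0 (pairE 13 4))
      (.add (.add (.unit throughE) (.get 0 (pairE 13 12))) (.get 0 (pairE 12 4))))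
    (.seq (.rput 0 (pairE 13 4)
      (.add (.add (.unit throughE) (.get 0 (pairE 13 12))) (.get 0 (pairE 12 4))))
      (.wput 9 (pairE 13 4) (.var 12))) .skip

/-- Try one choice, where the gain is the square of the size. -/
def wordStep : Prog :=
  .ite (.wle (.get 10 (pairE 13 4))
      (.add (.add (.mul throughE throughE) (.get 10 (pairE 13 12))) (.get 10 (pairE 12 4))))
    (.seq (.wput 10 (pairE 13 4)
      (.add (.add (.mul throughE throughE) (.get 10 (pairE 13 12))) (.get 10 (pairE 12 4))))
      (.wput 9 (pairE 13 4) (.var 12))) .skip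

/-- Try one choice. -/
def dpStep (b : Bool) : Prog := if b then realStep else wordStep

/-- The values in the table. -/
def dpVal (b : Bool) (n : ℕ) (s : Mem) (i j : ℕ) : ℝ :=
  if b then s.rarr 0 (i * (n + 2) + j) else (s.warr 10 (i * (n + 2) + j) : ℝ)

/-- The choices in the table. -/
def dpCh (n : ℕ) (s : Mem) (i j : ℕ) : ℕ := s.warr 9 (i * (n + 2) + j)

/-- Fill the table. -/
def dpProg (b : Bool) : Prog :=
  forUp 3 1 (.seq (.wset 13 (.sub (.sub (.var 1) (.lit 1)) (.var 3)))
    (forUp 4 1 (forUp 12 1 (.ite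
      (.conj (.neg (.wle (.var 12) (.var 13))) (.neg (.wle (.var 4) (.var 12))))
      (dpStep b) .skip))))

/-- The gain function `f` of the unit (`b = true`) or the square. -/
def StepGain (b : Bool) (f g : ℕ → ℝ) : Prop :=
  if b then g = f else g = fun a : ℕ => (a : ℝ) ^ 2

/-- The memory holds the table of the numbers of intervals between two points. -/
def HasInside (n : ℕ) (L R : ℕ → ℕ) (s : Mem) : Prop :=
  ∀ i < n + 2, ∀ j < n + 2, s.warr 8 (i * (n + 2) + j) = (inside n L R i j).card

section

variable {f g : ℕ → ℝ} {W : ℕ} {G : SimpleGraph ℕ} {n : ℕ} {s : Mem} {Q : Mem → Prop}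
  {L R : ℕ → ℕ} {b : Bool}

theorem pairE_spec (hW : 4 * (n + 2) ^ 2 ≤ W) (hc : Ctx G n s) {x y : ℕ} (hx : s.wvar x < n + 2)
    (hy : s.wvar y < n + 2) : (pairE x y).Fits W s ∧
      (pairE x y).eval s = s.wvar x * (n + 2) + s.wvar y := by
  simp only [pairE, WExpr.Fits, WExpr.eval, hc.size2, true_and, and_true]
  exact index_le hW le_rfl hx hy

theorem throughE_spec (hW : 4 * (n + 2) ^ 2 ≤ W) (hc : Ctx G n s) (hin : HasInside n L R s)
    {i j m : ℕ} (hi : s.wvar 13 = i) (hj : s.wvar 4 = j) (hm : s.wvar 12 = m)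
    (hin2 : i < n + 2) (hjn : j < n + 2) (hmn : m < n + 2) :
    throughE.Fits W s ∧ throughE.eval s = throughCount n L R i j m := by
  subst hi hj hm
  have e1 := pairE_spec hW hc hin2 hjn
  have e2 := pairE_spec hW hc hin2 hmn
  have e3 := pairE_spec hW hc hmn hjn
  simp only [throughE, WExpr.Fits, WExpr.eval, e1, e2, e3, hin _ hin2 _ hjn, hin _ hin2 _ hmn,
    hin _ hmn _ hjn, throughCount, and_true]

/-- The conclusion has the form required by `DPInv.try_choice`, both for exact reals and for words,
so the table loop is verified once for the two programs. -/
theorem wp_dpStep (hW : 4 * (n + 2) ^ 2 ≤ W) (hc : Ctx G n s) (hin : HasInside n L R s)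
    (hM : IsModel G n L R) (hg : IsGain g) (hfg : StepGain b f g) {i j m : ℕ}
    (hi : s.wvar 13 = i) (hj : s.wvar 4 = j) (hm : s.wvar 12 = m) (him : i < m) (hmj : m < j)
    (hjn : j ≤ n + 1)
    (hV : ∀ a b', a < b' → b' ≤ n + 1 →
      0 ≤ dpVal b n s a b' ∧ dpVal b n s a b' ≤ g (inside n L R a b').card)
    (hQ : ∀ s',
      ((dpVal b n s i j ≤ dpCand g n L R (dpVal b n s) i j m ∧
        (∀ a b', a < b' → b' ≤ n + 1 → dpVal b n s' a b' =
          if a = i ∧ b' = j then dpCand g n L R (dpVal b n s) i j m else dpVal b n s a b') ∧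
        (∀ a b', a < b' → b' ≤ n + 1 →
          dpCh n s' a b' = if a = i ∧ b' = j then m else dpCh n s a b')) ∨
      (dpCand g n L R (dpVal b n s) i j m < dpVal b n s i j ∧
        (∀ a b', a < b' → b' ≤ n + 1 → dpVal b n s' a b' = dpVal b n s a b') ∧
        ∀ a b', a < b' → b' ≤ n + 1 → dpCh n s' a b' = dpCh n s a b')) → Q s') :
    wp f W (n + 2) (dpStep b) Q s := by
  have hnW : n + 2 ≤ W := by nlinarith
  obtain ⟨t1, t2⟩ := throughE_spec hW hc hin hi hj hm (by omega) (by omega) (by omega)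
  obtain ⟨p1, q1⟩ := pairE_spec (x := 13) (y := 4) hW hc (by omega) (by omega)
  obtain ⟨p2, q2⟩ := pairE_spec (x := 13) (y := 12) hW hc (by omega) (by omega)
  obtain ⟨p3, q3⟩ := pairE_spec (x := 12) (y := 4) hW hc (by omega) (by omega)
  rw [hi, hj] at q1
  rw [hi, hm] at q2
  rw [hm, hj] at q3
  have hcand := dpCand_bounds (V := dpVal b n s) hM hg him hmj (hV i m him (by omega))
    (hV m j hmj hjn)
  cases b with
  | true =>
    have hfg : g = f := by simpa [StepGain] using hfg
    subst hfg
    simp only [dpVal, dpCh, dpCand, if_true] at hQ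
    refine ⟨by simp [p1, p2, p3, t1], fun hb => ?_, fun hb => ?_⟩
    · simp only [Test.Holds, RExpr.eval, q1, q2, q3, t2] at hb
      refine ⟨p1, by simp [p2, p3, t1], ?_⟩
      obtain ⟨s', hs'⟩ : ∃ s' : Mem, s' = s.putR 0 (WExpr.eval s (pairE 13 4)) (RExpr.eval g s
        (((RExpr.unit throughE).add (.get 0 (pairE 13 12))).add (.get 0 (pairE 12 4)))) :=
        ⟨_, rfl⟩
      rw [← hs']
      have hc' : Ctx G n s' := by
        rw [hs']
        exact ⟨hc.size, hc.size2, hc.adj⟩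
      have hw : s'.wvar = s.wvar := by rw [hs']; rfl
      obtain ⟨p1', q1'⟩ := pairE_spec (x := 13) (y := 4) hW hc' (by rw [hw]; omega)
        (by rw [hw]; omega)
      rw [hw, hi, hj] at q1'
      refine ⟨p1', trivial, hQ _ (Or.inl ⟨hb, ?_, ?_⟩)⟩
      · intro a b' hab hb'
        simp only [Mem.putW_rarr, hs', Mem.putR_rarr, if_true, q1, RExpr.eval, q2, q3, t2,
          pair_inj (show b' < n + 2 by omega) (show j < n + 2 by omega)]
      · intro a b' hab hb'
        simp only [Mem.putW_warr, q1', if_true, WExpr.eval, hw, hm,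
          pair_inj (show b' < n + 2 by omega) (show j < n + 2 by omega)]
        rw [hs', Mem.putR_warr]
    · simp only [Test.Holds, RExpr.eval, q1, q2, q3, t2, not_le] at hb
      exact hQ s (Or.inr ⟨hb, fun _ _ _ _ => rfl, fun _ _ _ _ => rfl⟩)
  | false =>
    have hfg : g = fun a : ℕ => (a : ℝ) ^ 2 := by simpa [StepGain] using hfg
    subst hfg
    simp only [dpVal, dpCh, dpCand, Bool.false_eq_true, if_false] at hQ
    simp only [dpVal, dpCand, Bool.false_eq_true, if_false] at hcand
    obtain ⟨c, hcdef⟩ : ∃ c, c = throughCount n L R i j m * throughCount n L R i j m +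
      s.warr 10 (i * (n + 2) + m) + s.warr 10 (m * (n + 2) + j) := ⟨_, rfl⟩
    have hcast : ((throughCount n L R i j m : ℕ) : ℝ) ^ 2 + (s.warr 10 (i * (n + 2) + m) : ℝ) +
      (s.warr 10 (m * (n + 2) + j) : ℝ) = (c : ℝ) := by
      rw [hcdef]; push_cast; ring
    rw [hcast] at hcand hQ
    have hcn : (inside n L R i j).card ≤ n := by
      simpa [inside] using Finset.card_filter_le (Finset.range n) fun v => i < L v ∧ R v < j
    -- By superadditivity the candidate is at most the square of the number of intervals in the
    -- window.
    have hcW : c ≤ W := by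
      have h1 : c ≤ (inside n L R i j).card ^ 2 := by exact_mod_cast hcand.2
      have h2 := Nat.pow_le_pow_left hcn 2
      nlinarith
    have hfit : (WExpr.add (.add (.mul throughE throughE) (.get 10 (pairE 13 12)))
        (.get 10 (pairE 12 4))).Fits W s := by
      simp only [WExpr.Fits, WExpr.eval, t1, t2, p2, p3, q2, q3, true_and]
      omega
    have heval : (WExpr.add (.add (.mul throughE throughE) (.get 10 (pairE 13 12)))
        (.get 10 (pairE 12 4))).eval s = c := by
      simp only [WExpr.eval, t2, q2, q3, hcdef]
    refine ⟨⟨p1, hfit⟩, fun hb => ?_, fun hb => ?_⟩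
    · rw [Test.Holds, heval, WExpr.eval, q1] at hb
      refine ⟨p1, hfit, ?_⟩
      rw [heval]
      obtain ⟨s', hs'⟩ : ∃ s' : Mem, s' = s.putW 10 (WExpr.eval s (pairE 13 4)) c := ⟨_, rfl⟩
      rw [← hs']
      have hc' : Ctx G n s' := by
        rw [hs']
        refine ⟨hc.size, hc.size2, fun u hu v hv => ?_⟩
        rw [Mem.putW_warr, if_neg (by decide)]
        exact hc.adj u hu v hv
      have hw : s'.wvar = s.wvar := by rw [hs']; rfl
      obtain ⟨p1', q1'⟩ := pairE_spec (x := 13) (y := 4) hW hc' (by rw [hw]; omega)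
        (by rw [hw]; omega)
      rw [hw, hi, hj] at q1'
      refine ⟨p1', trivial, hQ _ (Or.inl ⟨by exact_mod_cast hb, ?_, ?_⟩)⟩
      · intro a b' hab hb'
        simp only [Mem.putW_warr, hs', q1, pair_inj (show b' < n + 2 by omega)
          (show j < n + 2 by omega)]
        norm_num
      · intro a b' hab hb'
        simp only [Mem.putW_warr, q1', if_true, WExpr.eval, hw, hm,
          pair_inj (show b' < n + 2 by omega) (show j < n + 2 by omega)]
        rw [hs', Mem.putW_warr, if_neg (show ¬ 9 = 10 by decide)]
    · rw [Test.Holds, heval, WExpr.eval, q1, not_le] at hb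
      exact hQ s (Or.inr ⟨by exact_mod_cast hb, fun _ _ _ _ => rfl, fun _ _ _ _ => rfl⟩)

theorem HasInside.agree {c : Prog} {s s' : Mem} (h : HasInside n L R s) (hA : Agree c s s')
    (h8 : 8 ∉ c.warrs) : HasInside n L R s' := by
  unfold HasInside
  rw [hA.warr 8 h8]
  exact h

theorem wp_dpProg (hW : 4 * (n + 2) ^ 2 ≤ W) (hc : Ctx G n s) (hin : HasInside n L R s)
    (hM : IsModel G n L R) (hg : IsGain g) (hfg : StepGain b f g)
    (h0 : ∀ i j, dpVal b n s i j = 0)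
    (hQ : ∀ s', Agree (dpProg b) s s' → IsDPTable g n L R (dpVal b n s') (dpCh n s') → Q s') :
    wp f W (n + 2) (dpProg b) Q s := by
  have h1 := hc.size2
  have hnW : n + 3 ≤ W := by nlinarith
  -- Rows are filled from `n + 1` down to `0`: the cell `(i, j)` needs `(m, j)` with `m > i`, and
  -- `(i, m)` with `m < j` from its own row.
  refine wp_forUp (fun k s' => DPRows g n L R (dpVal b n s') (dpCh n s') k)
    (by cases b <;> decide) (by cases b <;> decide) (by decide) (by omega) (by omega) ?_ ?_ ?_
  · exact ⟨fun a b' hab hb hp => by omega, fun a b' _ _ _ => h0 a b'⟩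
  · intro k hk s₁ hA₁ hk₁ hI₁
    rw [h1] at hk
    have hc₁ : Ctx G n s₁ :=
      hc.agree hA₁ (by cases b <;> decide) (by cases b <;> decide) (by cases b <;> decide)
    have hin₁ := hin.agree hA₁ (by cases b <;> decide)
    refine wp_seq ⟨by simp; omega, ?_⟩
    obtain ⟨i, hi⟩ : ∃ i, i = n + 1 - k := ⟨_, rfl⟩
    obtain ⟨s₂, hs₂⟩ : ∃ s₂, s₂ = s₁.setW 13
      ((WExpr.sub (.sub (.var 1) (.lit 1)) (.var 3)).eval s₁) := ⟨_, rfl⟩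
    rw [← hs₂]
    have hc₂ : Ctx G n s₂ := by
      rw [hs₂]
      exact ⟨by simp [hc₁.size], by simp [hc₁.size2], hc₁.adj⟩
    have hi₂ : s₂.wvar 13 = i := by
      rw [hs₂, hi]
      simp [hc₁.size2, hk₁]
    have hin₂ : HasInside n L R s₂ := by rw [hs₂]; exact hin₁
    have hI₂ : DPInv g n L R (dpVal b n s₂) (dpCh n s₂) i 0 0 := by
      rw [hs₂, hi]
      exact hI₁.inv hk
    refine wp_forUp (fun j s' => DPInv g n L R (dpVal b n s') (dpCh n s') i j 0)
      (by cases b <;> decide) (by cases b <;> decide) (by decide) (by simp [hc₂.size2])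
      (by simp [hc₂.size2]; omega) hI₂ ?_ ?_
    · intro j hj s₃ hA₃ hj₃ hI₃
      rw [hc₂.size2] at hj
      have hc₃ : Ctx G n s₃ :=
        hc₂.agree hA₃ (by cases b <;> decide) (by cases b <;> decide) (by cases b <;> decide)
      have hin₃ := hin₂.agree hA₃ (by cases b <;> decide)
      have hi₃ : s₃.wvar 13 = i := (hA₃.wvar 13 (by cases b <;> decide)).trans hi₂
      refine wp_forUp (fun m s' => DPInv g n L R (dpVal b n s') (dpCh n s') i j m)
        (by cases b <;> decide) (by cases b <;> decide) (by decide) (by simp [hc₃.size2])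
        (by simp [hc₃.size2]; omega) hI₃ ?_ ?_
      · intro m hm s₄ hA₄ hm₄ hI₄
        rw [hc₃.size2] at hm
        have hc₄ : Ctx G n s₄ :=
          hc₃.agree hA₄ (by cases b <;> decide) (by cases b <;> decide) (by cases b <;> decide)
        have hin₄ := hin₃.agree hA₄ (by cases b <;> decide)
        have hi₄ : s₄.wvar 13 = i := (hA₄.wvar 13 (by cases b <;> decide)).trans hi₃
        have hj₄ : s₄.wvar 4 = j := (hA₄.wvar 4 (by cases b <;> decide)).trans hj₃
        refine ⟨by simp, fun hb => ?_, fun hb => ?_⟩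
        · simp [hi₄, hj₄, hm₄] at hb
          refine wp_dpStep hW hc₄ hin₄ hM hg hfg hi₄ hj₄ hm₄ hb.1 hb.2 (by omega)
            (fun a b' hab hb' => hI₄.cell_bounds hg hab hb') fun s₅ h₅ => ?_
          exact hI₄.try_choice hM hg hb.1 hb.2 (by omega) h₅
        · simp [hi₄, hj₄, hm₄] at hb
          exact hI₄.skip_choice (by omega)
      · intro s₄ _ _ hI₄
        rw [hc₃.size2] at hI₄
        exact hI₄.next_col hg
    · intro s₃ _ _ hI₃
      rw [hc₂.size2, hi] at hI₃
      exact hI₃.rows hk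
  · intro s₁ hA₁ _ hI₁
    rw [h1] at hI₁
    exact hQ s₁ hA₁ hI₁.isDPTable

end

/-! ### The program that reads off the partition -/

/-- Descend once. -/
def walkStep : Prog :=
  .seq (.wset 12 (.get 9 (pairE 13 14)))
  (.ite (.neg (.wle (.var 12) (.get 7 (.var 3)))) (.wset 14 (.var 12))
    (.ite (.neg (.wle (.get 6 (.var 3)) (.var 12))) (.wset 13 (.var 12)) .skip))

/-- Compute the labels of the vertices. -/
def walkProg : Prog :=
  forUp 3 0 (.seq (.wset 13 (.lit 0)) (.seq (.wset 14 (.sub (.var 1) (.lit 1)))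
    (.seq (forUp 4 1 walkStep) (.wput 1 (.var 3) (.get 9 (pairE 13 14))))))

section

variable {f g : ℕ → ℝ} {W : ℕ} {G : SimpleGraph ℕ} {n : ℕ} {s : Mem} {Q : Mem → Prop}
  {best : ℕ → ℕ → ℝ}

theorem wp_walkProg (hW : 4 * (n + 2) ^ 2 ≤ W) (hc : Ctx G n s)
    (hM : IsModel G n (s.warr 6) (s.warr 7))
    (hT : IsDPTable g n (s.warr 6) (s.warr 7) best (dpCh n s))
    (hQ : ∀ s', Agree walkProg s s' →
      (∀ v < n, Reach (s.warr 6) (s.warr 7) (dpCh n s) v 0 (n + 1) (s'.warr 1 v)) → Q s') :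
    wp f W (n + 2) walkProg Q s := by
  have h0 := hc.size
  have hnW : n + 3 ≤ W := by nlinarith
  have hW1 : 1 ≤ W := by omega
  refine wp_forUp (fun i s' => ∀ v < i, Reach (s.warr 6) (s.warr 7) (dpCh n s) v 0 (n + 1)
    (s'.warr 1 v)) (by decide) (by decide) (by decide) (by omega) (by omega) (by simp) ?_ ?_
  · intro v hv s₁ hA₁ hv₁ hI₁
    rw [h0] at hv
    have hc₁ : Ctx G n s₁ := hc.agree hA₁ (by decide) (by decide) (by decide)
    have e6₁ : s₁.warr 6 = s.warr 6 := hA₁.warr 6 (by decide)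
    have e7₁ : s₁.warr 7 = s.warr 7 := hA₁.warr 7 (by decide)
    have e9₁ : s₁.warr 9 = s.warr 9 := hA₁.warr 9 (by decide)
    have l1 := hM.one_le v hv
    have l2 := hM.le v hv
    have l3 := hM.le_n v hv
    refine wp_seq ⟨by simp, wp_seq ⟨by simp [hW1], ?_⟩⟩
    obtain ⟨s₂, hs₂⟩ : ∃ s₂, s₂ = (s₁.setW 13 ((WExpr.lit 0).eval s₁)).setW 14
      ((WExpr.sub (.var 1) (.lit 1)).eval (s₁.setW 13 ((WExpr.lit 0).eval s₁))) := ⟨_, rfl⟩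
    rw [← hs₂]
    have hc₂ : Ctx G n s₂ := by
      rw [hs₂]
      exact ⟨by simp [hc₁.size], by simp [hc₁.size2], hc₁.adj⟩
    have w13 : s₂.wvar 13 = 0 := by simp [hs₂]
    have w14 : s₂.wvar 14 = n + 1 := by simp [hs₂, hc₁.size2]
    have w3 : s₂.wvar 3 = v := by simp [hs₂, hv₁]
    have wr : s₂.warr = s₁.warr := by rw [hs₂]; rfl
    -- The interval of `v` stays strictly inside the current window. Either the choice there already
    -- hits it, or the window has shrunk by one in each of the `t` steps. After `n + 2` steps only
    -- the first is possible, as the initial width is `n + 1`.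
    refine wp_seq (wp_forUp (fun t s' => s'.wvar 13 < s.warr 6 v ∧ s.warr 7 v < s'.wvar 14 ∧
      s'.wvar 14 ≤ n + 1 ∧
      (∀ c, Reach (s.warr 6) (s.warr 7) (dpCh n s) v (s'.wvar 13) (s'.wvar 14) c →
        Reach (s.warr 6) (s.warr 7) (dpCh n s) v 0 (n + 1) c) ∧
      ((s.warr 6 v ≤ dpCh n s (s'.wvar 13) (s'.wvar 14) ∧
        dpCh n s (s'.wvar 13) (s'.wvar 14) ≤ s.warr 7 v) ∨
        s'.wvar 14 + t ≤ s'.wvar 13 + (n + 1)))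
      (by decide) (by decide) (by decide) (by simp [hc₂.size2]) (by simp [hc₂.size2]; omega)
      ?_ ?_ ?_)
    · simp only [Mem.setW_wvar, w13, w14]
      norm_num
      omega
    · rintro t ht s₃ hA₃ _ ⟨i1, i2, i3, i4, i5⟩
      have hc₃ : Ctx G n s₃ := hc₂.agree hA₃ (by decide) (by decide) (by decide)
      have e3 : s₃.wvar 3 = v := (hA₃.wvar 3 (by decide)).trans w3
      have e6 : s₃.warr 6 = s.warr 6 := by rw [hA₃.warr 6 (by decide), wr, e6₁]
      have e7 : s₃.warr 7 = s.warr 7 := by rw [hA₃.warr 7 (by decide), wr, e7₁]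
      have e9 : s₃.warr 9 = s.warr 9 := by rw [hA₃.warr 9 (by decide), wr, e9₁]
      obtain ⟨p1, q1⟩ := pairE_spec (x := 13) (y := 14) hW hc₃ (by omega) (by omega)
      obtain ⟨lo, hlo⟩ : ∃ lo, lo = s₃.wvar 13 := ⟨_, rfl⟩
      obtain ⟨hi, hhi⟩ : ∃ hi, hi = s₃.wvar 14 := ⟨_, rfl⟩
      simp only [← hlo, ← hhi] at i1 i2 i3 i4 i5 q1
      obtain ⟨m, hm⟩ : ∃ m, m = dpCh n s lo hi := ⟨_, rfl⟩
      have hmem := hT.ch_mem lo hi (by omega) i3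
      have hget : (WExpr.get 9 (pairE 13 14)).eval s₃ = m := by
        rw [WExpr.eval, q1, e9, hm, dpCh]
      rw [← hm] at hmem i5
      refine wp_seq ⟨p1, ?_⟩
      rw [hget]
      refine ⟨by simp, fun hb => ?_, fun hb => ⟨by simp, fun hb' => ?_, fun hb' => ?_⟩⟩
      · simp [e3, e7] at hb
        simp only [wp, WExpr.Fits, WExpr.eval, Mem.setW_wvar, true_and]
        norm_num [← hlo]
        refine ⟨i1, hb, by omega, fun c hr => i4 c (.left (hm ▸ hb) (hm ▸ hr)), Or.inr ?_⟩
        omega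
      · simp [e3, e6, e7] at hb hb'
        simp only [wp, WExpr.Fits, WExpr.eval, Mem.setW_wvar, true_and]
        norm_num [← hhi]
        refine ⟨hb', i2, i3, fun c hr => i4 c (.right (hm ▸ hb') (hm ▸ hr)), Or.inr ?_⟩
        omega
      · simp [e3, e6, e7] at hb hb'
        simp only [wp, Mem.setW_wvar]
        norm_num [← hlo, ← hhi, ← hm]
        exact ⟨i1, i2, i3, i4, Or.inl ⟨hb', hb⟩⟩
    · rintro s₃ hA₃ - ⟨i1, i2, i3, i4, i5⟩
      have hc₃ : Ctx G n s₃ := hc₂.agree hA₃ (by decide) (by decide) (by decide)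
      have e3 : s₃.wvar 3 = v := (hA₃.wvar 3 (by decide)).trans w3
      have e9 : s₃.warr 9 = s.warr 9 := by rw [hA₃.warr 9 (by decide), wr, e9₁]
      have e1 : s₃.warr 1 = s₁.warr 1 := by rw [hA₃.warr 1 (by decide), wr]
      obtain ⟨p1, q1⟩ := pairE_spec (x := 13) (y := 14) hW hc₃ (by omega) (by omega)
      rw [hc₂.size2] at i5
      have i5 := i5.resolve_right fun h => by omega
      have hget : (WExpr.get 9 (pairE 13 14)).eval s₃
          = dpCh n s (s₃.wvar 13) (s₃.wvar 14) := by
        rw [WExpr.eval, q1, e9, dpCh]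
      refine ⟨trivial, p1, ?_⟩
      rw [hget]
      intro u hu
      simp only [Mem.setW_warr, Mem.putW_warr, WExpr.eval, e3, e1, if_true]
      by_cases e : u = v
      · subst e
        simp only [if_true]
        exact i4 _ (.here i5.1 i5.2)
      · simp only [if_neg e]
        exact hI₁ u (by omega)
  · intro s₁ hA₁ _ hI
    rw [h0] at hI
    exact hQ s₁ hA₁ hI

end

/-! ### The complete program -/

/-- The complete program. -/
def cliqueProg (b : Bool) : Prog :=
  .seq (.wset 1 (.add (.var 0) (.lit 2))) (.seq rankProg (.seq leftProg (.seq rightProg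
    (.seq insideProg (.seq (dpProg b) walkProg)))))

theorem wp_cliqueProg {f g : ℕ → ℝ} {W n : ℕ} {b : Bool} {G : SimpleGraph ℕ} {s : Mem}
    {P : ℕ → ℕ → Prop} (hW : 4 * (n + 2) ^ 2 ≤ W) (hP : IsIntervalOrderOn G {v | v < n} P)
    (hg : IsGain g) (hfg : StepGain b f g) (h0 : s.wvar 0 = n)
    (hadj : ∀ u < n, ∀ v < n, s.warr 0 (u * n + v) = adjNat G u v)
    (h2 : ∀ i, s.warr 2 i = 0) (h10 : ∀ i, s.warr 10 i = 0) (hr : ∀ i, s.rarr 0 i = 0) :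
    wp f W (n + 2) (cliqueProg b) (fun s' =>
      (∀ u < n, ∀ v < n, u ≠ v → s'.warr 1 u = s'.warr 1 v → G.Adj u v) ∧
      ∀ ψ : ℕ → ℕ, (∀ u < n, ∀ v < n, u ≠ v → ψ u = ψ v → G.Adj u v) →
        gainValue g n ψ ≤ gainValue g n (s'.warr 1)) s := by
  have hnW : n + 2 ≤ W := by nlinarith
  refine wp_seq ⟨by simp [h0]; omega, ?_⟩
  obtain ⟨s₁, hs₁⟩ : ∃ s₁, s₁ = s.setW 1 ((WExpr.add (.var 0) (.lit 2)).eval s) := ⟨_, rfl⟩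
  rw [← hs₁]
  have hc₁ : Ctx G n s₁ := by
    rw [hs₁]
    exact ⟨by simp [h0], by simp [h0], hadj⟩
  have w₁ : s₁.warr = s.warr := by rw [hs₁]; rfl
  have r₁ : s₁.rarr = s.rarr := by rw [hs₁]; rfl
  refine wp_seq (wp_rankProg hW hc₁ (RankInv.init hP fun v _ => by rw [w₁]; exact h2 v)
    fun s₂ hA₂ hcons hinj => ?_)
  have hc₂ := hc₁.agree hA₂ (by decide) (by decide) (by decide)
  refine wp_seq (wp_leftProg hW hc₂ fun s₃ hA₃ hL => ?_)
  have hc₃ := hc₂.agree hA₃ (by decide) (by decide) (by decide)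
  refine wp_seq (wp_rightProg hW hc₃ fun s₄ hA₄ hR => ?_)
  have hc₄ := hc₃.agree hA₄ (by decide) (by decide) (by decide)
  have e6 : s₄.warr 6 = s₃.warr 6 := hA₄.warr 6 (by decide)
  have hM : IsModel G n (s₄.warr 6) (s₄.warr 7) := by
    rw [e6]
    exact hcons.isModel hinj hL hR
  refine wp_seq (wp_insideProg hW hc₄ fun s₅ hA₅ hin => ?_)
  have hc₅ := hc₄.agree hA₅ (by decide) (by decide) (by decide)
  have hv0 : ∀ i j, dpVal b n s₅ i j = 0 := by
    intro i j
    unfold dpVal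
    rw [hA₅.rarr 0 (by decide), hA₄.rarr 0 (by decide), hA₃.rarr 0 (by decide),
      hA₂.rarr 0 (by decide), r₁, hr, hA₅.warr 10 (by decide), hA₄.warr 10 (by decide),
      hA₃.warr 10 (by decide), hA₂.warr 10 (by decide), w₁, h10]
    simp
  have e6₅ : s₅.warr 6 = s₄.warr 6 := hA₅.warr 6 (by decide)
  have e7₅ : s₅.warr 7 = s₄.warr 7 := hA₅.warr 7 (by decide)
  refine wp_seq (wp_dpProg hW hc₅ hin hM hg hfg hv0 fun s₆ hA₆ hT => ?_)
  have hc₆ := hc₅.agree hA₆ (by cases b <;> decide) (by cases b <;> decide)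
    (by cases b <;> decide)
  have e6₆ : s₆.warr 6 = s₄.warr 6 := (hA₆.warr 6 (by cases b <;> decide)).trans e6₅
  have e7₆ : s₆.warr 7 = s₄.warr 7 := (hA₆.warr 7 (by cases b <;> decide)).trans e7₅
  rw [← e6₆, ← e7₆] at hM hT
  exact wp_walkProg hW hc₆ hM hT fun s₇ _ hreach => hT.optimal hM hg hreach

theorem depth_cliqueProg (b : Bool) : (cliqueProg b).depth = 3 := by
  cases b <;> decide

/-! ### Transfer to graphs on `Fin n` -/

/-- The graph on the natural numbers that extends `G` by isolated vertices. -/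
def natGraph {n : ℕ} (G : SimpleGraph (Fin n)) : SimpleGraph ℕ := G.map Fin.valEmbedding

theorem natGraph_adj {n : ℕ} {G : SimpleGraph (Fin n)} {u v : Fin n} :
    (natGraph G).Adj u v ↔ G.Adj u v :=
  SimpleGraph.map_adj_apply (f := Fin.valEmbedding)

/-- The order is "entirely to the left of". The Ferrers property follows by comparing the two right
endpoints. -/
theorem IsIntervalGraph.exists_order {n : ℕ} {G : SimpleGraph (Fin n)} (h : IsIntervalGraph G) :
    ∃ P, IsIntervalOrderOn (natGraph G) {v | v < n} P := by
  obtain ⟨l, r, hlr, hadj⟩ := h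
  refine ⟨fun u v => ∃ (hu : u < n) (hv : v < n), r ⟨u, hu⟩ < l ⟨v, hv⟩, ?_, ?_, ?_⟩
  · rintro a - ⟨ha, ha', hlt⟩
    exact absurd (hlr ⟨a, ha⟩) (not_le.2 hlt)
  · rintro a - b - c - d - ⟨ha, hb, hab⟩ ⟨hc, hd, hcd⟩
    rcases le_total (r ⟨a, ha⟩) (r ⟨c, hc⟩) with h1 | h1
    · exact Or.inl ⟨ha, hd, h1.trans_lt hcd⟩
    · exact Or.inr ⟨hc, hb, h1.trans_lt hab⟩
  · intro a ha b hb hne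
    have e : (natGraph G).Adj a b ↔ G.Adj ⟨a, ha⟩ ⟨b, hb⟩ :=
      natGraph_adj (u := ⟨a, ha⟩) (v := ⟨b, hb⟩)
    have ha' : a < n := ha
    have hb' : b < n := hb
    rw [e, hadj _ _ (by simpa using hne), Set.Icc_inter_Icc, Set.nonempty_Icc, sup_le_iff,
      le_inf_iff, le_inf_iff]
    simp only [ha', hb', exists_true_left, not_lt]
    have h1 := hlr ⟨a, ha⟩
    have h2 := hlr ⟨b, hb⟩
    constructor
    · rintro ⟨⟨-, h3⟩, h4, -⟩
      exact ⟨h4, h3⟩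
    · rintro ⟨h3, h4⟩
      exact ⟨⟨h1, h4⟩, h3, h2⟩

theorem inputMem_adj {n : ℕ} (G : SimpleGraph (Fin n)) {u v : ℕ} (hu : u < n) (hv : v < n) :
    (inputMem G).warr 0 (u * n + v) = adjNat (natGraph G) u v := by
  have e : (natGraph G).Adj u v ↔ G.Adj ⟨u, hu⟩ ⟨v, hv⟩ :=
    natGraph_adj (u := ⟨u, hu⟩) (v := ⟨v, hv⟩)
  have e' : (∃ u' v' : Fin n, u * n + v = (u' : ℕ) * n + (v' : ℕ) ∧ G.Adj u' v') ↔
      (natGraph G).Adj u v := by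
    refine ⟨?_, fun h => ⟨⟨u, hu⟩, ⟨v, hv⟩, rfl, e.1 h⟩⟩
    rintro ⟨u', v', h1, h2⟩
    obtain ⟨h3, h4⟩ := (pair_inj hv v'.2).1 h1
    have e1 : u' = ⟨u, hu⟩ := Fin.ext h3.symm
    have e2 : v' = ⟨v, hv⟩ := Fin.ext h4.symm
    rw [e1, e2] at h2
    exact e.2 h2
  simp only [inputMem, Function.update_self, adjNat]
  by_cases h : (natGraph G).Adj u v
  · rw [if_pos (e'.2 h), if_pos h]
  · rw [if_neg (fun h' => h (e'.1 h')), if_neg h]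

theorem partSize_eq {n : ℕ} (φ : ℕ → ℕ) (v : Fin n) :
    partSize (fun w : Fin n => φ w) v = ((Finset.range n).filter fun w => φ w = φ v).card := by
  rw [partSize, Finset.card_filter, Finset.card_filter, Finset.sum_range]

/-- Each part of size `a` contributes `h a` once for each of its `a` vertices. -/
theorem gainValue_eq_sum {n : ℕ} {g h : ℕ → ℝ} (hgh : ∀ a : ℕ, 0 < a → g a = a * h a)
    (φ : ℕ → ℕ) : gainValue g n φ = ∑ v : Fin n, h (partSize (fun w : Fin n => φ w) v) := by
  simp only [partSize_eq]
  rw [← Finset.sum_range (fun v => h ((Finset.range n).filter fun w => φ w = φ v).card),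
    Finset.sum_comp (fun c => h ((Finset.range n).filter fun w => φ w = c).card) φ, gainValue]
  refine Finset.sum_congr rfl fun c hc => ?_
  rw [nsmul_eq_mul, hgh]
  obtain ⟨v, hv, rfl⟩ := Finset.mem_image.1 hc
  exact Finset.card_pos.2 ⟨v, Finset.mem_filter.2 ⟨hv, rfl⟩⟩

theorem exists_run {f g h : ℕ → ℝ} {n : ℕ} {b : Bool} {G : SimpleGraph (Fin n)}
    (hG : IsIntervalGraph G) (hg : IsGain g) (hgh : ∀ a : ℕ, 0 < a → g a = a * h a)
    (hfg : StepGain b f g) :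
    ∃ (s : Mem) (t : ℕ), Run f ((n + 2) ^ 4) (cliqueProg b) (inputMem G) s t ∧
      t ≤ (cliqueProg b).factor * 64 * (n ^ 3 + 1) ∧ IsCliquePartition G (output n s) ∧
      ∀ ψ, IsCliquePartition G ψ →
        ∑ v, h (partSize ψ v) ≤ ∑ v, h (partSize (output n s) v) := by
  obtain ⟨P, hP⟩ := hG.exists_order
  have hW : 4 * (n + 2) ^ 2 ≤ (n + 2) ^ 4 := by
    have : (n + 2) ^ 4 = (n + 2) ^ 2 * (n + 2) ^ 2 := by ring
    rw [this]
    exact Nat.mul_le_mul_right _ (Nat.pow_le_pow_left (by omega : 2 ≤ n + 2) 2)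
  obtain ⟨s, t, hrun, ht, hcl, hopt⟩ := wp_sound (wp_cliqueProg (s := inputMem G) hW hP hg hfg
    (by simp [inputMem]) (fun u hu v hv => inputMem_adj G hu hv) (by simp [inputMem])
    (by simp [inputMem]) (by simp [inputMem]))
  -- For `n ≥ 1` this is `n + 3 ≤ 4 * n` cubed; the summand `1` covers `n = 0`.
  have hbound : (n + 2 + 1) ^ 3 ≤ 64 * (n ^ 3 + 1) := by
    rcases Nat.eq_zero_or_pos n with rfl | hn
    · norm_num
    · have h1 : n ≤ n ^ 3 := Nat.le_self_pow (by norm_num) n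
      have h2 : n ^ 2 ≤ n ^ 3 := Nat.pow_le_pow_right hn (by norm_num)
      nlinarith
  refine ⟨s, t, hrun, ht.trans ?_, ?_, ?_⟩
  · rw [depth_cliqueProg, mul_assoc]
    exact Nat.mul_le_mul_left _ hbound
  · intro u v hne e
    exact natGraph_adj.1 (hcl u u.2 v v.2 (fun h => hne (Fin.ext h)) e)
  · intro ψ hψ
    have hopt := hopt (fun v => if hv : v < n then ψ ⟨v, hv⟩ else 0) (by
      intro u hu v hv hne e
      simp only [hu, hv, dif_pos] at e
      exact natGraph_adj (u := ⟨u, hu⟩) (v := ⟨v, hv⟩) |>.2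
        (hψ _ _ (fun h => hne (Fin.ext_iff.1 h)) e))
    rw [gainValue_eq_sum hgh, gainValue_eq_sum hgh] at hopt
    simp only [Fin.is_lt, dif_pos, Fin.eta] at hopt
    exact hopt

/-! ### The two objective functions -/

theorem isGain_rpow {p : ℝ} (hp : 0 < p) : IsGain fun a : ℕ => (a : ℝ) ^ (p + 1) := by
  refine ⟨?_, fun a => by positivity, fun a b d hdb hba => ?_⟩
  · simp [Real.zero_rpow (by linarith : p + 1 ≠ 0)]
  · rcases Nat.eq_zero_or_pos d with rfl | hd
    · simp
    have hconv := convexOn_rpow (by linarith : 1 ≤ p + 1)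
    push_cast [Nat.cast_sub hdb]
    have hd' : (0 : ℝ) < d := by exact_mod_cast hd
    have hdb' : (d : ℝ) ≤ b := by exact_mod_cast hdb
    have hba' : (b : ℝ) ≤ a := by exact_mod_cast hba
    have hD : (0 : ℝ) < a + d - (b - d) := by linarith
    -- Both `a` and `b` lie between `b - d` and `a + d`, at weights `1 - t` and `t` from the lower
    -- end. Adding the two convexity inequalities makes the weights cancel.
    obtain ⟨t, ht⟩ : ∃ t : ℝ, t = d / (a + d - (b - d)) := ⟨_, rfl⟩
    have ht0 : 0 ≤ t := by rw [ht]; positivity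
    have ht1 : t ≤ 1 := by rw [ht, div_le_one hD]; linarith
    have htD : t * (a + d - (b - d)) = d := by rw [ht]; field_simp
    have hx : (b - d : ℝ) ∈ Set.Ici (0 : ℝ) := by simpa using hdb'
    have hy : (a + d : ℝ) ∈ Set.Ici (0 : ℝ) := by
      rw [Set.mem_Ici]
      positivity
    have c1 := hconv.2 hx hy (by linarith : 0 ≤ 1 - t) ht0 (by ring)
    have c2 := hconv.2 hx hy ht0 (by linarith : 0 ≤ 1 - t) (by ring)
    simp only [smul_eq_mul] at c1 c2
    rw [show (1 - t) * ((b : ℝ) - d) + t * (a + d) = b by linarith] at c1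
    rw [show t * ((b : ℝ) - d) + (1 - t) * (a + d) = a by linarith] at c2
    linarith

theorem isGain_sq : IsGain fun a : ℕ => (a : ℝ) ^ 2 := by
  refine ⟨by simp, fun a => by positivity, fun a b d hdb hba => ?_⟩
  push_cast [Nat.cast_sub hdb]
  have hba' : (b : ℝ) ≤ a := by exact_mod_cast hba
  nlinarith [mul_nonneg (Nat.cast_nonneg (α := ℝ) d) (sub_nonneg.2 hba'), sq_nonneg (d : ℝ)]

theorem pMeanValue_mono {V : Type*} [Fintype V] {p : ℝ} (hp : 0 < p) {φ ψ : V → ℕ}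
    (h : ∑ v, (partSize ψ v : ℝ) ^ p ≤ ∑ v, (partSize φ v : ℝ) ^ p) :
    pMeanValue p ψ ≤ pMeanValue p φ := by
  unfold pMeanValue genMean
  gcongr

/-- The edges inside the parts form a graph `H`, a disjoint union of cliques, in which `v` has
degree `a_v - 1`. The identity is the handshake lemma for `H`. -/
theorem sum_partSize_eq {V : Type*} [Fintype V] {G : SimpleGraph V} {φ : V → ℕ}
    (hφ : IsCliquePartition G φ) :
    ∑ v, partSize φ v = 2 * edgesInside G φ + Fintype.card V := by
  classical
  let H : SimpleGraph V :=
    { Adj := fun u v => u ≠ v ∧ φ u = φ v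
      symm := ⟨fun u v h => ⟨h.1.symm, h.2.symm⟩⟩
      loopless := ⟨fun u h => h.1 rfl⟩ }
  have hset : {e ∈ G.edgeSet | ∀ u ∈ e, ∀ v ∈ e, φ u = φ v} = H.edgeSet := by
    ext e
    induction e using Sym2.ind with
    | _ u v =>
      simp only [Set.mem_ofPred_eq, SimpleGraph.mem_edgeSet, Sym2.mem_iff]
      constructor
      · rintro ⟨h1, h2⟩
        exact ⟨h1.ne, h2 u (Or.inl rfl) v (Or.inr rfl)⟩
      · rintro ⟨h1, h2⟩
        refine ⟨hφ u v h1 h2, ?_⟩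
        rintro x (rfl | rfl) y (rfl | rfl) <;> simp [h2]
  have hdeg : ∀ v, partSize φ v = H.degree v + 1 := by
    intro v
    have : (Finset.univ.filter fun w => φ w = φ v) = insert v (H.neighborFinset v) := by
      ext w
      simp only [Finset.mem_filter, Finset.mem_univ, true_and, Finset.mem_insert,
        SimpleGraph.mem_neighborFinset]
      by_cases e : w = v
      · simp [e]
      · simp only [e, false_or]
        exact ⟨fun h => ⟨fun h' => e h'.symm, h.symm⟩, fun h => h.2.symm⟩
    rw [partSize, this, Finset.card_insert_of_notMem (by simp),
      SimpleGraph.card_neighborFinset_eq_degree]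
  rw [edgesInside, hset, ← SimpleGraph.coe_edgeFinset, Set.ncard_coe_finset,
    ← H.sum_degrees_eq_twice_card_edges, Finset.sum_congr rfl fun v _ => hdeg v,
    Finset.sum_add_distrib]
  simp

theorem wordOnly_cliqueProg : (cliqueProg false).WordOnly := by
  simp [cliqueProg, rankProg, rankRound, repFill, splitFind, classFind, pivotKey, firstKey,
    rankUpdate, pick, pickRound, pickSelect, pickTest, pickMove, leftProg, rightProg, rightMax,
    insideProg, dpProg, dpStep, wordStep, walkProg, walkStep, forUp, findLast, countUp, weq,
    Prog.WordOnly, Test.WordOnly]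

end PMean

theorem mainTheorem10 :
    (∃ (c : PMean.Prog) (C k : ℕ), ∀ p : ℝ, 0 < p →
      ∀ (n : ℕ) (G : SimpleGraph (Fin n)), PMean.IsIntervalGraph G →
        ∃ (s : PMean.Mem) (t : ℕ),
          PMean.Run (fun a : ℕ => (a : ℝ) ^ (p + 1)) ((n + 2) ^ k) c (PMean.inputMem G) s t ∧
          t ≤ C * (n ^ 3 + 1) ∧
          PMean.IsMaxPMeanCliquePartition p G (PMean.output n s)) ∧
    (∃ (c : PMean.Prog) (C k : ℕ), c.WordOnly ∧
      ∀ (n : ℕ) (G : SimpleGraph (Fin n)), PMean.IsIntervalGraph G →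
        ∃ (s : PMean.Mem) (t : ℕ),
          PMean.Run (fun _ : ℕ => (0 : ℝ)) ((n + 2) ^ k) c (PMean.inputMem G) s t ∧
          t ≤ C * (n ^ 3 + 1) ∧
          PMean.IsMaxEdgeCliquePartition G (PMean.output n s)) := by
  constructor
  -- The exponent `4` comes from `4 * (n + 2) ^ 2 ≤ (n + 2) ^ 4`, which leaves room for table
  -- indices and values. The factor `64` comes from `(n + 3) ^ 3 ≤ 64 * (n ^ 3 + 1)`.
  · refine ⟨PMean.cliqueProg true, (PMean.cliqueProg true).factor * 64, 4, fun p hp n G hG => ?_⟩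
    obtain ⟨s, t, hrun, ht, hcl, hopt⟩ := PMean.exists_run (b := true)
      (f := fun a : ℕ => (a : ℝ) ^ (p + 1)) (h := fun a : ℕ => (a : ℝ) ^ p) hG (PMean.isGain_rpow hp)
      (fun a ha => by
        rw [Real.rpow_add (by exact_mod_cast ha), Real.rpow_one, mul_comm])
      (by simp [PMean.StepGain])
    exact ⟨s, t, hrun, ht, hcl, fun ψ hψ => PMean.pMeanValue_mono hp (hopt ψ hψ)⟩
  · refine ⟨PMean.cliqueProg false, (PMean.cliqueProg false).factor * 64, 4, PMean.wordOnly_cliqueProg, fun n G hG => ?_⟩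
    obtain ⟨s, t, hrun, ht, hcl, hopt⟩ := PMean.exists_run (b := false)
      (f := fun _ : ℕ => (0 : ℝ)) (h := fun a : ℕ => (a : ℝ)) hG PMean.isGain_sq
      (fun a _ => sq (a : ℝ)) (by simp [PMean.StepGain])
    refine ⟨s, t, hrun, ht, hcl, fun ψ hψ => ?_⟩
    have h1 := hopt ψ hψ
    have h2 : ∑ v, PMean.partSize ψ v ≤ ∑ v, PMean.partSize (PMean.output n s) v := by
      exact_mod_cast h1
    rw [PMean.sum_partSize_eq hψ, PMean.sum_partSize_eq hcl] at h2
    omega
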